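/- Let $q$ be a polynomial with nonnegative integer coefficients and let $\delta>0$. Then there are a polynomial $p$ with nonnegative integer coefficients and a function $\eta:\mathbb R\to\mathbb R$ with $\eta(x)\to0$ as $x\to\infty$, depending only on $q$ and $\delta$, such that the following holds for every $N$ and all real $h,t\ge0$. Put $n=\lceil\log_2N\rceil$. There is a quantum circuit, which depends only on $q,\delta,N,h,t$, that simulates $e^{-iHt}$ with error at most $\delta$ in at most $$p(n)\,(ht)^{1+\eta(ht)}$$ steps, for every $N\times N$ Hermitian matrix $H$ with $$\max_j\sqrt{\textstyle\sum_k|H_{kj}|^2}=h$$ whose graph of nonzero entries (the graph on $\{0,\dots,N-1\}$ in which $j,k$ are adjacent if and only if $H_{jk}\ne0$) is a tree without loops, for every choice of a root, and for all procedures that efficiently compute the following data of the weighted rooted tree: (i) (index-computability) the degree of any vertex $j$, the $k$th neighbor of $j$ for any index $k<\deg(j)$, in some ordering of the neighbors, and the index of a given neighbor of $j$ in this ordering; (ii) the index, among the neighbors of a vertex other than the root, of its parent; (iii) the distance of any vertex to the root; (iv) (integrable weights) the real and imaginary parts of the weights $w_{j,k}=H_{v j}$, where $v$ is the $k$th neighbor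 of $j$, up to an error of $2^{-b}h$, and the sums $\sum_{a\le k<c}|w_{j,k}|^2$ for $0\le a\le c\le\deg(j)$, up to an error of $2^{-b}h^2$, each for any requested number $b$ of bits. Here vertices are labeled by $n$-bit strings. A circuit acts on at least $n$ qubits by unitary gates on at most three qubits and by calls $|x,y\rangle\mapsto|x,y\oplus f(x)\rangle$ of the procedures $f$. A gate counts as one step, and a call of a procedure counts as $q(n+b)$ steps, where $b$ is the requested number of bits ($b=0$ in (i)-(iii)); "efficiently" means that this cost is polynomial. A circuit simulates $e^{-iHt}$ with error at most $\delta$ if it maps $|\psi\rangle|0\cdots0\rangle$ to within Euclidean distance $\delta\|\psi\|$ of $(e^{-iHt}|\psi\rangle)|0\cdots0\rangle$ for every $\psi\in\mathbb C^N$. -/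

import Mathlib

open Filter Topology

/-! ## Hamiltonians and their graphs -/

/-- `G` is the graph of nonzero entries of `H`. As `G` has no loops, the diagonal of `H` is zero. -/
def IsGraphOfNonzeroEntries {N : ℕ} (G : SimpleGraph (Fin N))
    (H : Matrix (Fin N) (Fin N) ℂ) : Prop :=
  ∀ j k, H j k ≠ 0 ↔ G.Adj j k

/-- `max_j √(∑_k |⟨k|H|j⟩|²)`. -/
noncomputable def maxColumnNorm {N : ℕ} (H : Matrix (Fin N) (Fin N) ℂ) : ℝ :=
  ⨆ j : Fin N, Real.sqrt (∑ k, ‖H k j‖ ^ 2)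

/-- The number of bits of a vertex label, `⌈log₂ N⌉`. -/
def labelBits (N : ℕ) : ℕ := Nat.clog 2 N

/-! ## Classical procedures describing a weighted rooted tree -/

/-- Procedures on natural numbers (vertex labels and indices). Real quantities are returned to
`b` bits of precision, where `b` is the first argument. What the procedures have to compute is
said in `DescribesTree`; on invalid arguments their values are arbitrary. -/
structure Procedures where
  /-- the degree of a vertex -/
  degree : ℕ → ℕ
  /-- `neighbor j k` is the neighbor of `j` with index `k` -/
  neighbor : ℕ → ℕ → ℕ
  /-- `position j v` is the index of the neighbor `v` of `j` -/
  position : ℕ → ℕ → ℕ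
  /-- the index of the parent among the neighbors -/
  parent : ℕ → ℕ
  /-- the distance to the root -/
  depth : ℕ → ℕ
  /-- real part of the weight of the edge from `j` to its neighbor with index `k` -/
  weightRe : ℕ → ℕ → ℕ → ℤ
  /-- imaginary part of the weight of the edge from `j` to its neighbor with index `k` -/
  weightIm : ℕ → ℕ → ℕ → ℤ
  /-- `integral b j a c`: sum of the squared moduli of the weights of the edges from `j` to its
  neighbors with index in `[a, c)` -/
  integral : ℕ → ℕ → ℕ → ℕ → ℤ

/-- The integer `z` represents the real number `x` with `b` bits of precision, in the unit `u`. -/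
def Represents (b : ℕ) (u : ℝ) (z : ℤ) (x : ℝ) : Prop :=
  |x - (z : ℝ) / 2 ^ b * u| ≤ u / 2 ^ b

/-- The degree of every vertex and its `k`th neighbor are computed by `P`, for an ordering of the
neighbors of each vertex in which the index of a neighbor can be computed as well. -/
structure IndexComputable {N : ℕ} (P : Procedures) (G : SimpleGraph (Fin N)) : Prop where
  degree_eq : ∀ j : Fin N, P.degree j = (G.neighborSet j).ncard
  neighbor_bijOn : ∀ j : Fin N,
    Set.BijOn (P.neighbor j) (Set.Iio (P.degree j)) {v | ∃ u : Fin N, G.Adj j u ∧ (u : ℕ) = v}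
  position_eq : ∀ j : Fin N, ∀ k < P.degree j, P.position j (P.neighbor j k) = k

/-- The weights of the edges from a vertex `j` are computed by `P`, and they are integrable: the
sums of their squared moduli over an interval of indices are computed by `P`. Only neighbors `v`
of `j` contribute to the sum, as `H v j = 0` for the others. -/
structure IntegrableWeights {N : ℕ} (P : Procedures) (H : Matrix (Fin N) (Fin N) ℂ) : Prop where
  weightRe_approx : ∀ (b : ℕ) (j v : Fin N) (k : ℕ), k < P.degree j → P.neighbor j k = v →
    Represents b (maxColumnNorm H) (P.weightRe b j k) (H v j).re
  weightIm_approx : ∀ (b : ℕ) (j v : Fin N) (k : ℕ), k < P.degree j → P.neighbor j k = v →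
    Represents b (maxColumnNorm H) (P.weightIm b j k) (H v j).im
  integral_approx : ∀ (b : ℕ) (j : Fin N) (a c : ℕ), a ≤ c → c ≤ P.degree j →
    Represents b (maxColumnNorm H ^ 2) (P.integral b j a c)
      (∑ v : Fin N, if a ≤ P.position j v ∧ P.position j v < c then ‖H v j‖ ^ 2 else 0)

/-- `P` describes the Hamiltonian `H` whose graph of nonzero entries is `G`, with root `r`. -/
structure DescribesTree {N : ℕ} (P : Procedures) (H : Matrix (Fin N) (Fin N) ℂ)
    (G : SimpleGraph (Fin N)) (r : Fin N) : Prop where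
  index : IndexComputable P G
  /-- The parent of `j` is its neighbor that is closer to the root. -/
  parent_eq : ∀ j : Fin N, j ≠ r → P.parent j < P.degree j ∧
    ∃ u : Fin N, G.Adj j u ∧ G.dist r u + 1 = G.dist r j ∧ P.neighbor j (P.parent j) = u
  depth_eq : ∀ j : Fin N, P.depth j = G.dist r j
  weights : IntegrableWeights P H

/-! ## Quantum circuits calling the procedures, and their cost -/

/-- The procedures that a circuit may call; real quantities with a number `b` of bits. -/
inductive Query : Type
  | degree | neighbor | position | parent | depth
  | weightRe (b : ℕ) | weightIm (b : ℕ) | integral (b : ℕ)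

/-- The number of arguments, each of them an `n`-bit number. -/
@[reducible] def Query.arity : Query → ℕ
  | .degree => 1
  | .neighbor => 2
  | .position => 2
  | .parent => 1
  | .depth => 1
  | .weightRe _ => 2
  | .weightIm _ => 2
  | .integral _ => 3

/-- The requested number of bits of precision. -/
def Query.precision : Query → ℕ
  | .weightRe b => b
  | .weightIm b => b
  | .integral b => b
  | _ => 0

/-- The number of output bits. Approximate real quantities, which are integers in
`[-(2 ^ b + 1), 2 ^ b + 1]`, are returned in two's complement. -/
def Query.width (n : ℕ) : Query → ℕ
  | .weightRe b => b + 2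
  | .weightIm b => b + 2
  | .integral b => b + 2
  | _ => n

/-- The answer to a query. -/
def Procedures.answer (P : Procedures) : (f : Query) → (Fin f.arity → ℕ) → ℤ
  | .degree, x => P.degree (x 0)
  | .neighbor, x => P.neighbor (x 0) (x 1)
  | .position, x => P.position (x 0) (x 1)
  | .parent, x => P.parent (x 0)
  | .depth, x => P.depth (x 0)
  | .weightRe b, x => P.weightRe b (x 0) (x 1)
  | .weightIm b, x => P.weightIm b (x 0) (x 1)
  | .integral b, x => P.integral b (x 0) (x 1) (x 2)

/-- An operation on `m` qubits: a unitary gate on at most three of them, or a call of one of the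
procedures with `n`-bit arguments read from the wires `inp`, the answer being added bitwise modulo
2 to the wires `out`. -/
inductive Gate (n m : ℕ) : Type
  | unitary (k : ℕ) (hk : k ≤ 3) (e : Fin k ↪ Fin m) (U : Matrix.unitaryGroup (Fin k → Bool) ℂ)
  | call (f : Query) (inp : Fin f.arity → Fin n → Fin m) (out : Fin (f.width n) ↪ Fin m)
      (disjoint : ∀ a i o, inp a i ≠ out o)

/-- Amplitudes of `m` qubits in the computational basis. -/
abbrev QState (m : ℕ) : Type := (Fin m → Bool) → ℂ

/-- The effect of a procedure call on a computational basis state: `|x, y⟩ ↦ |x, y ⊕ f(x)⟩`. -/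
noncomputable def callBasis {n m : ℕ} (P : Procedures) (f : Query)
    (inp : Fin f.arity → Fin n → Fin m) (out : Fin (f.width n) ↪ Fin m)
    (x : Fin m → Bool) : Fin m → Bool := fun w =>
  xor (x w) (Function.extend out
    (fun i => Int.testBit (P.answer f (fun a => Nat.ofBits (fun l => x (inp a l)))) i)
    (fun _ => false) w)

/-- The action of an operation on amplitudes. The map `callBasis` is an involution. -/
noncomputable def Gate.apply {n m : ℕ} (P : Procedures) : Gate n m → QState m → QState m
  | .unitary _ _ e U, ψ => fun x => ∑ y, U.1 (x ∘ e) y * ψ (Function.extend e y x)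
  | .call f inp out _, ψ => fun x => ψ (callBasis P f inp out x)

/-- The number of steps of an operation: one for a unitary gate, and `q (n + b)` for a call of a
procedure on `n`-bit arguments with `b` bits of precision. -/
def Gate.cost {n m : ℕ} (q : Polynomial ℕ) : Gate n m → ℕ
  | .unitary _ _ _ _ => 1
  | .call f _ _ _ => q.eval (n + f.precision)

/-- A circuit: a sequence of operations, the first one acting first. -/
abbrev Circuit (n m : ℕ) : Type := List (Gate n m)

/-- The action of a circuit on amplitudes. -/
noncomputable def Circuit.run {n m : ℕ} (P : Procedures) (A : Circuit n m) (ψ : QState m) :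
    QState m :=
  A.foldl (fun φ g => g.apply P φ) ψ

/-- The number of steps of a circuit. -/
def Circuit.cost {n m : ℕ} (q : Polynomial ℕ) (A : Circuit n m) : ℕ :=
  (A.map (Gate.cost q)).sum

/-! ## Simulation -/

/-- The basis state `|j⟩|0 ⋯ 0⟩`: the binary digits of `j`, followed by zeros. -/
def basisLabel {N : ℕ} (m : ℕ) (j : Fin N) : Fin m → Bool := fun i => Nat.testBit j i

/-- A vector `ψ` of `ℂ^N` as the state `|ψ⟩|0 ⋯ 0⟩` of `m` qubits. -/
noncomputable def encode {N : ℕ} (m : ℕ) (ψ : Fin N → ℂ) : QState m := fun x =>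
  ∑ j, if x = basisLabel m j then ψ j else 0

/-- The circuit `A` implements the evolution `e^{-iHt}` with error at most `δ`, the ancillary
qubits being returned to zero. -/
def Simulates {N n m : ℕ} (P : Procedures) (A : Circuit n m) (H : Matrix (Fin N) (Fin N) ℂ)
    (t δ : ℝ) : Prop :=
  ∀ ψ : Fin N → ℂ,
    ‖WithLp.toLp 2 (A.run P (encode m ψ) -
        encode m (Matrix.mulVec (NormedSpace.exp ((-(Complex.I * (t : ℂ))) • H)) ψ))‖
      ≤ δ * ‖WithLp.toLp 2 ψ‖

/-! Orient every edge of the tree from child to parent. The edges whose child has depth of a fixed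
parity form disjoint stars, each consisting of a center and its children. The Hamiltonian is cut
into parts by this parity, by real or imaginary part, by sign, and by binary digit of the weight. In
the part of digit `e` every edge has weight zero or a fixed phase times `h / 2 ^ e`.

The main point is to simulate one such part although a star may have exponentially many leaves. An
edge whose digit `e` is set has squared weight at least `9/16 * h ^ 2 / 4 ^ e`. The approximate sum
of the squared weights preceding it at its center, with `2 * e + 4` bits of precision, is therefore
a mark that determines the edge, and binary search on these sums recovers the child from center and
mark (`DescribesTree.childVec_cumulative`). The unitary `edgeOp` sends a center to the uniform
superposition over all `2 ^ (2 * e + 6)` marks of the records (center, exclusive or of the two ends,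
mark), and a child to its single record, a role qubit telling the two cases apart. Conjugating a
one-qubit exchange of the role by this unitary couples child and center with amplitude `2 ^ (-(e +
3))` times a phase, exactly for the edges of the part (`partOp_center_child`). Hence `8 * h` times
the sum of the parts is the Hamiltonian with rounded weights
(`DescribesTree.norm_roundedHam_sub_le`).

The parts also move vertex states into states that are not vertex states. Averaging each part with
its conjugate by the reflection at the states with empty work qubits removes this leakage
(`pieceOp_false_add_true`), so the encoding of the vertices intertwines the resulting operator with
the rounded Hamiltonian and thus also their evolutions (`hamOp_mul_codeMat`, `exp_mul_of_mul_eq`).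
Each of the `16 * L` pieces is unitarily conjugate to a one-qubit Hamiltonian, so its evolution
costs two uses of a conjugating circuit and one rotation (`ImplUnitary.impl_exp`). The circuits come
from reversible computation of the classical functions on scratch qubits (`Avail.impl`).

The pieces are recombined by product formulas. For every order there is one whose error depends only
on the total norm of the exponents (`exists_formula_norm_sub_le`). With `x = h * t` this yields a
cost polynomial in the number of qubits, polylogarithmic in `x`, times `(x + 1) ^ (1 + 1 / (k +
1))`. Taking the cheapest order `k` for each `x` makes the excess of the exponent over one tend to
zero (`tendsto_excess`). -/

/-! ## Product formulas of arbitrarily high order -/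

namespace ProductFormula

set_option linter.unusedSectionVars false

open PowerSeries

/-! ### Formal power series of product formulas. -/

section Formal

variable {A : Type} [Ring A] [Algebra ℝ A]

/-- The power series `a(c τ)`. -/
noncomputable def dilate (c : ℝ) (a : PowerSeries A) : PowerSeries A :=
  PowerSeries.mk fun j => c ^ j • coeff j a

@[simp] lemma coeff_dilate (c : ℝ) (a : PowerSeries A) (j : ℕ) :
    coeff j (dilate c a) = c ^ j • coeff j a := by
  simp [dilate]

lemma dilate_mul (c : ℝ) (a b : PowerSeries A) :
    dilate c (a * b) = dilate c a * dilate c b := by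
  ext j
  simp only [coeff_dilate, coeff_mul, Finset.smul_sum]
  refine Finset.sum_congr rfl fun x hx => ?_
  rw [smul_mul_smul_comm, ← pow_add, Finset.HasAntidiagonal.mem_antidiagonal.1 hx]

lemma dilate_one (c : ℝ) : dilate c (1 : PowerSeries A) = 1 := by
  ext j
  rw [coeff_dilate, coeff_one]
  split_ifs with h <;> simp [h]

lemma dilate_dilate (c d : ℝ) (a : PowerSeries A) : dilate c (dilate d a) = dilate (c * d) a := by
  ext j
  simp [smul_smul, mul_pow]

lemma one_dilate (a : PowerSeries A) : dilate 1 a = a := by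
  ext j
  simp

lemma dilate_list_prod (c : ℝ) (l : List (PowerSeries A)) :
    dilate c l.prod = (l.map (dilate c)).prod := by
  induction l with
  | nil => simp [dilate_one]
  | cons a l ih => simp [dilate_mul, ih]

/-- The power series of `e^{τ Y}`. -/
noncomputable def expSeries (Y : A) : PowerSeries A :=
  PowerSeries.mk fun j => ((j.factorial : ℝ)⁻¹) • Y ^ j

lemma expSeries_add (c d : ℝ) (Y : A) :
    dilate c (expSeries Y) * dilate d (expSeries Y) = dilate (c + d) (expSeries Y) := by
  ext j
  simp only [coeff_mul, coeff_dilate, expSeries, coeff_mk]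
  have h1 : ∀ x ∈ Finset.HasAntidiagonal.antidiagonal j,
      (c ^ x.1 • ((x.1.factorial : ℝ)⁻¹) • Y ^ x.1) * (d ^ x.2 • ((x.2.factorial : ℝ)⁻¹) • Y ^ x.2)
        = (((j.factorial : ℝ)⁻¹) * (c ^ x.1 * d ^ x.2 * (j.choose x.1 : ℝ))) • Y ^ j := by
    intro x hx
    have hx' := Finset.HasAntidiagonal.mem_antidiagonal.1 hx
    rw [smul_smul, smul_smul, smul_mul_smul_comm, ← pow_add, hx']
    congr 1
    have := Nat.add_choose_mul_factorial_mul_factorial x.1 x.2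
    rw [hx', ← Nat.choose_symm_of_eq_add hx'.symm] at this
    have h2 : ((j.choose x.1 : ℝ)) * x.1.factorial * x.2.factorial = j.factorial := by
      exact_mod_cast this
    have h3 : (x.1.factorial : ℝ) ≠ 0 := by positivity
    have h4 : (x.2.factorial : ℝ) ≠ 0 := by positivity
    have h5 : (j.factorial : ℝ) ≠ 0 := by positivity
    field_simp
    rw [← h2]; ring
  rw [Finset.sum_congr rfl h1, ← Finset.sum_smul, ← Finset.mul_sum, smul_smul, mul_comm,
    (Commute.all c d).add_pow', ]
  congr 2
  refine Finset.sum_congr rfl fun x _ => ?_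
  rw [nsmul_eq_mul]; ring

lemma zero_dilate_expSeries (Y : A) : dilate 0 (expSeries Y) = 1 := by
  ext j
  rw [coeff_dilate, coeff_one]
  split_ifs with h
  · subst h; simp [expSeries]
  · simp [h]

/-- The series agree up to the order `k`. -/
def AgreeTo (k : ℕ) (a b : PowerSeries A) : Prop := ∀ j ≤ k, coeff j a = coeff j b

lemma AgreeTo.mul {k : ℕ} {a b a' b' : PowerSeries A} (h : AgreeTo k a b) (h' : AgreeTo k a' b') :
    AgreeTo k (a * a') (b * b') := by
  intro j hj
  simp only [coeff_mul]
  refine Finset.sum_congr rfl fun x hx => ?_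
  have := Finset.HasAntidiagonal.mem_antidiagonal.1 hx
  rw [h _ (by omega), h' _ (by omega)]

lemma AgreeTo.dilate {k : ℕ} {a b : PowerSeries A} (h : AgreeTo k a b) (c : ℝ) :
    AgreeTo k (dilate c a) (dilate c b) := by
  intro j hj
  simp [h j hj]

lemma AgreeTo.succ {k : ℕ} {a b : PowerSeries A} (h : AgreeTo k a b)
    (h' : coeff (k + 1) a - coeff (k + 1) b = 0) : AgreeTo (k + 1) a b := by
  intro j hj
  rcases Nat.lt_or_ge j (k + 1) with h1 | h1
  · exact h j (by omega)
  · obtain rfl : j = k + 1 := by omega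
    exact sub_eq_zero.1 h'

/-- Leading errors add up. -/
lemma defect_mul {k : ℕ} {a b a' b' : PowerSeries A} (h : AgreeTo k a b) (h' : AgreeTo k a' b')
    (hb : coeff 0 b = 1) (hb' : coeff 0 b' = 1) :
    coeff (k + 1) (a * a') - coeff (k + 1) (b * b') =
      (coeff (k + 1) a - coeff (k + 1) b) + (coeff (k + 1) a' - coeff (k + 1) b') := by
  have e : a * a' - b * b' = (a - b) * a' + b * (a' - b') := by noncomm_ring
  have ha' : coeff 0 a' = 1 := by rw [h' 0 (Nat.zero_le _), hb']
  have e1 : coeff (k + 1) ((a - b) * a') = coeff (k + 1) a - coeff (k + 1) b := by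
    rw [coeff_mul, Finset.sum_eq_single (k + 1, 0)]
    · simp only [map_sub, ha', mul_one]
    · rintro ⟨x, y⟩ hx hne
      have hx' := Finset.HasAntidiagonal.mem_antidiagonal.1 hx
      have : x ≤ k := by
        by_contra hc
        apply hne
        simp only at hx'
        ext <;> simp <;> omega
      simp [h x this]
    · intro hx; simp at hx
  have e2 : coeff (k + 1) (b * (a' - b')) = coeff (k + 1) a' - coeff (k + 1) b' := by
    rw [coeff_mul, Finset.sum_eq_single (0, k + 1)]
    · simp only [map_sub, hb, one_mul]
    · rintro ⟨x, y⟩ hx hne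
      have hx' := Finset.HasAntidiagonal.mem_antidiagonal.1 hx
      have : y ≤ k := by
        by_contra hc
        apply hne
        simp only at hx'
        ext <;> simp <;> omega
      simp [h' y this]
    · intro hx; simp at hx
  rw [← map_sub, e, map_add, e1, e2]

/-- A product formula: a list of coefficients, with a mark for the reversed order of factors. -/
abbrev Formula : Type := List (ℝ × Bool)

/-- The product formula applied to `S` and its reversed `S'`. -/
noncomputable def Formula.series (l : Formula) (S S' : PowerSeries A) : PowerSeries A :=
  (l.map fun x => dilate x.1 (if x.2 then S' else S)).prod

noncomputable def Formula.dilate (c : ℝ) (l : Formula) : Formula := l.map fun x => (c * x.1, x.2)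

def Formula.reversed (l : Formula) : Formula := (l.map fun x => (x.1, !x.2)).reverse

lemma Formula.series_append (l l' : Formula) (S S' : PowerSeries A) :
    Formula.series (l ++ l') S S' = l.series S S' * Formula.series l' S S' := by
  simp [Formula.series]

lemma Formula.series_dilate (c : ℝ) (l : Formula) (S S' : PowerSeries A) :
    (l.dilate c).series S S' = ProductFormula.dilate c (l.series S S') := by
  simp only [Formula.series, Formula.dilate, dilate_list_prod, List.map_map]
  congr 1
  refine List.map_congr_left fun x _ => ?_
  simp [dilate_dilate]

/-- The reversed formula runs through the factors backwards and exchanges `S` with `S'`. At `-τ` its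
last factor is thus inverse to the first factor of the original, and the product collapses from the
middle. -/
lemma Formula.series_reversed_mul (l : Formula) {S S' : PowerSeries A}
    (h : ProductFormula.dilate (-1) S' * S = 1) (h' : S * ProductFormula.dilate (-1) S' = 1) :
    ProductFormula.dilate (-1) (l.reversed.series S S') * l.series S S' = 1 := by
  have h'' : ProductFormula.dilate (-1) S * S' = 1 := by
    have := congrArg (ProductFormula.dilate (-1)) h'
    rwa [dilate_mul, dilate_dilate, neg_one_mul, neg_neg, one_dilate, dilate_one] at this
  induction l with
  | nil => simp [Formula.series, Formula.reversed, dilate_one]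
  | cons x l ih =>
    have e1 : Formula.series (x :: l) S S' =
        ProductFormula.dilate x.1 (if x.2 then S' else S) * Formula.series l S S' := by
      simp [Formula.series]
    have e2 : Formula.series (Formula.reversed (x :: l)) S S' =
        Formula.series (Formula.reversed l) S S' * ProductFormula.dilate x.1 (if !x.2 then S' else S) := by
      simp [Formula.series, Formula.reversed]
    have e3 : ProductFormula.dilate (-1) (ProductFormula.dilate x.1 (if !x.2 then S' else S)) *
        ProductFormula.dilate x.1 (if x.2 then S' else S) = 1 := by
      rw [dilate_dilate, mul_comm, ← dilate_dilate, ← dilate_mul]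
      rcases x with ⟨c, b⟩
      cases b <;> simp [h, h'', dilate_one]
    rw [e1, e2, dilate_mul, mul_assoc, ← mul_assoc _ _ (Formula.series l S S'), e3, one_mul, ih]

end Formal

/-- Intermediate value theorem between `p = 0`, with value 1, and `p = 2`, where oddness gives `2 *
2 ^ m - 3 ^ m`, which is at most zero from `m = 3` on. The root makes the leading errors of three
dilated copies cancel while their lengths still add up to one. -/
lemma exists_suzuki_coefficient (k : ℕ) (hk : Odd (k + 1)) (hk1 : 1 ≤ k) :
    ∃ p : ℝ, p ^ (k + 1) + (1 - 2 * p) ^ (k + 1) + p ^ (k + 1) = 0 := by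
  have hc : Continuous fun p : ℝ => p ^ (k + 1) + (1 - 2 * p) ^ (k + 1) + p ^ (k + 1) := by
    fun_prop
  have h0 : (0 : ℝ) ≤ 0 ^ (k + 1) + (1 - 2 * 0) ^ (k + 1) + 0 ^ (k + 1) := by simp
  have h1 : (2 : ℝ) ^ (k + 1) + (1 - 2 * 2) ^ (k + 1) + 2 ^ (k + 1) ≤ 0 := by
    have : (1 - 2 * 2 : ℝ) = -3 := by norm_num
    rw [this, hk.neg_pow]
    have h2 : ∀ j : ℕ, (2 : ℝ) ^ (j + 2 + 1) + 2 ^ (j + 2 + 1) ≤ 3 ^ (j + 2 + 1) := by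
      intro j
      have : (2 : ℝ) ^ j ≤ 3 ^ j := pow_le_pow_left₀ (by norm_num) (by norm_num) _
      have h3 : (0 : ℝ) ≤ 3 ^ j := by positivity
      rw [pow_add, pow_add, pow_add, pow_add]
      linarith
    rcases k with _ | _ | j
    · omega
    · exact absurd hk (by decide)
    · linarith [h2 j]
  exact mem_range_of_exists_le_of_exists_ge hc ⟨2, h1⟩ ⟨0, h0⟩

/-- For every order there is a product formula. -/
theorem exists_formula (k : ℕ) : ∃ l : Formula, ∀ (A : Type) [Ring A] [Algebra ℝ A] (Y : A)
    (S S' : PowerSeries A), dilate (-1) S' * S = 1 → S * dilate (-1) S' = 1 →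
    coeff 0 S = 1 → coeff 1 S = Y → AgreeTo (k + 1) (l.series S S') (expSeries Y) := by
  induction k with
  | zero =>
    refine ⟨[(1, false)], fun A _ _ Y S S' _ _ h0 h1 j hj => ?_⟩
    have : j = 0 ∨ j = 1 := by omega
    rcases this with rfl | rfl <;> simp [Formula.series, expSeries, h0, h1]
  | succ k ih =>
    obtain ⟨l, hl⟩ := ih
    have hE0 : ∀ (A : Type) [Ring A] [Algebra ℝ A] (Y : A) (c : ℝ),
      coeff 0 (dilate c (expSeries Y)) = 1 := by
      intro A _ _ Y c; simp [expSeries]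
    -- The leading defect has order `k + 2`. If this is even, a formula followed by its reversal,
    -- each at half length, cancels it. If it is odd, three copies with the lengths `p`, `1 - 2 *
    -- p`, `p` do.
    rcases Nat.even_or_odd (k + 1 + 1) with hk | hk
    · refine ⟨l.dilate (1 / 2) ++ l.reversed.dilate (1 / 2), ?_⟩
      intro A _ _ Y S S' h h' h0 h1
      have hT := hl A Y S S' h h' h0 h1
      set T := l.series S S' with hTdef
      set T' := l.reversed.series S S' with hTdef'
      have hinv : dilate (-1) T' * T = 1 := l.series_reversed_mul h h'
      have hEE : expSeries Y * dilate (-1) (expSeries Y) = 1 := by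
        have := expSeries_add 1 (-1) Y
        rwa [one_dilate, add_neg_cancel, zero_dilate_expSeries] at this
      have hEE' : dilate (-1) (expSeries Y) * expSeries Y = 1 := by
        have := expSeries_add (-1) 1 Y
        rwa [one_dilate, neg_add_cancel, zero_dilate_expSeries] at this
      -- Agreement passes to inverses: multiply the agreement of `T` with the exponential by the
      -- inverses of both.
      have hT' : AgreeTo (k + 1) (dilate (-1) T') (dilate (-1) (expSeries Y)) := by
        have e : AgreeTo (k + 1) (dilate (-1) T' * (T * dilate (-1) (expSeries Y)))
            (dilate (-1) T' * (expSeries Y * dilate (-1) (expSeries Y))) :=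
          AgreeTo.mul (fun _ _ => rfl) (AgreeTo.mul hT fun _ _ => rfl)
        rw [hEE, mul_one, ← mul_assoc, hinv, one_mul] at e
        exact fun j hj => (e j hj).symm
      have hE00 : coeff 0 (expSeries Y) = 1 := by simpa [one_dilate] using hE0 A Y 1
      -- Both products are 1, so the defects of `T'` at `-τ` and of `T` at `τ` are opposite. In even
      -- order the sign change of `τ` does not affect the defect of `T'`.
      have hd := defect_mul hT' hT (hE0 A Y (-1)) hE00
      rw [hinv, hEE', sub_self] at hd
      have hT'' : AgreeTo (k + 1) T' (expSeries Y) := by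
        have := hT'.dilate (-1)
        simpa [dilate_dilate, one_dilate] using this
      have hpow : ((-1 : ℝ)) ^ (k + 1 + 1) = 1 := hk.neg_one_pow
      rw [coeff_dilate, coeff_dilate, hpow, one_smul, one_smul] at hd
      rw [Formula.series_append, Formula.series_dilate, Formula.series_dilate, ← dilate_mul]
      have e2 : expSeries Y = dilate (1 / 2) (expSeries Y) * dilate (1 / 2) (expSeries Y) := by
        rw [expSeries_add]; norm_num [one_dilate]
      refine AgreeTo.succ ?_ ?_
      · rw [e2, dilate_mul]
        exact (hT.dilate _).mul (hT''.dilate _)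
      · rw [dilate_mul]
        rw [congrArg (coeff (k + 1 + 1)) e2,
          defect_mul (hT.dilate _) (hT''.dilate _) (hE0 _ _ _) (hE0 _ _ _)]
        simp only [coeff_dilate, ← smul_sub]
        rw [← smul_add, add_comm (coeff (k + 1 + 1) T - _), hd.symm, smul_zero]
    · obtain ⟨p, hp⟩ := exists_suzuki_coefficient (k + 1) hk (by omega)
      refine ⟨l.dilate p ++ (l.dilate (1 - 2 * p) ++ l.dilate p), ?_⟩
      intro A _ _ Y S S' h h' h0 h1
      have hT := hl A Y S S' h h' h0 h1
      set T := l.series S S' with hTdef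
      simp only [Formula.series_append, Formula.series_dilate, ← hTdef]
      have e2 : expSeries Y = dilate p (expSeries Y) *
          (dilate (1 - 2 * p) (expSeries Y) * dilate p (expSeries Y)) := by
        rw [expSeries_add, expSeries_add]
        ring_nf
        rw [one_dilate]
      refine AgreeTo.succ ?_ ?_
      · rw [e2]
        exact (hT.dilate _).mul ((hT.dilate _).mul (hT.dilate _))
      · rw [congrArg (coeff (k + 1 + 1)) e2,
          defect_mul (hT.dilate _) ((hT.dilate _).mul (hT.dilate _)) (hE0 _ _ _)
          (by rw [expSeries_add]; exact hE0 _ _ _),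
          defect_mul (hT.dilate _) (hT.dilate _) (hE0 _ _ _) (hE0 _ _ _)]
        simp only [coeff_dilate, ← smul_sub]
        rw [← add_smul, ← add_smul, ← add_assoc, hp, zero_smul]

/-! ### Error bounds for product formulas by majorant series. -/

section Analytic

variable {A : Type} [NormedRing A] [NormedAlgebra ℝ A] [CompleteSpace A]

/-- `f` is the entire function with the power series `a`, whose coefficients are bounded by those
of `e^{M τ}`. -/
structure Expands (M : ℝ) (a : PowerSeries A) (f : ℝ → A) : Prop where
  nonneg : 0 ≤ M
  bound : ∀ j, ‖coeff j a‖ ≤ M ^ j / j.factorial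
  hasSum : ∀ τ, HasSum (fun j => τ ^ j • coeff j a) (f τ)

omit [CompleteSpace A] in
lemma Expands.summable_norm {M : ℝ} {a : PowerSeries A} {f : ℝ → A} (h : Expands M a f) (τ : ℝ) :
    Summable fun j => ‖τ ^ j • coeff j a‖ := by
  refine Summable.of_nonneg_of_le (fun _ => norm_nonneg _) (fun j => ?_)
    (Real.summable_pow_div_factorial (|τ| * M))
  rw [norm_smul, norm_pow, Real.norm_eq_abs, mul_pow, mul_div_assoc]
  exact mul_le_mul_of_nonneg_left (h.bound j) (by positivity)

lemma Expands.mul {M M' : ℝ} {a a' : PowerSeries A} {f f' : ℝ → A} (h : Expands M a f)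
    (h' : Expands M' a' f') : Expands (M + M') (a * a') (fun τ => f τ * f' τ) where
  nonneg := add_nonneg h.nonneg h'.nonneg
  bound j := by
    rw [coeff_mul]
    refine (norm_sum_le _ _).trans ?_
    rw [(Commute.all M M').add_pow', Finset.sum_div]
    refine Finset.sum_le_sum fun x hx => ?_
    refine (norm_mul_le _ _).trans ((mul_le_mul (h.bound _) (h'.bound _) (norm_nonneg _)
      (div_nonneg (pow_nonneg h.nonneg _) (by positivity))).trans (le_of_eq ?_))
    have hx' := Finset.HasAntidiagonal.mem_antidiagonal.1 hx
    have := Nat.add_choose_mul_factorial_mul_factorial x.1 x.2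
    rw [hx', ← Nat.choose_symm_of_eq_add hx'.symm] at this
    have h2 : ((j.choose x.1 : ℝ)) * x.1.factorial * x.2.factorial = j.factorial := by
      exact_mod_cast this
    have h3 : (x.1.factorial : ℝ) ≠ 0 := by positivity
    have h4 : (x.2.factorial : ℝ) ≠ 0 := by positivity
    have h5 : (j.factorial : ℝ) ≠ 0 := by positivity
    rw [nsmul_eq_mul]
    field_simp
    rw [← h2]; ring
  hasSum τ := by
    have e : ∀ j, τ ^ j • coeff j (a * a') = ∑ x ∈ Finset.HasAntidiagonal.antidiagonal j,
        (τ ^ x.1 • coeff x.1 a) * (τ ^ x.2 • coeff x.2 a') := by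
      intro j
      rw [coeff_mul, Finset.smul_sum]
      refine Finset.sum_congr rfl fun x hx => ?_
      rw [smul_mul_smul_comm, ← pow_add, Finset.HasAntidiagonal.mem_antidiagonal.1 hx]
    simp only [e]
    have hs := summable_norm_sum_mul_antidiagonal_of_summable_norm (h.summable_norm τ)
      (h'.summable_norm τ)
    have := tsum_mul_tsum_eq_tsum_sum_antidiagonal_of_summable_norm (h.summable_norm τ)
      (h'.summable_norm τ)
    rw [(h.hasSum τ).tsum_eq, (h'.hasSum τ).tsum_eq] at this
    rw [this]
    exact hs.of_norm.hasSum

omit [CompleteSpace A] in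
lemma Expands.one [NormOneClass A] : Expands 0 (1 : PowerSeries A) (fun _ => 1) where
  nonneg := le_rfl
  bound j := by
    rw [coeff_one]
    split_ifs with h
    · simp [h]
    · simp only [norm_zero]; positivity
  hasSum τ := by
    convert hasSum_ite_eq (0 : ℕ) (1 : A) using 2 with j
    rw [coeff_one]
    split_ifs with h <;> simp [h]

omit [CompleteSpace A] in
lemma Expands.dilate {M : ℝ} {a : PowerSeries A} {f : ℝ → A} (h : Expands M a f) (c : ℝ) :
    Expands (|c| * M) (dilate c a) (fun τ => f (c * τ)) where
  nonneg := mul_nonneg (abs_nonneg _) h.nonneg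
  bound j := by
    rw [coeff_dilate, norm_smul, norm_pow, Real.norm_eq_abs, mul_pow, mul_div_assoc]
    exact mul_le_mul_of_nonneg_left (h.bound j) (by positivity)
  hasSum τ := by
    convert h.hasSum (c * τ) using 2 with j
    rw [coeff_dilate, smul_smul, mul_pow, mul_comm]

lemma Expands.exp [NormOneClass A] [Algebra ℚ A] (Y : A) :
    Expands ‖Y‖ (expSeries Y) (fun τ => NormedSpace.exp (τ • Y)) where
  nonneg := norm_nonneg _
  bound j := by
    rw [expSeries, coeff_mk, norm_smul, norm_inv, Real.norm_natCast, mul_comm, ← div_eq_mul_inv]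
    gcongr
    exact norm_pow_le _ _
  hasSum τ := by
    convert NormedSpace.exp_series_hasSum_exp' (𝕂 := ℝ) (τ • Y) using 2 with j
    rw [expSeries, coeff_mk, smul_pow, smul_smul, smul_smul, mul_comm]

lemma Expands.list_prod [NormOneClass A] {ι : Type} (l : List ι) (M : ι → ℝ)
    (a : ι → PowerSeries A) (f : ι → ℝ → A) (h : ∀ i ∈ l, Expands (M i) (a i) (f i)) :
    Expands (l.map M).sum (l.map a).prod (fun τ => (l.map fun i => f i τ).prod) := by
  induction l with
  | nil => simpa using Expands.one
  | cons i l ih =>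
    simpa using (h i (by simp)).mul (ih fun i hi => h i (by simp [hi]))

omit [CompleteSpace A] in
/-- Functions whose series agree to high order are close to each other near zero. -/
lemma Expands.norm_sub_le {k : ℕ} {M M' : ℝ} {a a' : PowerSeries A} {f f' : ℝ → A}
    (h : Expands M a f) (h' : Expands M' a' f') (hM : M ≤ M') (hk : AgreeTo k a a') (τ : ℝ)
    (hτ : 0 ≤ τ) :
    ‖f τ - f' τ‖ ≤ 2 * (τ * M') ^ (k + 1) * Real.exp (τ * M') := by
  have h0 := h'.nonneg
  have hs := (h.hasSum τ).sub (h'.hasSum τ)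
  set y := τ * M' with hy
  have hy0 : 0 ≤ y := mul_nonneg hτ h0
  have hb : ∀ j, ‖τ ^ j • coeff j a - τ ^ j • coeff j a'‖ ≤
      if j ≤ k then 0 else 2 * (y ^ j / j.factorial) := by
    intro j
    split_ifs with hj
    · simp [hk j hj]
    · have e1 := h.bound j
      have e2 := h'.bound j
      have e3 : M ^ j / j.factorial ≤ M' ^ j / j.factorial := by
        have := pow_le_pow_left₀ h.nonneg hM j
        gcongr
      rw [← smul_sub, norm_smul, norm_pow, Real.norm_of_nonneg hτ, hy, mul_pow, mul_div_assoc,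
        ← mul_assoc, mul_comm 2, mul_assoc]
      refine mul_le_mul_of_nonneg_left ?_ (by positivity)
      linarith [_root_.norm_sub_le (coeff j a) (coeff j a')]
  have hsum : HasSum (fun j : ℕ => y ^ j / j.factorial) (Real.exp y) := by
    rw [Real.exp_eq_exp_ℝ]
    exact NormedSpace.expSeries_div_hasSum_exp y
  -- Since `(i + k + 1)!` is at least `i!`, the tail of the exponential series is bounded by `y ^ (k
  -- + 1)` times the whole series.
  have hs2 : HasSum (fun j : ℕ => if j ≤ k then (0 : ℝ) else
      2 * y ^ (k + 1) * (y ^ (j - (k + 1)) / (j - (k + 1)).factorial))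
      (2 * y ^ (k + 1) * Real.exp y) := by
    have hinj : Function.Injective fun j : ℕ => j + (k + 1) := fun _ _ h => by simpa using h
    refine (Function.Injective.hasSum_iff hinj ?_).1 ?_
    · intro j hj
      rw [if_pos]
      by_contra hc
      exact hj ⟨j - (k + 1), by simp; omega⟩
    · refine (hsum.mul_left (2 * y ^ (k + 1))).congr_fun fun j => ?_
      rw [Function.comp_apply, if_neg (by omega), Nat.add_sub_cancel]
  rw [← hs.tsum_eq]
  refine tsum_of_norm_bounded hs2 fun j => (hb j).trans ?_
  split_ifs with hj
  · exact le_rfl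
  · obtain ⟨i, rfl⟩ : ∃ i, j = i + (k + 1) := ⟨j - (k + 1), by omega⟩
    rw [Nat.add_sub_cancel, mul_assoc]
    refine mul_le_mul_of_nonneg_left ?_ (by norm_num)
    rw [pow_add, mul_comm, mul_div_assoc]
    refine mul_le_mul_of_nonneg_left ?_ (by positivity)
    gcongr
    omega

/-- The product of `e^{τ Y}` for `Y` in a list. -/
noncomputable def expProd [Algebra ℚ A] (Y : List A) (τ : ℝ) : A :=
  (Y.map fun Z => NormedSpace.exp (τ • Z)).prod

/-- The product formula for the exponential of the sum of the list `Y`. -/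
noncomputable def Formula.eval [Algebra ℚ A] (l : Formula) (Y : List A) (τ : ℝ) : A :=
  (l.map fun x => expProd (if x.2 then Y.reverse else Y) (x.1 * τ)).prod

/-- The sum of the moduli of the coefficients, but at least one. -/
noncomputable def Formula.weight (l : Formula) : ℝ := 1 + (l.map fun x => |x.1|).sum

lemma Formula.one_le_weight (l : Formula) : 1 ≤ l.weight := by
  have : 0 ≤ (l.map fun x : ℝ × Bool => |x.1|).sum := by
    refine List.sum_nonneg fun a ha => ?_
    obtain ⟨x, _, rfl⟩ := List.mem_map.1 ha
    exact abs_nonneg _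
  rw [weight]; linarith

lemma norm_list_sum_le (Y : List A) : ‖Y.sum‖ ≤ (Y.map fun Z => ‖Z‖).sum := by
  induction Y with
  | nil => simp
  | cons Z Y ih => simpa using (norm_add_le _ _).trans (by gcongr)

/-- The factors `e ^ (-τ Z)` and `e ^ (τ Z)` that meet in the middle cancel one after another. This
supplies the reversed first-order formula `S'` that `exists_formula` requires. -/
lemma prod_expSeries_inverse (Y : List A) :
    dilate (-1) (Y.reverse.map expSeries).prod * (Y.map expSeries).prod = 1 := by
  induction Y with
  | nil => simp [dilate_one]
  | cons Z Y ih =>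
    have e : dilate (-1) (expSeries Z) * expSeries Z = 1 := by
      have := expSeries_add (-1) 1 Z
      rwa [one_dilate, neg_add_cancel, zero_dilate_expSeries] at this
    simp only [List.reverse_cons, List.map_append, List.map_cons, List.map_nil, List.prod_append,
      List.prod_cons, List.prod_nil, mul_one, dilate_mul]
    rw [mul_assoc, ← mul_assoc _ (expSeries Z), e, one_mul, ih]

lemma coeff_zero_prod_expSeries (Y : List A) : coeff 0 (Y.map expSeries).prod = 1 := by
  induction Y with
  | nil => simp
  | cons Z Y ih =>
    rw [List.map_cons, List.prod_cons, coeff_mul]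
    simp only [Finset.HasAntidiagonal.antidiagonal]
    simp [ih, expSeries]

lemma coeff_one_prod_expSeries (Y : List A) : coeff 1 (Y.map expSeries).prod = Y.sum := by
  induction Y with
  | nil => simp [coeff_one]
  | cons Z Y ih =>
    rw [List.map_cons, List.prod_cons, coeff_mul]
    have := coeff_zero_prod_expSeries Y
    simp [Finset.Nat.antidiagonal_succ, ih, this, expSeries, add_comm]

/-- For every order there is a product formula, with an error bound that depends only on the total
norm of the exponents. -/
theorem exists_formula_norm_sub_le (k : ℕ) : ∃ l : Formula,
    ∀ (A : Type) [NormedRing A] [NormedAlgebra ℝ A] [CompleteSpace A] [NormOneClass A]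
      [Algebra ℚ A] (Y : List A) (M : ℝ), (Y.map fun Z => ‖Z‖).sum ≤ M → ∀ τ : ℝ, 0 ≤ τ →
      ‖l.eval Y τ - NormedSpace.exp (τ • Y.sum)‖ ≤
        2 * (τ * (l.weight * M)) ^ (k + 2) * Real.exp (τ * (l.weight * M)) := by
  obtain ⟨l, hl⟩ := exists_formula k
  refine ⟨l, fun A _ _ _ _ _ Y M hM τ hτ => ?_⟩
  have h1 := prod_expSeries_inverse Y
  have h2 : (Y.map expSeries).prod * dilate (-1) (Y.reverse.map expSeries).prod = 1 := by
    have := congrArg (dilate (-1)) (prod_expSeries_inverse Y.reverse)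
    rwa [dilate_mul, dilate_dilate, neg_one_mul, neg_neg, one_dilate, dilate_one,
      List.reverse_reverse] at this
  have hk := hl A Y.sum _ _ h1 h2 (coeff_zero_prod_expSeries Y) (coeff_one_prod_expSeries Y)
  set M₀ := (Y.map fun Z => ‖Z‖).sum with hM₀
  have hM₀0 : 0 ≤ M₀ := List.sum_nonneg fun a ha => by
    obtain ⟨x, _, rfl⟩ := List.mem_map.1 ha
    exact norm_nonneg _
  have hexp : ∀ Y : List A, Expands (Y.map fun Z => ‖Z‖).sum (Y.map expSeries).prod (expProd Y) :=
    fun Y => Expands.list_prod Y _ _ _ fun Z _ => Expands.exp Z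
  have hexp1 : ∀ x : ℝ × Bool, Expands (|x.1| * M₀)
      (dilate x.1 (if x.2 then (Y.reverse.map expSeries).prod else (Y.map expSeries).prod))
      (fun τ => expProd (if x.2 then Y.reverse else Y) (x.1 * τ)) := by
    rintro ⟨c, b⟩
    cases b
    · exact (hexp Y).dilate c
    · have h3 : (Y.reverse.map fun Z => ‖Z‖).sum = M₀ := by
        rw [List.map_reverse, List.sum_reverse]
      have := (hexp Y.reverse).dilate c
      rw [h3] at this
      exact this
  have hT := Expands.list_prod l _ _ _ fun x _ => hexp1 x
  -- The weight is at least one by definition, so the exact exponential has the majorant used for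
  -- the formula.
  have hE : Expands (l.weight * M) (expSeries Y.sum) (fun τ => NormedSpace.exp (τ • Y.sum)) := by
    have := Expands.exp Y.sum
    refine ⟨?_, fun j => (this.bound j).trans ?_, this.hasSum⟩
    · exact mul_nonneg (by linarith [l.one_le_weight]) (hM₀0.trans hM)
    · have : ‖Y.sum‖ ≤ l.weight * M := by
        have h3 : ‖Y.sum‖ ≤ M₀ := norm_list_sum_le Y
        nlinarith [l.one_le_weight]
      gcongr
  refine hT.norm_sub_le hE ?_ hk τ hτ
  rw [List.sum_map_mul_right]
  have : (l.map fun x : ℝ × Bool => |x.1|).sum ≤ l.weight := by rw [Formula.weight]; linarith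
  exact mul_le_mul this hM hM₀0 (by linarith [l.one_le_weight])

end Analytic

end ProductFormula

/-! ## Controlled one-qubit operations -/

section Controlled

variable {ι : Type} [Fintype ι] [DecidableEq ι]

/-- The operation `M` on the qubit `w`, controlled by the Boolean function `f`. -/
def ctrlMat (f : (ι → Bool) → Bool) (w : ι) (M : Matrix Bool Bool ℂ) :
    Matrix (ι → Bool) (ι → Bool) ℂ := fun x y =>
  if f x then (if Function.update y w (x w) = x then M (x w) (y w) else 0)
  else if y = x then 1 else 0

/-- The Boolean function `f` does not depend on the qubit `w`. -/
def IndepOf (w : ι) (f : (ι → Bool) → Bool) : Prop :=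
  ∀ x b, f (Function.update x w b) = f x

lemma ctrlMat_mulVec (f : (ι → Bool) → Bool) (w : ι) (M : Matrix Bool Bool ℂ)
    (ψ : (ι → Bool) → ℂ) (x : ι → Bool) :
    (ctrlMat f w M).mulVec ψ x =
      if f x then ∑ b, M (x w) b * ψ (Function.update x w b) else ψ x := by
  unfold Matrix.mulVec dotProduct ctrlMat
  by_cases hf : f x = true
  · simp only [hf, if_true]
    have e : ∀ b, M (x w) b * ψ (Function.update x w b) =
        ∑ y, if y = Function.update x w b then M (x w) b * ψ y else 0 := by
      intro b; simp
    simp only [e]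
    rw [Finset.sum_comm]
    refine Finset.sum_congr rfl fun y _ => ?_
    by_cases h : Function.update y w (x w) = x
    · rw [if_pos h, Finset.sum_eq_single (y w)]
      · rw [if_pos]
        rw [← h]; simp
      · intro b _ hb
        rw [if_neg]
        rintro rfl
        simp at hb
      · simp
    · rw [if_neg h, zero_mul, Finset.sum_eq_zero]
      intro b _
      rw [if_neg]
      rintro rfl
      simp at h
  · simp [hf]

lemma matrix_ext_mulVec {A B : Matrix (ι → Bool) (ι → Bool) ℂ}
    (h : ∀ ψ x, A.mulVec ψ x = B.mulVec ψ x) : A = B :=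
  Matrix.mulVec_injective (funext fun ψ => funext fun x => h ψ x)

lemma ctrlMat_mul {f : (ι → Bool) → Bool} {w : ι} (hf : IndepOf w f)
    (M M' : Matrix Bool Bool ℂ) : ctrlMat f w M * ctrlMat f w M' = ctrlMat f w (M * M') := by
  refine matrix_ext_mulVec fun ψ x => ?_
  rw [← Matrix.mulVec_mulVec]
  simp only [ctrlMat_mulVec, hf x, Function.update_idem, Function.update_self, Matrix.mul_apply]
  split_ifs with h
  · simp only [Finset.mul_sum, Finset.sum_mul]
    rw [Finset.sum_comm]
    simp only [mul_assoc]
  · rfl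

lemma ctrlMat_one (f : (ι → Bool) → Bool) (w : ι) : ctrlMat f w 1 = 1 := by
  refine matrix_ext_mulVec fun ψ x => ?_
  rw [ctrlMat_mulVec]
  simp [Matrix.one_apply]

lemma ctrlMat_conjTranspose {f : (ι → Bool) → Bool} {w : ι} (hf : IndepOf w f)
    (M : Matrix Bool Bool ℂ) : (ctrlMat f w M).conjTranspose = ctrlMat f w M.conjTranspose := by
  ext x y
  simp only [Matrix.conjTranspose_apply, ctrlMat]
  have h1 : Function.update x w (y w) = y ↔ Function.update y w (x w) = x := by
    constructor <;> · intro h; rw [← h]; simp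
  by_cases h : Function.update y w (x w) = x
  · have hxy : f x = f y := by rw [← h, hf]
    rw [hxy, if_pos h, if_pos (h1.2 h)]
    by_cases h2 : f y = true
    · simp [h2]
    · simp only [h2]
      by_cases h3 : x = y
      · simp [h3]
      · simp [h3, Ne.symm h3]
  · rw [if_neg h, if_neg (fun h' => h (h1.1 h'))]
    have hne : ¬ x = y := by rintro rfl; simp at h
    have hne' : ¬ y = x := fun h => hne h.symm
    simp [hne, hne']

lemma ctrlMat_mem_unitary {f : (ι → Bool) → Bool} {w : ι} (hf : IndepOf w f)
    {M : Matrix Bool Bool ℂ} (hM : M ∈ Matrix.unitaryGroup Bool ℂ) :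
    ctrlMat f w M ∈ Matrix.unitaryGroup (ι → Bool) ℂ := by
  rw [Matrix.mem_unitaryGroup_iff, Matrix.star_eq_conjTranspose, ctrlMat_conjTranspose hf,
    ctrlMat_mul hf, ← Matrix.star_eq_conjTranspose, Matrix.mem_unitaryGroup_iff.1 hM, ctrlMat_one]

/-- The negation of a qubit. -/
def notMat : Matrix Bool Bool ℂ := fun a b => if a = b then 0 else 1

lemma notMat_mem_unitary : notMat ∈ Matrix.unitaryGroup Bool ℂ := by
  rw [Matrix.mem_unitaryGroup_iff]
  ext a b
  cases a <;> cases b <;> simp [notMat, Matrix.mul_apply, Matrix.star_apply]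

lemma sum_notMat (a : Bool) (F : Bool → ℂ) : ∑ b, notMat a b * F b = F (!a) := by
  cases a <;> simp [notMat]

end Controlled

/-! ## Gates for controlled operations -/

lemma exists_gate_ctrl {n m k : ℕ} (hk : k ≤ 3) (e : Fin k ↪ Fin m) (i : Fin k)
    {f : (Fin k → Bool) → Bool} (hf : IndepOf i f) {M : Matrix Bool Bool ℂ}
    (hM : M ∈ Matrix.unitaryGroup Bool ℂ) :
    ∃ g : Gate n m, (∀ q, g.cost q = 1) ∧ ∀ P ψ x, g.apply P ψ x =
      if f (x ∘ e) then ∑ b, M (x (e i)) b * ψ (Function.update x (e i) b) else ψ x := by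
  refine ⟨.unitary k hk e ⟨ctrlMat f i M, ctrlMat_mem_unitary hf hM⟩, fun q => rfl,
    fun P ψ x => ?_⟩
  have h := ctrlMat_mulVec f i M (fun y => ψ (Function.extend e y x)) (x ∘ e)
  have e1 : ∀ b, Function.extend e (Function.update (x ∘ e) i b) x =
      Function.update x (e i) b := by
    intro b
    funext w
    by_cases hw : ∃ l, e l = w
    · obtain ⟨l, rfl⟩ := hw
      rw [e.injective.extend_apply, Function.update_apply, Function.update_apply]
      simp [e.injective.eq_iff]
    · rw [Function.extend_apply' _ _ _ hw, Function.update_of_ne]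
      rintro rfl
      exact hw ⟨i, rfl⟩
  have e2 : Function.extend e (x ∘ e) x = x := by
    funext w
    by_cases hw : ∃ l, e l = w
    · obtain ⟨l, rfl⟩ := hw
      rw [e.injective.extend_apply]; rfl
    · rw [Function.extend_apply' _ _ _ hw]
  simp only [e1, e2] at h
  exact h

lemma exists_gate_ctrl_qubit {n m : ℕ} {w l : Fin m} (h : l ≠ w) {M : Matrix Bool Bool ℂ}
    (hM : M ∈ Matrix.unitaryGroup Bool ℂ) :
    ∃ g : Gate n m, (∀ q, g.cost q = 1) ∧ ∀ P ψ x, g.apply P ψ x =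
      if x l then ∑ b, M (x w) b * ψ (Function.update x w b) else ψ x := by
  have he : Function.Injective ![w, l] := by
    intro a b hab
    fin_cases a <;> fin_cases b <;> simp_all
  exact exists_gate_ctrl (f := fun y => y 1) (by norm_num) ⟨![w, l], he⟩ 0
    (fun x b => by simp) hM

lemma exists_gate_xor {n m : ℕ} {r a b : Fin m} (ha : a ≠ r) (hb : b ≠ r)
    (g : Bool → Bool → Bool) :
    ∃ G : Gate n m, (∀ q, G.cost q = 1) ∧ ∀ P ψ x, G.apply P ψ x =
      ψ (Function.update x r (xor (x r) (g (x a) (x b)))) := by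
  have key : ∀ (ψ : QState m) (x : Fin m → Bool) (v : Bool),
      (if v then ∑ b, notMat (x r) b * ψ (Function.update x r b) else ψ x) =
        ψ (Function.update x r (xor (x r) v)) := by
    intro ψ x v
    cases v
    · simp
    · rw [if_pos rfl, sum_notMat (x r) (fun b => ψ (Function.update x r b)), Bool.xor_true]
  -- The wires of a gate are distinct, so coinciding inputs need a gate on two qubits only.
  by_cases hab : a = b
  · subst hab
    have he : Function.Injective ![r, a] := by
      intro c d hcd
      fin_cases c <;> fin_cases d <;> simp_all
    obtain ⟨G, h1, h2⟩ := exists_gate_ctrl (n := n) (f := fun y => g (y 1) (y 1)) (by norm_num)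
      ⟨![r, a], he⟩ 0 (fun x b => by simp) notMat_mem_unitary
    exact ⟨G, h1, fun P ψ x => (h2 P ψ x).trans (key ψ x _)⟩
  · have he : Function.Injective ![r, a, b] := by
      intro c d hcd
      fin_cases c <;> fin_cases d <;> simp_all
    obtain ⟨G, h1, h2⟩ := exists_gate_ctrl (n := n) (f := fun y => g (y 1) (y 2)) (by norm_num)
      ⟨![r, a, b], he⟩ 0 (fun x b => by simp) notMat_mem_unitary
    exact ⟨G, h1, fun P ψ x => (h2 P ψ x).trans (key ψ x _)⟩

lemma Circuit.run_append {n m : ℕ} (P : Procedures) (A B : Circuit n m) (ψ : QState m) :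
    Circuit.run P (A ++ B) ψ = Circuit.run P B (Circuit.run P A ψ) :=
  List.foldl_append

lemma Circuit.cost_append {n m : ℕ} (q : Polynomial ℕ) (A B : Circuit n m) :
    Circuit.cost q (A ++ B) = Circuit.cost q A + Circuit.cost q B := by
  simp [Circuit.cost]

/-! ## Boolean functions computed with scratch qubits -/

/-- Boolean functions of the data qubits, depending on the procedures. -/
abbrev BoolFun (D : Type) : Type := Procedures → (D → Bool) → Bool

/-- The bits of the answer to a query with given arguments. -/
def answerBit {D : Type} {n : ℕ} (f : Query) (arg : Fin f.arity → Fin n → BoolFun D) (i : ℕ) :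
    BoolFun D := fun P x =>
  Int.testBit (P.answer f fun a => Nat.ofBits fun l => arg a l P x) i

/-- Starting from the functions in `base`, those in the set can be computed at the given cost. -/
inductive Avail {D : Type} (n : ℕ) (q : Polynomial ℕ) (base : Set (BoolFun D)) :
    ℕ → Set (BoolFun D) → Prop
  | base : Avail n q base 0 base
  | gate {c : ℕ} {Φ : Set (BoolFun D)} (h : Avail n q base c Φ) {a b : BoolFun D} (ha : a ∈ Φ)
      (hb : b ∈ Φ) (g : Bool → Bool → Bool) :
      Avail n q base (c + 1) (insert (fun P x => g (a P x) (b P x)) Φ)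
  | call {c : ℕ} {Φ : Set (BoolFun D)} (h : Avail n q base c Φ) (f : Query)
      (arg : Fin f.arity → Fin n → BoolFun D) (harg : ∀ a l, arg a l ∈ Φ) :
      Avail n q base (c + q.eval (n + f.precision))
        (Φ ∪ Set.range fun i : Fin (f.width n) => answerBit f arg i)
  | mono {c c' : ℕ} {Φ Φ' : Set (BoolFun D)} (h : Avail n q base c Φ) (hc : c ≤ c')
      (hΦ : Φ' ⊆ Φ) : Avail n q base c' Φ'

/-- The values of all data qubits but `w`. -/
def otherQubits {D : Type} (w : D) : Set (BoolFun D) := {φ | ∃ d, d ≠ w ∧ φ = fun _ x => x d}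

/-- Exclusive or of the values `val y` to the qubits `out`. -/
noncomputable def xorStep {m k : ℕ} (out : Fin k ↪ Fin m) (val : (Fin m → Bool) → Fin k → Bool)
    (y : Fin m → Bool) : Fin m → Bool := fun l =>
  xor (y l) (Function.extend out (val y) (fun _ => false) l)

/-- A reversible circuit that computes the functions in `Φ` on scratch qubits `S`, and its
inverse. -/
structure Program {D : Type} (n m : ℕ) (q : Polynomial ℕ) (j : D ↪ Fin m) (w : D) (s c : ℕ)
    (Φ : Set (BoolFun D)) where
  compute : Circuit n m
  uncompute : Circuit n m
  state : Procedures → (Fin m → Bool) → Fin m → Bool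
  back : Procedures → (Fin m → Bool) → Fin m → Bool
  scratch : Finset (Fin m)
  compute_cost : compute.cost q ≤ c
  uncompute_cost : uncompute.cost q ≤ c
  run_compute : ∀ P ψ, compute.run P ψ = fun x => ψ (back P x)
  run_uncompute : ∀ P ψ, uncompute.run P ψ = fun x => ψ (state P x)
  back_state : ∀ P x, back P (state P x) = x
  card_scratch : scratch.card ≤ s
  not_mem_scratch : ∀ d, j d ∉ scratch
  state_of_not_mem : ∀ P x, ∀ l ∉ scratch, state P x l = x l
  state_update : ∀ P x b,
    state P (Function.update x (j w) b) = Function.update (state P x) (j w) b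
  exists_loc : ∀ φ ∈ Φ, ∃ l, l ≠ j w ∧ (l ∈ scratch ∨ l ∈ Set.range j) ∧
    ∀ P x, (∀ i ∈ scratch, x i = false) → state P x l = φ P (x ∘ j)

section Programs

set_option linter.unusedSectionVars false

variable {D : Type} [Fintype D] [DecidableEq D] {n m : ℕ} {q : Polynomial ℕ}

/-- A program followed by one more step on fresh qubits `out`. -/
lemma Program.extend {j : D ↪ Fin m} {w : D} {s c k d : ℕ} {Φ : Set (BoolFun D)}
    (p : Program n m q j w s c Φ) (out : Fin k ↪ Fin m) (hout : ∀ i, out i ∉ p.scratch)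
    (hout' : ∀ i d, out i ≠ j d) (g : Gate n m)
    (val : Procedures → (Fin m → Bool) → Fin k → Bool)
    (hg : ∀ P ψ, g.apply P ψ = fun x => ψ (xorStep out (val P) x)) (hd : g.cost q = d)
    (hval : ∀ P y y', (∀ l, l ≠ j w → (∀ i, out i ≠ l) → y l = y' l) → val P y = val P y')
    (φ : Fin k → BoolFun D)
    (hφ : ∀ P x i, (∀ i ∈ p.scratch, x i = false) → val P (p.state P x) i = φ i P (x ∘ j)) :
    Nonempty (Program n m q j w (s + k) (c + d) (Φ ∪ Set.range φ)) := by
  have hstep_out : ∀ P y i, xorStep out (val P) y (out i) = xor (y (out i)) (val P y i) := by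
    intro P y i; simp [xorStep, out.injective.extend_apply]
  have hstep_ne : ∀ P y l, (∀ i, out i ≠ l) → xorStep out (val P) y l = y l := by
    intro P y l hl
    rw [xorStep, Function.extend_apply', Bool.xor_false]
    rintro ⟨i, hi⟩
    exact hl i hi
  have hstep : ∀ P y, xorStep out (val P) (xorStep out (val P) y) = y := by
    intro P y
    -- The value does not read the wires it is written to, so the step is an involution and serves
    -- as its own inverse in the uncomputation.
    have hv : val P (xorStep out (val P) y) = val P y :=
      hval P _ _ fun l _ hl => hstep_ne P y l hl
    funext l
    by_cases hl : ∃ i, out i = l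
    · obtain ⟨i, rfl⟩ := hl
      rw [hstep_out, hstep_out, hv]; simp
    · rw [hstep_ne P _ l fun i hi => hl ⟨i, hi⟩, hstep_ne P _ l fun i hi => hl ⟨i, hi⟩]
  refine ⟨{
    compute := p.compute ++ [g]
    uncompute := g :: p.uncompute
    state := fun P x => xorStep out (val P) (p.state P x)
    back := fun P x => p.back P (xorStep out (val P) x)
    scratch := p.scratch ∪ Finset.univ.map out
    compute_cost := ?_
    uncompute_cost := ?_
    run_compute := ?_
    run_uncompute := ?_
    back_state := ?_
    card_scratch := ?_
    not_mem_scratch := ?_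
    state_of_not_mem := ?_
    state_update := ?_
    exists_loc := ?_ }⟩
  · have := p.compute_cost
    rw [Circuit.cost_append]
    simp only [Circuit.cost, List.map_cons, List.map_nil, List.sum_cons, List.sum_nil, hd] at this ⊢
    omega
  · have := p.uncompute_cost
    simp only [Circuit.cost, List.map_cons, List.sum_cons, hd] at this ⊢
    omega
  · intro P ψ
    rw [Circuit.run_append, p.run_compute]
    exact hg P _
  · intro P ψ
    have : Circuit.run P (g :: p.uncompute) ψ = Circuit.run P p.uncompute (g.apply P ψ) := rfl
    rw [this, p.run_uncompute, hg]
  · intro P x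
    simp only [hstep, p.back_state]
  · refine (Finset.card_union_le _ _).trans ?_
    have := p.card_scratch
    simpa using this
  · intro d hd
    rcases Finset.mem_union.1 hd with h | h
    · exact p.not_mem_scratch d h
    · obtain ⟨i, _, hi⟩ := Finset.mem_map.1 h
      exact hout' i d hi
  · intro P x l hl
    rw [hstep_ne P _ l, p.state_of_not_mem P x l fun h => hl (Finset.mem_union_left _ h)]
    intro i hi
    exact hl (Finset.mem_union_right _ (Finset.mem_map.2 ⟨i, Finset.mem_univ _, hi⟩))
  · intro P x b
    rw [p.state_update]
    have hv : val P (Function.update (p.state P x) (j w) b) = val P (p.state P x) :=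
      hval P _ _ fun l hl _ => Function.update_of_ne hl _ _
    funext l
    by_cases hl : ∃ i, out i = l
    · obtain ⟨i, rfl⟩ := hl
      rw [hstep_out, hv, Function.update_of_ne (hout' i w), Function.update_of_ne (hout' i w),
        hstep_out]
    · rw [hstep_ne P _ l fun i hi => hl ⟨i, hi⟩]
      by_cases hlw : l = j w
      · subst hlw; simp
      · rw [Function.update_of_ne hlw, Function.update_of_ne hlw,
          hstep_ne P _ l fun i hi => hl ⟨i, hi⟩]
  · rintro ψ (hψ | ⟨i, rfl⟩)
    · obtain ⟨l, h1, h2, h3⟩ := p.exists_loc ψ hψ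
      refine ⟨l, h1, h2.imp (Finset.mem_union_left _) id, fun P x hx => ?_⟩
      rw [hstep_ne, h3 P x fun i hi => hx i (Finset.mem_union_left _ hi)]
      rintro i rfl
      rcases h2 with h2 | ⟨d, h2⟩
      · exact hout i h2
      · exact hout' i d h2.symm
    · refine ⟨out i, hout' i w, Or.inl (Finset.mem_union_right _ (Finset.mem_map.2
        ⟨i, Finset.mem_univ _, rfl⟩)), fun P x hx => ?_⟩
      rw [hstep_out, hφ P x i fun i hi => hx i (Finset.mem_union_left _ hi),
        p.state_of_not_mem P x _ (hout i),
        hx _ (Finset.mem_union_right _ (Finset.mem_map.2 ⟨i, Finset.mem_univ _, rfl⟩)),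
        Bool.false_xor]

lemma exists_fresh (T : Finset (Fin m)) (k : ℕ) (h : T.card + k ≤ m) :
    ∃ e : Fin k ↪ Fin m, ∀ i, e i ∉ T := by
  have hc : k ≤ Tᶜ.card := by
    rw [Finset.card_compl, Fintype.card_fin]; omega
  exact ⟨(Tᶜ.orderEmbOfCardLe hc).toEmbedding, fun i =>
    Finset.mem_compl.1 (Finset.orderEmbOfCardLe_mem _ hc i)⟩

lemma Program.exists_fresh {j : D ↪ Fin m} {w : D} {s c : ℕ} {Φ : Set (BoolFun D)}
    (p : Program n m q j w s c Φ) (k : ℕ) (h : Fintype.card D + (s + k) ≤ m) :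
    ∃ e : Fin k ↪ Fin m, (∀ i, e i ∉ p.scratch) ∧ ∀ i d, e i ≠ j d := by
  obtain ⟨e, he⟩ := _root_.exists_fresh (p.scratch ∪ Finset.univ.map j) k (by
    have h1 := Finset.card_union_le p.scratch (Finset.univ.map j)
    rw [Finset.card_map, Finset.card_univ] at h1
    have := p.card_scratch
    omega)
  refine ⟨e, fun i hi => he i (Finset.mem_union_left _ hi), fun i d hid => he i ?_⟩
  exact Finset.mem_union_right _ (Finset.mem_map.2 ⟨d, Finset.mem_univ _, hid.symm⟩)

/-- Each gate or call writes by exclusive or to fresh wires and never reads the target `w`. The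
number of scratch qubits is read off the derivation before register and embedding are chosen, so
programs can be placed in any sufficiently large register. -/
theorem Avail.exists_program {w : D} {c : ℕ} {Φ : Set (BoolFun D)}
    (h : Avail n q (otherQubits w) c Φ) :
    ∃ s, ∀ (m : ℕ) (j : D ↪ Fin m), Fintype.card D + s ≤ m →
      Nonempty (Program n m q j w s c Φ) := by
  induction h with
  | base =>
    refine ⟨0, fun m j _ => ⟨{
      compute := []
      uncompute := []
      state := fun _ x => x
      back := fun _ x => x
      scratch := ∅
      compute_cost := le_rfl
      uncompute_cost := le_rfl
      run_compute := fun _ _ => rfl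
      run_uncompute := fun _ _ => rfl
      back_state := fun _ _ => rfl
      card_scratch := le_rfl
      not_mem_scratch := by simp
      state_of_not_mem := fun _ _ _ _ => rfl
      state_update := fun _ _ _ => rfl
      exists_loc := ?_ }⟩⟩
    rintro φ ⟨d, hd, rfl⟩
    exact ⟨j d, fun h => hd (j.injective h), Or.inr ⟨d, rfl⟩, fun _ _ _ => rfl⟩
  | @gate c Φ _ a b ha hb g ih =>
    obtain ⟨s, hs⟩ := ih
    refine ⟨s + 1, fun m j hm => ?_⟩
    obtain ⟨p⟩ := hs m j (by omega)
    obtain ⟨e, he, he'⟩ := p.exists_fresh 1 hm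
    obtain ⟨la, ha1, ha2, ha3⟩ := p.exists_loc a ha
    obtain ⟨lb, hb1, hb2, hb3⟩ := p.exists_loc b hb
    have hne : ∀ l, (l ∈ p.scratch ∨ l ∈ Set.range j) → ∀ i, e i ≠ l := by
      rintro l (h | ⟨d, rfl⟩) i hi
      · exact he i (hi ▸ h)
      · exact he' i d hi
    obtain ⟨G, hG, hG'⟩ := exists_gate_xor (n := n) (hne la ha2 0).symm (hne lb hb2 0).symm g
    have := p.extend e he he' G (fun _ y _ => g (y la) (y lb)) (fun P ψ => ?_) (hG q)
      (fun P y y' h => ?_) (fun _ P x => g (a P x) (b P x)) (fun P x i hx => ?_)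
    · refine this.map fun p => ?_
      rwa [Set.range_const, Set.union_singleton] at p
    · funext x
      rw [hG' P ψ x]
      congr 1
      funext l
      by_cases hl : l = e 0
      · subst hl
        rw [xorStep, e.injective.extend_apply, Function.update_self]
      · rw [Function.update_of_ne hl, xorStep, Function.extend_apply', Bool.xor_false]
        rintro ⟨i, hi⟩
        exact hl (by rw [← hi, Subsingleton.elim i 0])
    · rw [h la ha1 (hne la ha2), h lb hb1 (hne lb hb2)]
    · simp only [ha3 P x hx, hb3 P x hx]
  | @call c Φ _ f arg harg ih =>
    obtain ⟨s, hs⟩ := ih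
    refine ⟨s + f.width n, fun m j hm => ?_⟩
    obtain ⟨p⟩ := hs m j (by omega)
    obtain ⟨e, he, he'⟩ := p.exists_fresh (f.width n) hm
    choose loc h1 h2 h3 using fun a l => p.exists_loc (arg a l) (harg a l)
    have hne : ∀ l, (l ∈ p.scratch ∨ l ∈ Set.range j) → ∀ i, e i ≠ l := by
      rintro l (h | ⟨d, rfl⟩) i hi
      · exact he i (hi ▸ h)
      · exact he' i d hi
    refine p.extend e he he' (.call f loc e fun a i o => (hne _ (h2 a i) o).symm)
      (fun P y i => Int.testBit (P.answer f fun a => Nat.ofBits fun l => y (loc a l)) i)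
      (fun P ψ => rfl) rfl (fun P y y' h => ?_) _ (fun P x i hx => ?_)
    · have : ∀ a l, y (loc a l) = y' (loc a l) := fun a l => h _ (h1 a l) (hne _ (h2 a l))
      simp only [this]
    · simp only [answerBit]
      congr 2
      funext a
      congr 1
      funext l
      exact h3 a l P x hx
  | @mono c c' Φ Φ' _ hc hΦ ih =>
    obtain ⟨s, hs⟩ := ih
    refine ⟨s, fun m j hm => ?_⟩
    obtain ⟨p⟩ := hs m j hm
    exact ⟨{ p with
      compute_cost := p.compute_cost.trans hc
      uncompute_cost := p.uncompute_cost.trans hc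
      exists_loc := fun φ hφ => p.exists_loc φ (hΦ hφ) }⟩

end Programs

/-! ## Operators on the data qubits implemented by circuits -/

section Implementation

variable {D : Type}

open Classical in
/-- A state of the data qubits, the other qubits being zero. -/
noncomputable def embState {m : ℕ} (j : D ↪ Fin m) (ψ : (D → Bool) → ℂ) : QState m := fun x =>
  if ∀ l, l ∉ Set.range j → x l = false then ψ (x ∘ j) else 0

lemma embState_sub {m : ℕ} (j : D ↪ Fin m) (ψ φ : (D → Bool) → ℂ) :
    embState j (ψ - φ) = embState j ψ - embState j φ := by
  funext x
  simp only [embState, Pi.sub_apply]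
  split_ifs <;> simp

lemma extend_comp_embedding {m : ℕ} (j : D ↪ Fin m) (x : Fin m → Bool)
    (h : ∀ l, l ∉ Set.range j → x l = false) :
    Function.extend j (x ∘ j) (fun _ => false) = x := by
  funext l
  by_cases hl : ∃ d, j d = l
  · obtain ⟨d, rfl⟩ := hl
    rw [j.injective.extend_apply]; rfl
  · rw [Function.extend_apply' _ _ _ hl, h l hl]

variable [Fintype D] [DecidableEq D]

lemma norm_embState {m : ℕ} (j : D ↪ Fin m) (ψ : (D → Bool) → ℂ) :
    ‖WithLp.toLp 2 (embState j ψ)‖ = ‖WithLp.toLp 2 ψ‖ := by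
  rw [EuclideanSpace.norm_eq, EuclideanSpace.norm_eq]
  congr 1
  symm
  refine Fintype.sum_of_injective (fun y : D → Bool => Function.extend j y (fun _ => false))
    (fun y y' h => ?_) _ _ (fun x hx => ?_) (fun y => ?_)
  · funext d
    have := congrFun h (j d)
    simpa [j.injective.extend_apply] using this
  · have : ¬ ∀ l, l ∉ Set.range j → x l = false := fun h =>
      hx ⟨x ∘ j, extend_comp_embedding j x h⟩
    have h0 : embState j ψ x = 0 := if_neg this
    simp [h0]
  · have h1 : ∀ l, l ∉ Set.range j →
        Function.extend j y (fun _ => false) l = false := fun l hl =>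
      Function.extend_apply' _ _ _ hl
    have h2 : Function.extend j y (fun _ => false) ∘ j = y := by
      funext d; simp [j.injective.extend_apply]
    simp only [embState, if_pos h1, h2]

/-- The operator `O` on the data qubits, which may depend on the procedures, is implemented by a
circuit of cost at most `c` with scratch qubits that are returned to zero. -/
def Impl (n : ℕ) (q : Polynomial ℕ) (c : ℕ)
    (O : Procedures → Matrix (D → Bool) (D → Bool) ℂ) : Prop :=
  ∃ s, ∀ (m : ℕ) (j : D ↪ Fin m), Fintype.card D + s ≤ m →
    ∃ A : Circuit n m, A.cost q ≤ c ∧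
      ∀ P ψ, A.run P (embState j ψ) = embState j ((O P).mulVec ψ)

variable {n : ℕ} {q : Polynomial ℕ}

lemma Impl.mono {c c' : ℕ} {O : Procedures → Matrix (D → Bool) (D → Bool) ℂ}
    (h : Impl n q c O) (hc : c ≤ c') : Impl n q c' O := by
  obtain ⟨s, hs⟩ := h
  refine ⟨s, fun m j hm => ?_⟩
  obtain ⟨A, hA, hA'⟩ := hs m j hm
  exact ⟨A, hA.trans hc, hA'⟩

lemma Impl.one : Impl n q 0 (fun _ => (1 : Matrix (D → Bool) (D → Bool) ℂ)) :=
  ⟨0, fun m j _ => ⟨[], le_rfl, fun P ψ => by rw [Matrix.one_mulVec]; rfl⟩⟩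

/-- As every circuit returns its scratch qubits to zero, consecutive circuits share them, and the
maximum of the two numbers is enough. -/
lemma Impl.mul {c c' : ℕ} {O O' : Procedures → Matrix (D → Bool) (D → Bool) ℂ}
    (h : Impl n q c O) (h' : Impl n q c' O') : Impl n q (c + c') (fun P => O P * O' P) := by
  obtain ⟨s, hs⟩ := h
  obtain ⟨s', hs'⟩ := h'
  refine ⟨max s s', fun m j hm => ?_⟩
  obtain ⟨A, hA, hA'⟩ := hs m j (by omega)
  obtain ⟨B, hB, hB'⟩ := hs' m j (by omega)
  refine ⟨B ++ A, ?_, fun P ψ => ?_⟩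
  · rw [Circuit.cost_append]; omega
  · rw [Circuit.run_append, hB', hA', Matrix.mulVec_mulVec]

lemma Impl.list_prod {ι : Type} (l : List ι) {c : ℕ}
    {O : ι → Procedures → Matrix (D → Bool) (D → Bool) ℂ} (h : ∀ i ∈ l, Impl n q c (O i)) :
    Impl n q (l.length * c) (fun P => (l.map fun i => O i P).prod) := by
  induction l with
  | nil => simpa using Impl.one
  | cons i l ih =>
    have := (h i (by simp)).mul (ih fun i hi => h i (by simp [hi]))
    refine (this.mono (le_of_eq ?_))
    rw [List.length_cons]; ring

lemma Impl.pow {c : ℕ} {O : Procedures → Matrix (D → Bool) (D → Bool) ℂ} (h : Impl n q c O)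
    (r : ℕ) : Impl n q (r * c) (fun P => O P ^ r) := by
  have := Impl.list_prod (List.replicate r ()) (fun _ _ => h)
  simpa using this

lemma Avail.indepOf {w : D} {c : ℕ} {Φ : Set (BoolFun D)}
    (h : Avail n q (otherQubits w) c Φ) : ∀ φ ∈ Φ, ∀ P, IndepOf w (φ P) := by
  induction h with
  | base =>
    rintro φ ⟨d, hd, rfl⟩ P x b
    exact Function.update_of_ne hd _ _
  | gate _ ha hb g ih =>
    rintro φ (rfl | hφ)
    · intro P x b
      simp only [ih _ ha P x b, ih _ hb P x b]
    · exact ih φ hφ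
  | call _ f arg harg ih =>
    rintro φ (hφ | ⟨i, rfl⟩)
    · exact ih φ hφ
    · intro P x b
      simp only [answerBit]
      congr 2
      funext a
      congr 1
      funext l
      exact ih _ (harg a l) P x b
  | mono _ _ hΦ ih => exact fun φ hφ => ih φ (hΦ hφ)

/-- An operation on a qubit that is controlled by a function of the other qubits. -/
theorem Avail.impl {w : D} {c : ℕ} {Φ : Set (BoolFun D)} (h : Avail n q (otherQubits w) c Φ)
    {f : BoolFun D} (hf : f ∈ Φ) {M : Matrix Bool Bool ℂ}
    (hM : M ∈ Matrix.unitaryGroup Bool ℂ) :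
    Impl n q (2 * c + 1) (fun P => ctrlMat (f P) w M) := by
  obtain ⟨s, hs⟩ := h.exists_program
  refine ⟨s, fun m j hm => ?_⟩
  obtain ⟨p⟩ := hs m j hm
  obtain ⟨l, h1, h2, h3⟩ := p.exists_loc f hf
  obtain ⟨G, hG, hG'⟩ := exists_gate_ctrl_qubit (n := n) h1 hM
  refine ⟨p.compute ++ ([G] ++ p.uncompute), ?_, fun P ψ => ?_⟩
  · have e1 := p.compute_cost
    have e2 := p.uncompute_cost
    have e3 : Circuit.cost q [G] = 1 := by simp [Circuit.cost, hG]
    rw [Circuit.cost_append, Circuit.cost_append, e3]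
    omega
  · rw [Circuit.run_append, Circuit.run_append, p.run_compute, p.run_uncompute]
    funext x
    have e1 : ∀ φ, Circuit.run P [G] φ = G.apply P φ := fun _ => rfl
    rw [e1, hG', p.state_of_not_mem P x _ (p.not_mem_scratch w)]
    -- Amplitudes are pulled back, so uncomputing evaluates at `state P x`. The program commutes
    -- with a change of the target, hence undoing it after the controlled operation restores all
    -- scratch qubits in every branch.
    simp only [← p.state_update, p.back_state]
    by_cases hx : ∀ l, l ∉ Set.range j → x l = false
    · have hx' : ∀ i ∈ p.scratch, x i = false := fun i hi => hx i (by
        rintro ⟨d, rfl⟩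
        exact p.not_mem_scratch d hi)
      have hu : ∀ b, embState j ψ (Function.update x (j w) b) =
          ψ (Function.update (x ∘ j) w b) := by
        intro b
        rw [embState, if_pos]
        · congr 1
          funext d
          simp [Function.update_apply, j.injective.eq_iff]
        · intro l hl
          rw [Function.update_of_ne, hx l hl]
          rintro rfl
          exact hl ⟨w, rfl⟩
      have h0 : ∀ φ, embState j φ x = φ (x ∘ j) := fun φ => by rw [embState, if_pos hx]
      rw [h3 P x hx', h0, h0, ctrlMat_mulVec]
      simp only [hu, Function.comp_apply]
    -- If a qubit outside the data is nonzero, it stays so when the target is changed, and all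
    -- amplitudes involved vanish.
    · have hu : ∀ b, embState j ψ (Function.update x (j w) b) = 0 := by
        intro b
        rw [embState, if_neg]
        intro h
        apply hx
        intro l hl
        rw [← h l hl, Function.update_of_ne]
        rintro rfl
        exact hl ⟨w, rfl⟩
      have h0 : ∀ φ, embState j φ x = 0 := fun φ => by rw [embState, if_neg hx]
      simp [hu, h0]

end Implementation

/-! ## Functions available at polynomial cost -/

section Available

variable {D : Type} {n : ℕ} {q : Polynomial ℕ} {base Φ Ψ : Set (BoolFun D)} {c : ℕ}

/-- Boolean functions of three available functions. -/
lemma Avail.gate₃ (h : Avail n q base c Φ) {a b d : BoolFun D} (ha : a ∈ Φ) (hb : b ∈ Φ)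
    (hd : d ∈ Φ) (g : Bool → Bool → Bool → Bool) :
    Avail n q base (c + 5) (insert (fun P x => g (a P x) (b P x) (d P x)) Φ) := by
  -- Case distinction on the third input: `g(a, b, true) && d` or `g(a, b, false) && !d`, five gates
  -- with two inputs.
  have h1 := h.gate ha hb (fun a b => g a b true)
  have h2 := h1.gate (Set.mem_insert_of_mem _ ha) (Set.mem_insert_of_mem _ hb)
    (fun a b => g a b false)
  have h3 := h2.gate (a := fun P x => g (a P x) (b P x) true)
    (Set.mem_insert_of_mem _ (Set.mem_insert _ _))
    (Set.mem_insert_of_mem _ (Set.mem_insert_of_mem _ hd)) (fun a b => a && b)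
  have h4 := h3.gate (a := fun P x => g (a P x) (b P x) false)
    (Set.mem_insert_of_mem _ (Set.mem_insert _ _))
    (Set.mem_insert_of_mem _ (Set.mem_insert_of_mem _ (Set.mem_insert_of_mem _ hd)))
    (fun a b => a && !b)
  have h5 := h4.gate (Set.mem_insert_of_mem _ (Set.mem_insert _ _)) (Set.mem_insert _ _)
    (fun a b => a || b)
  refine h5.mono le_rfl ?_
  rintro φ (rfl | hφ)
  · left
    funext P x
    cases d P x <;> simp
  · exact Set.mem_insert_of_mem _ (Set.mem_insert_of_mem _ (Set.mem_insert_of_mem _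
      (Set.mem_insert_of_mem _ (Set.mem_insert_of_mem _ hφ))))

/-- Adding finitely many functions, each of them at a given cost. -/
lemma Avail.family (k e : ℕ) (f : ℕ → BoolFun D) (h : Avail n q base c Φ)
    (hf : ∀ i < k, ∀ c' Φ', Φ ⊆ Φ' → (∀ i' < i, f i' ∈ Φ') → Avail n q base c' Φ' →
      Avail n q base (c' + e) (insert (f i) Φ')) :
    Avail n q base (c + k * e) (Φ ∪ {φ | ∃ i < k, φ = f i}) := by
  induction k with
  | zero => exact h.mono (by omega) (by rintro φ (hφ | ⟨i, hi, _⟩); exacts [hφ, absurd hi (by omega)])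
  | succ k ih =>
    have h1 := ih fun i hi => hf i (by omega)
    have h2 := hf k (by omega) _ (Φ ∪ {φ | ∃ i < k, φ = f i}) Set.subset_union_left
      (fun i hi => Or.inr ⟨i, hi, rfl⟩) h1
    refine h2.mono (by rw [Nat.succ_mul]; omega) ?_
    rintro φ (hφ | ⟨i, hi, rfl⟩)
    · exact Or.inr (Or.inl hφ)
    · rcases Nat.lt_succ_iff_lt_or_eq.1 hi with hi | rfl
      · exact Or.inr (Or.inr ⟨i, hi, rfl⟩)
      · exact Or.inl rfl

/-- The bits of a number with `w` bits. -/
def bits {w : ℕ} (a : Procedures → (D → Bool) → BitVec w) : Set (BoolFun D) :=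
  {φ | ∃ i < w, φ = fun P x => (a P x).getLsbD i}

lemma Avail.const (h : Avail n q base c Φ) {φ : BoolFun D} (hφ : φ ∈ Φ) (b : Bool) :
    Avail n q base (c + 1) (insert (fun _ _ => b) Φ) :=
  h.gate hφ hφ fun _ _ => b

/-- Ripple-carry addition: each carry is a majority of two digits and the previous carry, each digit
of the sum a parity of three bits. -/
lemma Avail.add (h : Avail n q base c Φ) {w : ℕ} {a b : Procedures → (D → Bool) → BitVec w}
    (ha : bits a ⊆ Φ) (hb : bits b ⊆ Φ) :
    Avail n q base (c + 11 * w) (Φ ∪ bits fun P x => a P x + b P x) := by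
  rcases Nat.eq_zero_or_pos w with rfl | hw
  · refine h.mono (by omega) ?_
    rintro φ (hφ | ⟨i, hi, _⟩)
    exacts [hφ, absurd hi (by omega)]
  have ha' : ∀ i < w, (fun P x => (a P x).getLsbD i) ∈ Φ := fun i hi => ha ⟨i, hi, rfl⟩
  have hb' : ∀ i < w, (fun P x => (b P x).getLsbD i) ∈ Φ := fun i hi => hb ⟨i, hi, rfl⟩
  have h2 : Avail n q base (c + w * 5 + 1 + 5 * w)
      (Φ ∪ {φ | ∃ i < w, φ = fun P x => BitVec.carry i (a P x) (b P x) false} ∪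
        {φ | ∃ i < w, φ = fun P x => (a P x + b P x).getLsbD i}) := by
    have h3 := Avail.family w 5
      (fun i P x => BitVec.carry i (a P x) (b P x) false) h (by
        intro i hi c' Φ' hΦ hlt hA
        rcases i with _ | i
        · have := hA.const (hΦ (ha' 0 hw)) false
          refine this.mono (by omega) ?_
          simp [BitVec.carry_zero]
        · have := hA.gate₃ (hΦ (ha' i (by omega))) (hΦ (hb' i (by omega))) (hlt i (by omega))
            Bool.atLeastTwo
          refine this.mono le_rfl ?_
          simp only [BitVec.carry_succ]
          exact subset_rfl)
    have h4 := Avail.family w 5 (fun i P x => (a P x + b P x).getLsbD i) h3 (by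
        intro i hi c' Φ' hΦ hlt hA
        have := hA.gate₃ (hΦ (Or.inl (ha' i (by omega)))) (hΦ (Or.inl (hb' i (by omega))))
          (hΦ (Or.inr ⟨i, hi, rfl⟩)) (fun a b c => a ^^ (b ^^ c))
        refine this.mono le_rfl ?_
        simp only [BitVec.getLsbD_add hi]
        exact subset_rfl)
    exact h4.mono (by omega) subset_rfl
  refine h2.mono (by omega) ?_
  rintro φ (hφ | ⟨i, hi, rfl⟩)
  · exact Or.inl (Or.inl hφ)
  · exact Or.inr ⟨i, hi, rfl⟩

end Available

lemma getLsbD_ofInt (w : ℕ) (z : ℤ) (i : ℕ) :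
    (BitVec.ofInt w z).getLsbD i = (decide (i < w) && Int.testBit z i) := by
  cases z with
  | ofNat m =>
    have : BitVec.ofInt w (Int.ofNat m) = BitVec.ofNat w m := BitVec.ofInt_natCast w m
    rw [this, BitVec.getLsbD_ofNat]; rfl
  | negSucc m =>
    rw [BitVec.ofInt_negSucc_eq_not_ofNat, BitVec.getLsbD_not, BitVec.getLsbD_ofNat]
    simp only [Int.testBit]
    by_cases h : i < w <;> simp [h]

/-! ### Comparisons, constants and queries on registers. -/

section Available

variable {D : Type} {n : ℕ} {q : Polynomial ℕ} {base Φ Ψ : Set (BoolFun D)} {c : ℕ}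

lemma mem_bits_of_lt {w : ℕ} {a : Procedures → (D → Bool) → BitVec w} {i : ℕ} (hi : i < w) :
    (fun P x => (a P x).getLsbD i) ∈ bits a := ⟨i, hi, rfl⟩

lemma Avail.mono' {Φ' : Set (BoolFun D)} {c' : ℕ} (h : Avail n q base c Φ) (hΦ : Φ' ⊆ Φ)
    (hc : c ≤ c') : Avail n q base c' Φ' := h.mono hc hΦ

/-- Comparison of two numbers. -/
lemma Avail.ult (h : Avail n q base c Φ) {w : ℕ} (hw : 0 < w)
    {a b : Procedures → (D → Bool) → BitVec w}
    (ha : bits a ⊆ Φ) (hb : bits b ⊆ Φ) :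
    Avail n q base (c + 5 * w + 7) (insert (fun P x => (a P x).ult (b P x)) Φ) := by
  -- `a < b` holds exactly if `a + ~b + 1` has no carry out of the highest digit, so only carries
  -- are computed. The carry with index `w` is the one needed.
  have h3 := Avail.family (w + 1) 5
    (fun i P x => BitVec.carry i (a P x) (~~~ (b P x)) true) h (by
      intro i hi c' Φ' hΦ hlt hA
      rcases i with _ | i
      · have := hA.const (hΦ (ha (mem_bits_of_lt hw))) true
        refine this.mono (by omega) ?_
        simp [BitVec.carry_zero]
      · have := hA.gate₃ (hΦ (ha (mem_bits_of_lt (i := i) (by omega))))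
          (hΦ (hb (mem_bits_of_lt (i := i) (by omega)))) (hlt i (by omega))
          (fun x y z => Bool.atLeastTwo x (!y) z)
        refine this.mono le_rfl ?_
        have hi' : i < w := by omega
        simp only [BitVec.carry_succ, BitVec.getLsbD_not, hi', decide_true, Bool.true_and]
        exact subset_rfl)
  have hw' : (fun P x => BitVec.carry w (a P x) (~~~ (b P x)) true) ∈
      Φ ∪ {φ | ∃ i < w + 1, φ = fun P x => BitVec.carry i (a P x) (~~~ (b P x)) true} :=
    Or.inr ⟨w, by omega, rfl⟩
  refine (h3.gate hw' hw' fun a _ => !a).mono (by omega) ?_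
  simp only [BitVec.ult_eq_not_carry]
  exact Set.insert_subset_insert Set.subset_union_left

/-- Comparison of two signed numbers. -/
lemma Avail.slt (h : Avail n q base c Φ) {w : ℕ} (hw : 0 < w)
    {a b : Procedures → (D → Bool) → BitVec w}
    (ha : bits a ⊆ Φ) (hb : bits b ⊆ Φ) :
    Avail n q base (c + 5 * w + 12) (insert (fun P x => (a P x).slt (b P x)) Φ) := by
  have h1 := h.ult hw ha hb
  have h2 := h1.gate₃ (Set.mem_insert_of_mem _ (ha (mem_bits_of_lt (i := w - 1) (by omega))))
    (Set.mem_insert_of_mem _ (hb (mem_bits_of_lt (i := w - 1) (by omega))))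
    (Set.mem_insert _ _) (fun x y z => x != y ^^ z)
  refine h2.mono (by omega) ?_
  simp only [BitVec.slt_eq_ult, BitVec.msb_eq_getLsbD_last]
  exact Set.insert_subset_insert (Set.subset_insert _ _)

/-- The bits of a given number. -/
lemma Avail.ofNat (h : Avail n q base c Φ) {φ : BoolFun D} (hφ : φ ∈ Φ) (w k : ℕ) :
    Avail n q base (c + w) (Φ ∪ bits fun _ _ => BitVec.ofNat w k) := by
  have := Avail.family w 1 (fun i _ _ => (BitVec.ofNat w k).getLsbD i) h
    fun i hi c' Φ' hΦ _ hA => hA.const (hΦ hφ) _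
  exact this.mono (by omega) subset_rfl

/-- A query whose answer is given as a number of bits. -/
lemma Avail.query (h : Avail n q base c Φ) (f : Query)
    (arg : Fin f.arity → Procedures → (D → Bool) → BitVec n) (harg : ∀ a, bits (arg a) ⊆ Φ) :
    Avail n q base (c + q.eval (n + f.precision))
      (Φ ∪ bits fun P x => BitVec.ofInt (f.width n) (P.answer f fun a => (arg a P x).toNat)) := by
  have h1 := h.call f (fun a l P x => (arg a P x).getLsbD l)
    fun a l => harg a (mem_bits_of_lt l.2)
  refine h1.mono le_rfl (Set.union_subset_union_right _ ?_)
  rintro φ ⟨i, hi, rfl⟩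
  refine ⟨⟨i, hi⟩, ?_⟩
  funext P x
  have e : ∀ u : BitVec n, Nat.ofBits (fun l : Fin n => u.getLsbD l) = u.toNat := by
    intro u
    rw [← BitVec.toNat_ofFnLE]
    congr 1
    refine BitVec.eq_of_getLsbD_eq fun i hi => ?_
    simp [hi]
  simp only [answerBit, e, getLsbD_ofInt, hi, decide_true, Bool.true_and]

lemma Avail.depth {a : Procedures → (D → Bool) → BitVec n} (h : Avail n q base c Φ)
    (ha : bits a ⊆ Φ) : Avail n q base (c + q.eval n)
      (Φ ∪ bits fun P x => BitVec.ofNat n (P.depth (a P x).toNat)) := by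
  refine (h.query .depth (fun _ => a) fun _ => ha).mono' ?_ le_rfl
  simp only [Procedures.answer, Query.width, BitVec.ofInt_natCast]
  exact subset_rfl

lemma Avail.degree {a : Procedures → (D → Bool) → BitVec n} (h : Avail n q base c Φ)
    (ha : bits a ⊆ Φ) : Avail n q base (c + q.eval n)
      (Φ ∪ bits fun P x => BitVec.ofNat n (P.degree (a P x).toNat)) := by
  refine (h.query .degree (fun _ => a) fun _ => ha).mono' ?_ le_rfl
  simp only [Procedures.answer, Query.width, BitVec.ofInt_natCast]
  exact subset_rfl

lemma Avail.parent {a : Procedures → (D → Bool) → BitVec n} (h : Avail n q base c Φ)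
    (ha : bits a ⊆ Φ) : Avail n q base (c + q.eval n)
      (Φ ∪ bits fun P x => BitVec.ofNat n (P.parent (a P x).toNat)) := by
  refine (h.query .parent (fun _ => a) fun _ => ha).mono' ?_ le_rfl
  simp only [Procedures.answer, Query.width, BitVec.ofInt_natCast]
  exact subset_rfl

lemma Avail.neighbor {a b : Procedures → (D → Bool) → BitVec n} (h : Avail n q base c Φ)
    (ha : bits a ⊆ Φ) (hb : bits b ⊆ Φ) : Avail n q base (c + q.eval n)
      (Φ ∪ bits fun P x => BitVec.ofNat n (P.neighbor (a P x).toNat (b P x).toNat)) := by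
  refine (h.query .neighbor ![a, b] fun i => ?_).mono' ?_ le_rfl
  · fin_cases i
    exacts [ha, hb]
  · simp only [Procedures.answer, Query.width, BitVec.ofInt_natCast]
    exact subset_rfl

lemma Avail.position {a b : Procedures → (D → Bool) → BitVec n} (h : Avail n q base c Φ)
    (ha : bits a ⊆ Φ) (hb : bits b ⊆ Φ) : Avail n q base (c + q.eval n)
      (Φ ∪ bits fun P x => BitVec.ofNat n (P.position (a P x).toNat (b P x).toNat)) := by
  refine (h.query .position ![a, b] fun i => ?_).mono' ?_ le_rfl
  · fin_cases i
    exacts [ha, hb]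
  · simp only [Procedures.answer, Query.width, BitVec.ofInt_natCast]
    exact subset_rfl

lemma Avail.weight (im : Bool) (p : ℕ) {a b : Procedures → (D → Bool) → BitVec n}
    (h : Avail n q base c Φ) (ha : bits a ⊆ Φ) (hb : bits b ⊆ Φ) :
    Avail n q base (c + q.eval (n + p))
      (Φ ∪ bits fun P x => BitVec.ofInt (p + 2)
        ((if im then P.weightIm else P.weightRe) p (a P x).toNat (b P x).toNat)) := by
  cases im
  · refine (h.query (.weightRe p) ![a, b] fun i => ?_).mono' ?_ le_rfl
    · fin_cases i
      exacts [ha, hb]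
    · exact subset_rfl
  · refine (h.query (.weightIm p) ![a, b] fun i => ?_).mono' ?_ le_rfl
    · fin_cases i
      exacts [ha, hb]
    · exact subset_rfl

lemma Avail.integral (p : ℕ) {a b d : Procedures → (D → Bool) → BitVec n}
    (h : Avail n q base c Φ) (ha : bits a ⊆ Φ) (hb : bits b ⊆ Φ) (hd : bits d ⊆ Φ) :
    Avail n q base (c + q.eval (n + p))
      (Φ ∪ bits fun P x => BitVec.ofInt (p + 2)
        (P.integral p (a P x).toNat (b P x).toNat (d P x).toNat)) := by
  refine (h.query (.integral p) ![a, b, d] fun i => ?_).mono' ?_ le_rfl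
  · fin_cases i
    exacts [ha, hb, hd]
  · exact subset_rfl

end Available

/-! ## The classical functions of a vertex used in the simulation -/

/-- A part of the Hamiltonian: the parity of the depth of the children, the real or imaginary part
of the weights, its sign, and a binary digit of it. -/
structure HamPart where
  parity : Bool
  im : Bool
  sgn : Bool
  level : ℕ

section Functions

variable {n : ℕ} (P : Procedures)

def depthVec (v : BitVec n) : BitVec n := BitVec.ofNat n (P.depth v.toNat)

def degreeVec (v : BitVec n) : BitVec n := BitVec.ofNat n (P.degree v.toNat)

/-- Whether `v` is a child in the stars of a given parity. -/
def isChild (c : Bool) (v : BitVec n) : Bool := (depthVec P v).getLsbD 0 ^^ c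

def parentVec (v : BitVec n) : BitVec n :=
  BitVec.ofNat n (P.neighbor v.toNat (BitVec.ofNat n (P.parent v.toNat)).toNat)

/-- The index of `v` among the neighbors of its parent. -/
def positionVec (v : BitVec n) : BitVec n :=
  BitVec.ofNat n (P.position (parentVec P v).toNat v.toNat)

/-- The sum of the squared moduli of the weights of the edges from `u` with index less than `k`. -/
def cumulative (p : ℕ) (u k : BitVec n) : BitVec (p + 2) :=
  BitVec.ofInt (p + 2) (P.integral p u.toNat (BitVec.ofNat n 0).toNat k.toNat)

/-- The weight of the edge from the parent of `v` to `v`. -/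
def weightVec (im : Bool) (β : ℕ) (v : BitVec n) : BitVec (β + 2) :=
  BitVec.ofInt (β + 2) ((if im then P.weightIm else P.weightRe) β (parentVec P v).toNat
    (positionVec P v).toNat)

/-- Whether the edge from the parent of `v` to `v` occurs in a part of the Hamiltonian. -/
def isGood (T : HamPart) (β : ℕ) (v : BitVec n) : Bool :=
  (BitVec.ofNat n 0).ult (depthVec P v) &&
    (((weightVec P T.im β v).getLsbD (β - T.level) ^^ (weightVec P T.im β v).getLsbD (β + 1)) &&
      ((weightVec P T.im β v).getLsbD (β + 1) == T.sgn))

/-- The test of the binary search. -/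
def searchTest (p : ℕ) (v : BitVec n) (y : BitVec (p + 2)) (c : BitVec n) : Bool :=
  c.ult (degreeVec P v) && (cumulative P p v c).slt (y + BitVec.ofNat (p + 2) 4)

/-- Binary search for the largest index that passes the test. -/
def search (p : ℕ) (v : BitVec n) (y : BitVec (p + 2)) : ℕ → BitVec n
  | 0 => BitVec.ofNat n 0
  | t + 1 => if searchTest P p v y (search p v y t ||| BitVec.twoPow n (n - 1 - t)) then
      search p v y t ||| BitVec.twoPow n (n - 1 - t) else search p v y t

/-- The neighbor of `v` with the index found by the binary search. -/
def childVec (p : ℕ) (v : BitVec n) (y : BitVec (p + 2)) : BitVec n :=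
  BitVec.ofNat n (P.neighbor v.toNat (search P p v y n).toNat)

end Functions

/-! ### Costs of the classical functions of a vertex. -/

section Available

variable {D : Type} {n : ℕ} {q : Polynomial ℕ} {base Φ : Set (BoolFun D)} {c : ℕ}
  {V : Procedures → (D → Bool) → BitVec n} {Q : ℕ}

lemma Avail.isChild_mem (h : Avail n q base c Φ) (hn : 0 < n) (hV : bits V ⊆ Φ)
    (hQ : q.eval n ≤ Q) (b : Bool) :
    Avail n q base (c + (Q + 1)) (insert (fun P x => isChild P b (V P x)) Φ) := by
  have h1 := h.depth hV
  have h2 := h1.gate (Or.inr (mem_bits_of_lt hn)) (Or.inr (mem_bits_of_lt hn)) (fun a _ => a ^^ b)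
  refine h2.mono (by omega) (Set.insert_subset_insert Set.subset_union_left)

lemma Avail.bits_parentVec (h : Avail n q base c Φ) (hV : bits V ⊆ Φ) (hQ : q.eval n ≤ Q) :
    Avail n q base (c + 2 * Q) (Φ ∪ bits fun P x => parentVec P (V P x)) := by
  have h1 := h.parent hV
  have h2 := h1.neighbor (hV.trans Set.subset_union_left) Set.subset_union_right
  exact h2.mono (by omega) (Set.union_subset_union_left _ Set.subset_union_left)

lemma Avail.bits_positionVec (h : Avail n q base c Φ) (hV : bits V ⊆ Φ) (hQ : q.eval n ≤ Q) :
    Avail n q base (c + 3 * Q) (Φ ∪ (bits (fun P x => parentVec P (V P x)) ∪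
      bits fun P x => positionVec P (V P x))) := by
  have h1 := h.bits_parentVec hV hQ
  have h2 := h1.position Set.subset_union_right (hV.trans Set.subset_union_left)
  refine h2.mono (by omega) (by rw [Set.union_assoc]; exact subset_rfl)

lemma Avail.bits_cumulative {p : ℕ} (h : Avail n q base c Φ) (hn : 0 < n) (hV : bits V ⊆ Φ)
    (hQ : q.eval n ≤ Q) (hQ' : q.eval (n + p) ≤ Q) :
    Avail n q base (c + (4 * Q + n)) (Φ ∪ bits fun P x =>
      cumulative P p (parentVec P (V P x)) (positionVec P (V P x))) := by
  have h1 := (h.bits_positionVec hV hQ).ofNat (Or.inl (hV (mem_bits_of_lt hn))) n 0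
  have h2 := h1.integral p (a := fun P x => parentVec P (V P x))
    (b := fun _ _ => BitVec.ofNat n 0) (d := fun P x => positionVec P (V P x))
    (fun φ hφ => Or.inl (Or.inr (Or.inl hφ))) (fun φ hφ => Or.inr hφ)
    (fun φ hφ => Or.inl (Or.inr (Or.inr hφ)))
  exact h2.mono (by omega) (Set.union_subset_union_left _ fun φ hφ => Or.inl (Or.inl hφ))

lemma Avail.isGood_mem (h : Avail n q base c Φ) (hn : 0 < n) (hV : bits V ⊆ Φ) (T : HamPart) (β : ℕ)
    (hQ : q.eval n ≤ Q) (hQ' : q.eval (n + β) ≤ Q) :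
    Avail n q base (c + (5 * Q + 6 * n + 12))
      (insert (fun P x => isGood P T β (V P x)) Φ) := by
  have h1 := h.bits_positionVec hV hQ
  have h2 := h1.weight T.im β (a := fun P x => parentVec P (V P x))
    (b := fun P x => positionVec P (V P x))
    (fun φ hφ => Or.inr (Or.inl hφ)) (fun φ hφ => Or.inr (Or.inr hφ))
  have h3 := (h2.depth (a := V) (fun φ hφ => Or.inl (Or.inl (hV hφ)))).ofNat
    (Or.inl (Or.inl (Or.inl (hV (mem_bits_of_lt hn))))) n 0
  have h4 := h3.ult hn (a := fun _ _ => BitVec.ofNat n 0) (b := fun P x => depthVec P (V P x))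
    (fun φ hφ => Or.inr hφ) (fun φ hφ => Or.inl (Or.inr hφ))
  have hm : ∀ i < β + 2, (fun P x => (weightVec P T.im β (V P x)).getLsbD i) ∈
      bits fun P x => weightVec P T.im β (V P x) := fun i hi => mem_bits_of_lt hi
  have h5 := h4.gate₃ (Set.mem_insert _ _)
    (Set.mem_insert_of_mem _ (Or.inl (Or.inl (Or.inr (hm (β - T.level) (by omega))))))
    (Set.mem_insert_of_mem _ (Or.inl (Or.inl (Or.inr (hm (β + 1) (by omega))))))
    (fun a b d => a && ((b ^^ d) && (d == T.sgn)))
  refine h5.mono (by omega) (Set.insert_subset_insert ?_)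
  exact fun φ hφ => Or.inr (Or.inl (Or.inl (Or.inl (Or.inl hφ))))

/-- A step of the search needs one integral and two comparisons. The degree, the number zero and the
threshold are computed once and stay available throughout. -/
lemma Avail.bits_search {p : ℕ} (h : Avail n q base c Φ) (hn : 0 < n) (hV : bits V ⊆ Φ)
    {Y : Procedures → (D → Bool) → BitVec (p + 2)} (hY : bits Y ⊆ Φ)
    (hQ : q.eval n ≤ Q) (hQ' : q.eval (n + p) ≤ Q) (t : ℕ) (ht : t ≤ n) :
    Avail n q base (c + (Q + 2 * n + 12 * (p + 2)) + t * (Q + 5 * n + 5 * (p + 2) + 22))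
      (Φ ∪ (bits (fun P x => degreeVec P (V P x)) ∪ (bits (fun _ _ => BitVec.ofNat n 0) ∪
        (bits (fun P x => Y P x + BitVec.ofNat (p + 2) 4) ∪
          bits fun P x => search P p (V P x) (Y P x) t)))) := by
  induction t with
  | zero =>
    have h1 := (h.degree hV).ofNat (Or.inl (hV (mem_bits_of_lt hn))) n 0
    have h2 := h1.ofNat (Or.inl (Or.inl (hV (mem_bits_of_lt hn)))) (p + 2) 4
    have h3 := h2.add (a := Y) (b := fun _ _ => BitVec.ofNat (p + 2) 4)
      (fun φ hφ => Or.inl (Or.inl (Or.inl (hY hφ)))) (fun φ hφ => Or.inr hφ)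
    refine h3.mono (by omega) ?_
    rintro φ (hφ | hφ | hφ | hφ | hφ)
    · exact Or.inl (Or.inl (Or.inl (Or.inl hφ)))
    · exact Or.inl (Or.inl (Or.inl (Or.inr hφ)))
    · exact Or.inl (Or.inl (Or.inr hφ))
    · exact Or.inr hφ
    · exact Or.inl (Or.inl (Or.inr hφ))
  | succ t ih =>
    have h0 := ih (by omega)
    set Ψ := Φ ∪ (bits (fun P x => degreeVec P (V P x)) ∪ (bits (fun _ _ => BitVec.ofNat n 0) ∪
        (bits (fun P x => Y P x + BitVec.ofNat (p + 2) 4) ∪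
          bits fun P x => search P p (V P x) (Y P x) t))) with hΨ
    have hK : bits (fun P x => search P p (V P x) (Y P x) t) ⊆ Ψ :=
      fun φ hφ => Or.inr (Or.inr (Or.inr (Or.inr hφ)))
    have h1 := h0.const (hK (mem_bits_of_lt hn)) true
    set C : Procedures → (D → Bool) → BitVec n := fun P x =>
      search P p (V P x) (Y P x) t ||| BitVec.twoPow n (n - 1 - t) with hCdef
    have hC : bits C ⊆ insert (fun _ _ => true) Ψ := by
      rintro φ ⟨i, hi, rfl⟩
      by_cases hit : n - 1 - t = i
      · left
        funext P x
        simp [hCdef, hit, hi]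
      · right
        apply hK
        refine ⟨i, hi, ?_⟩
        funext P x
        simp [hCdef, hit, BitVec.getLsbD_twoPow]
    have h2 := h1.integral p (a := V) (b := fun _ _ => BitVec.ofNat n 0) (d := C)
      (fun φ hφ => Or.inr (Or.inl (hV hφ)))
      (fun φ hφ => Or.inr (Or.inr (Or.inr (Or.inl hφ)))) hC
    have h3 := h2.slt (by omega) (a := fun P x => cumulative P p (V P x) (C P x))
      (b := fun P x => Y P x + BitVec.ofNat (p + 2) 4) (fun φ hφ => Or.inr hφ)
      (fun φ hφ => Or.inl (Or.inr (Or.inr (Or.inr (Or.inr (Or.inl hφ))))))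
    have h4 := h3.ult hn (a := C) (b := fun P x => degreeVec P (V P x))
      (fun φ hφ => Or.inr (Or.inl (hC hφ)))
      (fun φ hφ => Or.inr (Or.inl (Or.inr (Or.inr (Or.inl hφ)))))
    have h5 := h4.gate (Set.mem_insert _ _) (Set.mem_insert_of_mem _ (Set.mem_insert _ _))
      (fun a b => a && b)
    have hb : n - 1 - t < n := by omega
    -- The candidate differs from the current value at most in the digit `n - 1 - t`, so the
    -- conditional replacement is a disjunction in this digit.
    have h6 := h5.gate (Set.mem_insert _ _)
      (Or.inr (Or.inr (Or.inr (Or.inl (Or.inr (hK (mem_bits_of_lt hb)))))))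
      (fun a b => a || b)
    refine h6.mono ?_ ?_
    · rw [Nat.add_mul t 1]; omega
    · rintro φ (hφ | hφ | hφ | hφ | ⟨i, hi, rfl⟩)
      · exact Or.inr (Or.inr (Or.inr (Or.inr (Or.inl (Or.inr (Or.inl hφ))))))
      · exact Or.inr (Or.inr (Or.inr (Or.inr (Or.inl (Or.inr (Or.inr (Or.inl hφ)))))))
      · exact Or.inr (Or.inr (Or.inr (Or.inr (Or.inl (Or.inr (Or.inr (Or.inr (Or.inl hφ))))))))
      · exact Or.inr (Or.inr (Or.inr (Or.inr (Or.inl (Or.inr (Or.inr (Or.inr (Or.inr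
          (Or.inl hφ)))))))))
      · by_cases hit : n - 1 - t = i
        · left
          subst hit
          funext P x
          change (search P p (V P x) (Y P x) (t + 1)).getLsbD (n - 1 - t) =
            ((searchTest P p (V P x) (Y P x) (C P x)) || _)
          change (if searchTest P p (V P x) (Y P x) (C P x) then C P x else _).getLsbD (n - 1 - t)
            = _
          cases searchTest P p (V P x) (Y P x) (C P x)
          · simp
          · simp [hCdef, hb]
        · refine Or.inr (Or.inr (Or.inr (Or.inr (Or.inl (Or.inr (hK ⟨i, hi, ?_⟩))))))
          funext P x
          change (search P p (V P x) (Y P x) (t + 1)).getLsbD i = _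
          rw [search]
          split_ifs
          · simp [BitVec.getLsbD_twoPow, hit]
          · rfl

lemma Avail.bits_childVec {p : ℕ} (h : Avail n q base c Φ) (hn : 0 < n) (hV : bits V ⊆ Φ)
    {Y : Procedures → (D → Bool) → BitVec (p + 2)} (hY : bits Y ⊆ Φ)
    (hQ : q.eval n ≤ Q) (hQ' : q.eval (n + p) ≤ Q) :
    Avail n q base (c + (2 * Q + 2 * n + 12 * (p + 2) + n * (Q + 5 * n + 5 * (p + 2) + 22)))
      (Φ ∪ bits fun P x => childVec P p (V P x) (Y P x)) := by
  have h1 := h.bits_search hn hV hY hQ hQ' n le_rfl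
  have h2 := h1.neighbor (a := V) (b := fun P x => search P p (V P x) (Y P x) n)
    (fun φ hφ => Or.inl (hV hφ)) (fun φ hφ => Or.inr (Or.inr (Or.inr (Or.inr hφ))))
  exact h2.mono (by omega) (Set.union_subset_union_left _ Set.subset_union_left)

end Available

/-! ## Implementable unitary operators -/

section Unitary

variable {D : Type} [Fintype D] [DecidableEq D] {n : ℕ} {q : Polynomial ℕ}

/-- Unitary operators that are implemented by circuits together with their inverses. -/
structure ImplUnitary (n : ℕ) (q : Polynomial ℕ) (c : ℕ)
    (O : Procedures → Matrix (D → Bool) (D → Bool) ℂ) : Prop where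
  impl : Impl n q c O
  impl_adjoint : Impl n q c fun P => (O P).conjTranspose
  mem_unitary : ∀ P, O P ∈ Matrix.unitaryGroup (D → Bool) ℂ

lemma ImplUnitary.mono {c c' : ℕ} {O : Procedures → Matrix (D → Bool) (D → Bool) ℂ}
    (h : ImplUnitary n q c O) (hc : c ≤ c') : ImplUnitary n q c' O :=
  ⟨h.impl.mono hc, h.impl_adjoint.mono hc, h.mem_unitary⟩

lemma ImplUnitary.mul {c c' : ℕ} {O O' : Procedures → Matrix (D → Bool) (D → Bool) ℂ}
    (h : ImplUnitary n q c O) (h' : ImplUnitary n q c' O') :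
    ImplUnitary n q (c + c') (fun P => O P * O' P) where
  impl := h.impl.mul h'.impl
  impl_adjoint := by
    simp only [Matrix.conjTranspose_mul]
    exact (h'.impl_adjoint.mul h.impl_adjoint).mono (by omega)
  mem_unitary P := mul_mem (h.mem_unitary P) (h'.mem_unitary P)

lemma ImplUnitary.one :
    ImplUnitary n q 0 (fun _ => (1 : Matrix (D → Bool) (D → Bool) ℂ)) where
  impl := Impl.one
  impl_adjoint := by simpa using Impl.one
  mem_unitary _ := one_mem _

lemma ImplUnitary.list_prod {ι : Type} (l : List ι) {c : ℕ}
    {O : ι → Procedures → Matrix (D → Bool) (D → Bool) ℂ}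
    (h : ∀ i ∈ l, ImplUnitary n q c (O i)) :
    ImplUnitary n q (l.length * c) (fun P => (l.map fun i => O i P).prod) := by
  induction l with
  | nil => simpa using ImplUnitary.one
  | cons i l ih =>
    have := (h i (by simp)).mul (ih fun i hi => h i (by simp [hi]))
    refine (this.mono (le_of_eq ?_))
    rw [List.length_cons]; ring

theorem Avail.implUnitary {w : D} {c c' : ℕ} {Φ : Set (BoolFun D)}
    (h : Avail n q (otherQubits w) c Φ) {f : BoolFun D} (hf : f ∈ Φ) {M : Matrix Bool Bool ℂ}
    (hM : M ∈ Matrix.unitaryGroup Bool ℂ) (hc : 2 * c + 1 ≤ c') :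
    ImplUnitary n q c' (fun P => ctrlMat (f P) w M) := by
  refine ⟨(h.impl hf hM).mono hc, ?_, fun P => ctrlMat_mem_unitary (h.indepOf f hf P) hM⟩
  have e : (fun P => (ctrlMat (f P) w M).conjTranspose) =
      fun P => ctrlMat (f P) w M.conjTranspose := by
    funext P
    exact ctrlMat_conjTranspose (h.indepOf f hf P) M
  rw [e]
  have hM' : M.conjTranspose ∈ Matrix.unitaryGroup Bool ℂ := by
    rw [← Matrix.star_eq_conjTranspose]
    exact Unitary.star_mem hM
  exact (h.impl hf hM').mono hc

end Unitary

/-! ## Products of controlled operations on basis states -/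

section BasisStates

set_option linter.unusedSectionVars false
set_option linter.unusedSimpArgs false

variable {ι κ : Type} [Fintype ι] [DecidableEq ι] [DecidableEq κ]

/-- A computational basis state. -/
def ket (x : ι → Bool) : (ι → Bool) → ℂ := Pi.single x 1

lemma ket_apply (x y : ι → Bool) : ket x y = if y = x then 1 else 0 := by
  rw [ket, Pi.single_apply]

lemma ctrlMat_not_ket {f : (ι → Bool) → Bool} {w : ι} (hf : IndepOf w f) (x : ι → Bool) :
    (ctrlMat f w notMat).mulVec (ket x) = ket (Function.update x w (x w ^^ f x)) := by
  funext z
  have key : ∀ v : Bool, (Function.update z w (z w ^^ v) = x ∧ f z = v) ↔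
      (z = Function.update x w (x w ^^ v) ∧ f z = v) := by
    intro v
    constructor
    · rintro ⟨h, h'⟩; refine ⟨?_, h'⟩; rw [← h]; simp
    · rintro ⟨h, h'⟩; refine ⟨?_, h'⟩; rw [h]; simp
  have hfx : ∀ b, z = Function.update x w b → f z = f x := by
    rintro b rfl; exact hf x b
  have hfz : ∀ b, Function.update z w b = x → f z = f x := by
    rintro b rfl; exact (hf z b).symm
  rw [ctrlMat_mulVec, sum_notMat (z w) (fun b => ket x (Function.update z w b))]
  simp only [ket_apply]
  have k1 := key true
  have k2 := key false
  simp only [Bool.xor_true, Bool.xor_false, Function.update_eq_self] at k1 k2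
  cases hz : f z <;> cases hx : f x <;> simp only [hz, hx, Bool.xor_true, Bool.xor_false,
    Function.update_eq_self, if_true, Bool.false_eq_true, if_false]
  · rw [if_neg, if_neg]
    · intro h; have := hfx _ h; simp_all
    · intro h; have := hfz (z w) (by simpa using h); simp_all
  · rw [if_neg, if_neg]
    · intro h; have := hfx (x w) (by simpa using h); simp_all
    · intro h; have := hfz _ h; simp_all
  · have := k1
    simp only [hz, and_true] at this
    simp only [this]

/-- No control reads any target, so every flip sees the original values and the product is a single
exclusive or to a register. -/
lemma list_prod_not_ket (e : κ ↪ ι) (F : κ → (ι → Bool) → Bool)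
    (hF : ∀ k k' x b, F k (Function.update x (e k') b) = F k x) (l : List κ) (hl : l.Nodup)
    (x : ι → Bool) :
    ((l.map fun k => ctrlMat (F k) (e k) notMat).prod).mulVec (ket x) =
      ket fun i => x i ^^ Function.extend e (fun k => decide (k ∈ l) && F k x) (fun _ => false) i := by
  have hext : ∀ (l : List κ) (k : κ),
      Function.extend e (fun k => decide (k ∈ l) && F k x) (fun _ => false) (e k) =
        (decide (k ∈ l) && F k x) := fun l k => e.injective.extend_apply _ _ k
  have hext' : ∀ (l : List κ) (i : ι), (¬ ∃ k, e k = i) →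
      Function.extend e (fun k => decide (k ∈ l) && F k x) (fun _ => false) i = false :=
    fun l i hi => Function.extend_apply' _ _ _ hi
  induction l with
  | nil =>
    rw [List.map_nil, List.prod_nil, Matrix.one_mulVec]
    congr 1
    funext i
    by_cases hi : ∃ k, e k = i
    · obtain ⟨k, rfl⟩ := hi
      rw [hext]; simp
    · rw [hext' _ _ hi]; simp
  | cons k l ih =>
    rw [List.map_cons, List.prod_cons, ← Matrix.mulVec_mulVec, ih hl.of_cons,
      ctrlMat_not_ket (fun x b => hF k k x b)]
    have hk : k ∉ l := (List.nodup_cons.1 hl).1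
    have hFx : F k (fun i => x i ^^
        Function.extend e (fun k => decide (k ∈ l) && F k x) (fun _ => false) i) = F k x := by
      have : ∀ l' : List κ, F k (fun i => x i ^^
          Function.extend e (fun k => decide (k ∈ l') && F k x) (fun _ => false) i) = F k x := by
        intro l'
        induction l' with
        | nil =>
          congr 1
          funext i
          by_cases hi : ∃ k, e k = i
          · obtain ⟨k, rfl⟩ := hi
            rw [hext]; simp
          · rw [hext' _ _ hi]; simp
        | cons a l' ih' =>
          rw [← ih', ← hF k a _ (x (e a) ^^ F a x)]
          conv_rhs => rw [← hF k a _ (x (e a) ^^ F a x)]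
          congr 1
          funext i
          by_cases hia : i = e a
          · subst hia; simp
          · rw [Function.update_of_ne hia, Function.update_of_ne hia]
            by_cases hi : ∃ k, e k = i
            · obtain ⟨b, rfl⟩ := hi
              rw [hext, hext]
              have : b ≠ a := fun h => hia (h ▸ rfl)
              simp [this]
            · rw [hext' _ _ hi, hext' _ _ hi]
      exact this l
    rw [hFx]
    congr 1
    funext i
    by_cases hi : ∃ k, e k = i
    · obtain ⟨a, rfl⟩ := hi
      by_cases ha : a = k
      · subst ha
        rw [Function.update_self, hext, hext]
        simp [hk]
      · rw [Function.update_of_ne (fun h => ha (e.injective h)), hext, hext]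
        simp [ha]
    · rw [Function.update_of_ne (fun h => hi ⟨k, h.symm⟩), hext' _ _ hi, hext' _ _ hi]

/-- The Hadamard gate. -/
noncomputable def hadamardMat : Matrix Bool Bool ℂ := fun a b =>
  if a && b then -((Real.sqrt 2)⁻¹ : ℝ) else ((Real.sqrt 2)⁻¹ : ℝ)

lemma hadamardMat_mem_unitary : hadamardMat ∈ Matrix.unitaryGroup Bool ℂ := by
  have h : (((Real.sqrt 2)⁻¹ : ℝ) : ℂ) * (((Real.sqrt 2)⁻¹ : ℝ) : ℂ) = 1 / 2 := by
    rw [← Complex.ofReal_mul, ← mul_inv, Real.mul_self_sqrt (by norm_num)]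
    push_cast; norm_num
  rw [Matrix.mem_unitaryGroup_iff]
  ext a b
  cases a <;> cases b <;>
    simp only [hadamardMat, Matrix.mul_apply, Matrix.star_apply, Fintype.sum_bool, Matrix.one_apply,
      Bool.and_true, Bool.and_false, Bool.true_and, Bool.false_and, if_true, Bool.false_eq_true,
      if_false, star_neg, map_neg, Complex.star_def, Complex.conj_ofReal, mul_neg, neg_mul, h, neg_neg,
      reduceCtorEq] <;> norm_num

-- The controls read no target and the targets start at zero, so the active Hadamard gates act
-- independently and produce a uniform superposition over their targets.
open Classical in
lemma list_prod_hadamard_ket (e : κ ↪ ι) (F : κ → (ι → Bool) → Bool)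
    (hF : ∀ k k' x b, F k (Function.update x (e k') b) = F k x) (l : List κ) (hl : l.Nodup)
    (x : ι → Bool) (hx : ∀ k, x (e k) = false) (z : ι → Bool) :
    ((l.map fun k => ctrlMat (F k) (e k) hadamardMat).prod).mulVec (ket x) z =
      if ∀ i, (∀ k ∈ l, F k x = true → e k ≠ i) → z i = x i then
        (((Real.sqrt 2)⁻¹ : ℝ) : ℂ) ^ (l.countP fun k => F k x) else 0 := by
  induction l generalizing z with
  | nil =>
    simp only [List.map_nil, List.prod_nil, Matrix.one_mulVec, List.not_mem_nil, false_implies,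
      implies_true, true_implies, ket_apply, List.countP_nil, pow_zero]
    simp only [funext_iff]
  | cons k l ih =>
    have hk : k ∉ l := (List.nodup_cons.1 hl).1
    rw [List.map_cons, List.prod_cons, ← Matrix.mulVec_mulVec, ctrlMat_mulVec]
    simp only [ih hl.of_cons]
    -- `z` and `x` differ only in targets. Changing these one at a time never alters the control.
    have hagree : ∀ z, (∀ i, (∀ k ∈ l, F k x = true → e k ≠ i) → z i = x i) → F k z = F k x := by
      intro z hz
      have : ∀ l' : List κ, ∀ y, (∀ i, (∀ k ∈ l', e k ≠ i) → z i = y i) → F k z = F k y := by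
        intro l'
        induction l' with
        | nil =>
          intro y hy
          congr 1
          funext i
          exact hy i (by simp)
        | cons a l' ih' =>
          intro y hy
          rw [← hF k a y (z (e a))]
          refine ih' _ fun i hi => ?_
          by_cases hia : i = e a
          · subst hia; simp
          · rw [Function.update_of_ne hia]
            refine hy i fun b hb => ?_
            rcases List.mem_cons.1 hb with rfl | hb
            · exact fun h => hia h.symm
            · exact hi b hb
      exact this l x fun i hi => hz i fun b hb _ => hi b hb
    by_cases hfx : F k x = true
    · rw [List.countP_cons_of_pos (p := fun k => F k x) hfx]
      have hcond : ∀ b, (∀ i, (∀ k ∈ l, F k x = true → e k ≠ i) →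
          Function.update z (e k) b i = x i) ↔ (b = false ∧
          ∀ i, (∀ k' ∈ k :: l, F k' x = true → e k' ≠ i) → z i = x i) := by
        intro b
        constructor
        · intro h
          refine ⟨?_, fun i hi => ?_⟩
          · have := h (e k) (fun a ha _ hak => hk (e.injective hak ▸ ha))
            rw [Function.update_self, hx] at this
            exact this
          · have := h i fun a ha => hi a (List.mem_cons_of_mem _ ha)
            rwa [Function.update_of_ne (fun h => hi k List.mem_cons_self hfx h.symm)] at this
        · rintro ⟨rfl, h⟩ i hi
          by_cases hik : i = e k
          · subst hik; rw [Function.update_self, hx]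
          · rw [Function.update_of_ne hik]
            refine h i fun a ha => ?_
            rcases List.mem_cons.1 ha with rfl | ha
            · exact fun _ h => hik h.symm
            · exact hi a ha
      simp only [hcond]
      rw [Fintype.sum_bool]
      by_cases hz : ∀ i, (∀ k' ∈ k :: l, F k' x = true → e k' ≠ i) → z i = x i
      · have hfz : F k z = true := by
          rw [← hF k k z false, hagree _ ((hcond false).2 ⟨rfl, hz⟩), hfx]
        rw [if_pos hfz, if_pos hz]
        rw [if_neg (fun h => absurd h.1 (by simp)), if_pos ⟨rfl, hz⟩]
        simp only [hadamardMat, Bool.and_false]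
        simp [pow_succ, mul_comm]
      · rw [if_neg hz]
        by_cases hfz : F k z = true
        · rw [if_pos hfz, if_neg (fun h => hz h.2), if_neg (fun h => hz h.2)]
          simp
        · rw [if_neg hfz, if_neg]
          exact fun h => hz fun i hi => h i fun a ha => hi a (List.mem_cons_of_mem _ ha)
    · rw [List.countP_cons_of_neg (p := fun k => F k x) hfx]
      have hcond : (∀ i, (∀ k' ∈ k :: l, F k' x = true → e k' ≠ i) → z i = x i) ↔
          ∀ i, (∀ k ∈ l, F k x = true → e k ≠ i) → z i = x i := by
        simp [hfx]
      by_cases hz : ∀ i, (∀ k ∈ l, F k x = true → e k ≠ i) → z i = x i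
      · have hfz : ¬ F k z = true := by rw [hagree z hz]; exact hfx
        rw [if_neg hfz, if_pos hz, if_pos (hcond.2 hz)]
      · rw [if_neg hz, if_neg (fun h => hz (hcond.1 h))]
        split_ifs with hfz
        · refine Finset.sum_eq_zero fun b _ => ?_
          rw [if_neg, mul_zero]
          intro h
          have : F k z = F k x := by rw [← hF k k z b, hagree _ h]
          exact hfx (this ▸ hfz)
        · rfl

end BasisStates

/-! ## The isometry that maps vertices to edges -/

/-- The data qubits: the vertex, the other end of an edge, a mark, and two more qubits, which tell
whether the vertex is a child and whether the edge to its parent is to be ignored. -/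
abbrev Wire (n w : ℕ) : Type := (Fin n ⊕ Fin n) ⊕ (Fin w ⊕ Bool)

section Wires

variable {n w : ℕ}

abbrev vertexWire (i : Fin n) : Wire n w := .inl (.inl i)
abbrev otherWire (i : Fin n) : Wire n w := .inl (.inr i)
abbrev markWire (i : Fin w) : Wire n w := .inr (.inl i)
abbrev roleWire : Wire n w := .inr (.inr false)
abbrev flagWire : Wire n w := .inr (.inr true)

def vertexEmb : Fin n ↪ Wire n w := ⟨vertexWire, fun i j h => by simpa using h⟩
def otherEmb : Fin n ↪ Wire n w := ⟨otherWire, fun i j h => by simpa using h⟩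
def markEmb : Fin w ↪ Wire n w := ⟨markWire, fun i j h => by simpa using h⟩

@[simp] lemma vertexEmb_apply (i : Fin n) : (vertexEmb i : Wire n w) = vertexWire i := rfl
@[simp] lemma otherEmb_apply (i : Fin n) : (otherEmb i : Wire n w) = otherWire i := rfl
@[simp] lemma markEmb_apply (i : Fin w) : (markEmb i : Wire n w) = markWire i := rfl

/-- The content of the qubits. -/
def content (v u : BitVec n) (y : BitVec w) (r g : Bool) : Wire n w → Bool :=
  Sum.elim (Sum.elim (fun i => v.getLsbD i) fun i => u.getLsbD i)
    (Sum.elim (fun i => y.getLsbD i) fun b => if b then g else r)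

def vertexReg (x : Wire n w → Bool) : BitVec n := BitVec.ofFnLE fun i => x (vertexWire i)

def markReg (p : ℕ) (x : Wire n w → Bool) : BitVec (p + 2) :=
  BitVec.ofFnLE fun i => if h : i.1 < w then x (markWire ⟨i, h⟩) else false

@[simp] lemma vertexReg_content (v u : BitVec n) (y : BitVec w) (r g : Bool) :
    vertexReg (content v u y r g) = v := by
  refine BitVec.eq_of_getLsbD_eq fun i hi => ?_
  simp [vertexReg, content, hi]

@[simp] lemma markReg_content (p : ℕ) (v u : BitVec n) (y : BitVec w) (r g : Bool) :
    markReg p (content v u y r g) = y.setWidth (p + 2) := by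
  refine BitVec.eq_of_getLsbD_eq fun i hi => ?_
  by_cases h : i < w
  · simp [markReg, content, hi, h]
  · simp [markReg, hi, h, BitVec.getLsbD_of_ge y i (by omega)]

@[simp] lemma content_role (v u : BitVec n) (y : BitVec w) (r g : Bool) :
    content v u y r g roleWire = r := rfl

@[simp] lemma content_flag (v u : BitVec n) (y : BitVec w) (r g : Bool) :
    content v u y r g flagWire = g := rfl

lemma content_injective {v u v' u' : BitVec n} {y y' : BitVec w} {r g r' g' : Bool} :
    content v u y r g = content v' u' y' r' g' ↔
      v = v' ∧ u = u' ∧ y = y' ∧ r = r' ∧ g = g' := by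
  constructor
  · intro h
    refine ⟨?_, ?_, ?_, congrFun h roleWire, congrFun h flagWire⟩
    · exact BitVec.eq_of_getLsbD_eq fun i hi => congrFun h (vertexWire ⟨i, hi⟩)
    · exact BitVec.eq_of_getLsbD_eq fun i hi => congrFun h (otherWire ⟨i, hi⟩)
    · exact BitVec.eq_of_getLsbD_eq fun i hi => congrFun h (markWire ⟨i, hi⟩)
  · rintro ⟨rfl, rfl, rfl, rfl, rfl⟩; rfl

lemma setWidth_setWidth_self {a b : ℕ} (h : a ≤ b) (y : BitVec a) :
    (y.setWidth b).setWidth a = y := by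
  refine BitVec.eq_of_getLsbD_eq fun i hi => ?_
  simp [hi, show i < b by omega]

lemma setWidth_injective {a b : ℕ} (h : a ≤ b) {y y' : BitVec a} :
    y.setWidth b = y'.setWidth b ↔ y = y' := by
  constructor
  · intro e
    rw [← setWidth_setWidth_self h y, e, setWidth_setWidth_self h]
  · rintro rfl; rfl

lemma update_role (v u : BitVec n) (y : BitVec w) (r g b : Bool) :
    Function.update (content v u y r g) roleWire b = content v u y b g := by
  funext i
  rcases i with (i | i) | (i | i | i) <;> simp [content]

lemma update_flag (v u : BitVec n) (y : BitVec w) (r g b : Bool) :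
    Function.update (content v u y r g) flagWire b = content v u y r b := by
  funext i
  rcases i with (i | i) | (i | i | i) <;> simp [content]

lemma xor_vertex (v u a : BitVec n) (y : BitVec w) (r g : Bool) (F : Fin n → Bool)
    (hF : ∀ i : Fin n, F i = a.getLsbD i) :
    (fun i => content v u y r g i ^^ Function.extend vertexEmb
      (fun k => decide (k ∈ List.finRange n) && F k) (fun _ => false) i) =
      content (v ^^^ a) u y r g := by
  funext i
  rcases i with (i | i) | i
  · have : (Sum.inl (Sum.inl i) : Wire n w) = vertexEmb i := rfl
    rw [this, vertexEmb.injective.extend_apply]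
    simp [content, hF]
  all_goals
    rw [Function.extend_apply']
    · simp [content]
    · rintro ⟨k, hk⟩; simp at hk

lemma xor_other (v u a : BitVec n) (y : BitVec w) (r g : Bool) (F : Fin n → Bool)
    (hF : ∀ i : Fin n, F i = a.getLsbD i) :
    (fun i => content v u y r g i ^^ Function.extend otherEmb
      (fun k => decide (k ∈ List.finRange n) && F k) (fun _ => false) i) =
      content v (u ^^^ a) y r g := by
  funext i
  rcases i with (i | i) | i
  rotate_left
  · have : (Sum.inl (Sum.inr i) : Wire n w) = otherEmb i := rfl
    rw [this, otherEmb.injective.extend_apply]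
    simp [content, hF]
  all_goals
    rw [Function.extend_apply']
    · simp [content]
    · rintro ⟨k, hk⟩; simp at hk

lemma xor_mark (v u : BitVec n) (y a : BitVec w) (r g : Bool) (F : Fin w → Bool)
    (hF : ∀ i : Fin w, F i = a.getLsbD i) :
    (fun i => content v u y r g i ^^ Function.extend markEmb
      (fun k => decide (k ∈ List.finRange w) && F k) (fun _ => false) i) =
      content v u (y ^^^ a) r g := by
  funext i
  rcases i with i | (i | i)
  rotate_left
  · have : (Sum.inr (Sum.inl i) : Wire n w) = markEmb i := rfl
    rw [this, markEmb.injective.extend_apply]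
    simp [content, hF]
  all_goals
    rw [Function.extend_apply']
    · simp [content]
    · rintro ⟨k, hk⟩; simp at hk

end Wires

/-! ### The factors of the isometry and their action on basis states. -/

section Operators

variable {n w : ℕ}

/-- Decide whether the vertex is a child. -/
def roleOp (b : Bool) (P : Procedures) : Matrix (Wire n w → Bool) (Wire n w → Bool) ℂ :=
  ctrlMat (fun x => isChild P b (vertexReg x)) roleWire notMat

/-- Spread the mark of a vertex that is not a child over all possible values. -/
noncomputable def spreadOp (p : ℕ) : Matrix (Wire n w → Bool) (Wire n w → Bool) ℂ :=
  ((List.finRange w).map fun i : Fin w =>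
    ctrlMat (fun x => !x roleWire && decide (i.1 < p + 2)) (markEmb i) hadamardMat).prod

/-- The other end of the edge. -/
def linkValue (p : ℕ) (P : Procedures) (x : Wire n w → Bool) : BitVec n :=
  vertexReg x ^^^ if x roleWire then parentVec P (vertexReg x)
    else childVec P p (vertexReg x) (markReg p x)

noncomputable def linkOp (p : ℕ) (P : Procedures) :
    Matrix (Wire n w → Bool) (Wire n w → Bool) ℂ :=
  ((List.finRange n).map fun i : Fin n =>
    ctrlMat (fun x => (linkValue p P x).getLsbD i) (otherEmb i) notMat).prod

/-- Compute the mark of a child. -/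
noncomputable def childMarkOp (p : ℕ) (P : Procedures) :
    Matrix (Wire n w → Bool) (Wire n w → Bool) ℂ :=
  ((List.finRange w).map fun i : Fin w =>
    ctrlMat (fun x => x roleWire && (cumulative P p (parentVec P (vertexReg x))
      (positionVec P (vertexReg x))).getLsbD i) (markEmb i) notMat).prod

/-- Flag a child that is to be ignored. -/
def flagOp (T : HamPart) (β : ℕ) (P : Procedures) :
    Matrix (Wire n w → Bool) (Wire n w → Bool) ℂ :=
  ctrlMat (fun x => x roleWire && !isGood P T β (vertexReg x)) flagWire notMat

/-- Let the parent take the place of the child. -/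
noncomputable def exchangeOp : Matrix (Wire n w → Bool) (Wire n w → Bool) ℂ :=
  ((List.finRange n).map fun i : Fin n =>
    ctrlMat (fun x => x roleWire && x (otherWire i)) (vertexEmb i) notMat).prod

/-- The number of bits of precision of the integrals. -/
def HamPart.precision (T : HamPart) : ℕ := 2 * T.level + 4

/-- The operator that maps a vertex to a superposition of edges. -/
noncomputable def edgeOp (T : HamPart) (β : ℕ) (P : Procedures) :
    Matrix (Wire n w → Bool) (Wire n w → Bool) ℂ :=
  exchangeOp * (flagOp T β P * (childMarkOp T.precision P * (linkOp T.precision P *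
    (spreadOp T.precision * roleOp T.parity P))))

variable (P : Procedures)

lemma roleOp_ket (b : Bool) (v : BitVec n) :
    (roleOp b P).mulVec (ket (content v 0 (0 : BitVec w) false false)) =
      ket (content v 0 0 (isChild P b v) false) := by
  rw [roleOp, ctrlMat_not_ket]
  · simp [update_role]
  · intro x b
    have : vertexReg (Function.update x roleWire b) = vertexReg x := rfl
    simp only [this]

lemma spreadOp_ket_child (p : ℕ) (v : BitVec n) :
    (spreadOp p).mulVec (ket (content v 0 (0 : BitVec w) true false)) =
      ket (content v 0 0 true false) := by
  funext z
  rw [spreadOp, list_prod_hadamard_ket markEmb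
    (fun i x => !x roleWire && decide (i.1 < p + 2)) (fun k k' x b => rfl) _ (List.nodup_finRange w)]
  · simp [ket_apply, funext_iff]
  · intro k; simp [content]

lemma spreadOp_ket_center (p : ℕ) (hp : p + 2 ≤ w) (v : BitVec n) :
    (spreadOp p).mulVec (ket (content v 0 (0 : BitVec w) false false)) =
      ∑ y : BitVec (p + 2), (((Real.sqrt 2)⁻¹ : ℝ) : ℂ) ^ (p + 2) •
        ket (content v 0 (y.setWidth w) false false) := by
  funext z
  rw [spreadOp, list_prod_hadamard_ket markEmb
    (fun i x => !x roleWire && decide (i.1 < p + 2)) (fun k k' x b => rfl) _ (List.nodup_finRange w)]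
  · have hc : List.countP (fun k : Fin w =>
        !content v 0 (0 : BitVec w) false false roleWire && decide (k.1 < p + 2))
          (List.finRange w) = p + 2 := by
      have e1 : List.countP (fun k : Fin w =>
        !content v 0 (0 : BitVec w) false false roleWire && decide (k.1 < p + 2))
          (List.finRange w) = (Finset.univ.filter fun k : Fin w => k.1 < p + 2).card := by
        rw [List.countP_eq_length_filter]
        simp only [content_role, Bool.not_false, Bool.true_and]
        rfl
      rw [e1]
      have e2 : (Finset.univ.filter fun k : Fin w => k.1 < p + 2) =
          Finset.univ.map (Fin.castLEEmb hp) := by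
        ext k
        simp only [Finset.mem_filter, Finset.mem_univ, true_and, Finset.mem_map]
        constructor
        · intro h; exact ⟨⟨k, h⟩, rfl⟩
        · rintro ⟨a, rfl⟩; exact a.2
      rw [e2]; simp
    rw [hc]
    simp only [Finset.sum_apply, Pi.smul_apply, ket_apply, smul_eq_mul, mul_ite, mul_one, mul_zero]
    split_ifs with hz
    · have hzy : z = content v 0 ((markReg p z).setWidth w) false false := by
        funext i
        have hzi := hz i
        rcases i with i | (i | i)
        · rw [hzi]
          · rcases i with i | i <;> simp [content]
          · intro k _ _ hk; simp at hk
        · by_cases hi : i.1 < p + 2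
          · simp [content, markReg, hi]
          · rw [hzi]
            · simp [content, BitVec.getLsbD_of_ge (markReg p z) i (by omega)]
            · intro k _ hk hki
              simp only [markEmb_apply, Sum.inr.injEq, Sum.inl.injEq] at hki
              subst hki
              simp [hi] at hk
        · rw [hzi]
          · simp [content]
          · intro k _ _ hk; simp at hk
      rw [Finset.sum_eq_single (markReg p z)]
      · rw [if_pos hzy]
      · intro y _ hy
        rw [if_neg]
        intro h
        apply hy
        rw [h, markReg_content, setWidth_setWidth_self hp]
      · simp
    · symm
      refine Finset.sum_eq_zero fun y _ => ?_
      rw [if_neg]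
      rintro rfl
      apply hz
      intro i hi
      rcases i with i | (i | i)
      · rcases i with i | i <;> simp [content]
      · have := hi i (by simp)
        simp only [content_role, Bool.not_false, Bool.true_and, decide_eq_true_eq] at this
        have hi' : ¬ i.1 < p + 2 := fun h => this h rfl
        simp [content, BitVec.getLsbD_of_ge y i (by omega)]
      · simp [content]
  · intro k; simp [content]

lemma linkOp_ket (p : ℕ) (v : BitVec n) (y : BitVec w) (r g : Bool) :
    (linkOp p P).mulVec (ket (content v 0 y r g)) =
      ket (content v (v ^^^ if r then parentVec P v else childVec P p v (y.setWidth (p + 2)))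
        y r g) := by
  rw [linkOp, list_prod_not_ket otherEmb (fun i x => (linkValue p P x).getLsbD i)
    (fun k k' x b => rfl) _ (List.nodup_finRange n), xor_other v 0 _ y r g _ fun i => rfl]
  simp [linkValue]

lemma childMarkOp_ket_center (p : ℕ) (v u : BitVec n) (y : BitVec w) (g : Bool) :
    (childMarkOp p P).mulVec (ket (content v u y false g)) = ket (content v u y false g) := by
  rw [childMarkOp, list_prod_not_ket markEmb _ (fun k k' x b => rfl) _ (List.nodup_finRange w),
    xor_mark v u y 0 false g _ fun i => by simp]
  simp

lemma childMarkOp_ket_child (p : ℕ) (v u : BitVec n) (g : Bool) :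
    (childMarkOp p P).mulVec (ket (content v u (0 : BitVec w) true g)) =
      ket (content v u ((cumulative P p (parentVec P v) (positionVec P v)).setWidth w) true g) := by
  rw [childMarkOp, list_prod_not_ket markEmb _ (fun k k' x b => rfl) _ (List.nodup_finRange w),
    xor_mark v u 0 ((cumulative P p (parentVec P v) (positionVec P v)).setWidth w) true g _
      fun i => by simp]
  simp

lemma flagOp_ket (T : HamPart) (β : ℕ) (v u : BitVec n) (y : BitVec w) (r : Bool) :
    (flagOp T β P).mulVec (ket (content v u y r false)) =
      ket (content v u y r (r && !isGood P T β v)) := by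
  rw [flagOp, ctrlMat_not_ket]
  · simp [update_flag]
  · intro x b
    have : vertexReg (Function.update x flagWire b) = vertexReg x := rfl
    simp only [this]
    rfl

lemma exchangeOp_ket (v u : BitVec n) (y : BitVec w) (r g : Bool) :
    exchangeOp.mulVec (ket (content v u y r g)) =
      ket (content (v ^^^ if r then u else 0) u y r g) := by
  rw [exchangeOp, list_prod_not_ket vertexEmb _ (fun k k' x b => rfl) _ (List.nodup_finRange n),
    xor_vertex v u (if r then u else 0) y r g _ fun i => by cases r <;> simp [content]]

/-- The exclusive or of the two ends is kept instead of one end, so adding it to the vertex register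
turns the child into its parent. The resulting record has the form of those in `edgeOp_ket_center`,
up to role, and with a raised flag if the edge is outside the part. -/
lemma edgeOp_ket_child (T : HamPart) (β : ℕ) (v : BitVec n) (hv : isChild P T.parity v = true) :
    (edgeOp T β P).mulVec (ket (content v 0 (0 : BitVec w) false false)) =
      ket (content (parentVec P v) (v ^^^ parentVec P v)
        ((cumulative P T.precision (parentVec P v) (positionVec P v)).setWidth w) true
        (!isGood P T β v)) := by
  simp only [edgeOp, ← Matrix.mulVec_mulVec]
  rw [roleOp_ket, hv, spreadOp_ket_child, linkOp_ket, childMarkOp_ket_child, flagOp_ket,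
    exchangeOp_ket]
  simp

lemma edgeOp_ket_center (T : HamPart) (β : ℕ) (hT : T.precision + 2 ≤ w) (v : BitVec n)
    (hv : isChild P T.parity v = false) :
    (edgeOp T β P).mulVec (ket (content v 0 (0 : BitVec w) false false)) =
      ∑ y : BitVec (T.precision + 2), (((Real.sqrt 2)⁻¹ : ℝ) : ℂ) ^ (T.precision + 2) •
        ket (content v (v ^^^ childVec P T.precision v y) (y.setWidth w) false false) := by
  simp only [edgeOp, ← Matrix.mulVec_mulVec]
  rw [roleOp_ket, hv, spreadOp_ket_center _ hT]
  simp only [Matrix.mulVec_sum, Matrix.mulVec_smul]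
  refine Finset.sum_congr rfl fun y _ => ?_
  rw [linkOp_ket, childMarkOp_ket_center, flagOp_ket, exchangeOp_ket]
  simp [setWidth_setWidth_self hT]

end Operators

/-! ## Circuits for the evolution of the parts of the Hamiltonian -/

lemma eval_mono_nat (q : Polynomial ℕ) : Monotone fun n => q.eval n := by
  intro a b h
  induction q using Polynomial.induction_on' with
  | add p r hp hr => simpa using Nat.add_le_add hp hr
  | monomial k c => simpa using Nat.mul_le_mul_left c (Nat.pow_le_pow_left h k)

section Bases

variable {n w : ℕ}

lemma bits_vertexReg_subset {t : Wire n w} (ht : ∀ i, vertexWire i ≠ t) :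
    bits (fun _ x => vertexReg x) ⊆ otherQubits t := by
  rintro φ ⟨i, hi, rfl⟩
  refine ⟨vertexWire ⟨i, hi⟩, ht _, ?_⟩
  funext P x
  simp [vertexReg, hi]

lemma bits_markReg_subset {p : ℕ} (hp : p + 2 ≤ w) {t : Wire n w} (ht : ∀ i, markWire i ≠ t) :
    bits (fun _ x => markReg p x) ⊆ otherQubits t := by
  rintro φ ⟨i, hi, rfl⟩
  refine ⟨markWire ⟨i, by omega⟩, ht _, ?_⟩
  funext P x
  simp [markReg, hi, show i < w by omega]

end Bases

/-! ### Costs of the factors of the isometry. -/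

section Circuits

variable {n w : ℕ} {q : Polynomial ℕ} {Q : ℕ}

lemma roleOp_implUnitary (hn : 0 < n) (hQ : q.eval n ≤ Q) (b : Bool) :
    ImplUnitary n q (2 * (Q + 1) + 1) (roleOp (n := n) (w := w) b) := by
  have h := (Avail.base (n := n) (q := q) (base := otherQubits (roleWire : Wire n w))).isChild_mem hn
    (bits_vertexReg_subset (by simp)) hQ b
  exact h.implUnitary (Set.mem_insert _ _) notMat_mem_unitary (by omega)

lemma spreadOp_implUnitary (p : ℕ) :
    ImplUnitary n q (w * 3) (fun _ => spreadOp (n := n) (w := w) p) := by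
  have := ImplUnitary.list_prod (n := n) (q := q) (c := 3) (List.finRange w)
    (O := fun i _ => ctrlMat (fun x : Wire n w → Bool => !x roleWire && decide (i.1 < p + 2))
      (markEmb i) hadamardMat) (by
      intro i _
      have hr : (fun _ x => x roleWire) ∈ otherQubits (markEmb i : Wire n w) :=
        ⟨roleWire, by simp, rfl⟩
      exact ((Avail.base (n := n) (q := q)).gate hr hr
        (fun a _ => !a && decide (i.1 < p + 2))).implUnitary (Set.mem_insert _ _)
        hadamardMat_mem_unitary (by omega))
  rwa [List.length_finRange] at this

lemma linkOp_implUnitary (hn : 0 < n) {p : ℕ} (hp : p + 2 ≤ w) (hQ : q.eval n ≤ Q)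
    (hQ' : q.eval (n + p) ≤ Q) :
    ImplUnitary n q (n * (2 * (4 * Q + 2 * n + 12 * w + n * (Q + 5 * n + 5 * w + 22) + 6) + 1))
      (linkOp (n := n) (w := w) p) := by
  have := ImplUnitary.list_prod (n := n) (q := q)
    (c := 2 * (4 * Q + 2 * n + 12 * w + n * (Q + 5 * n + 5 * w + 22) + 6) + 1) (List.finRange n)
    (O := fun i P => ctrlMat (fun x : Wire n w → Bool => (linkValue p P x).getLsbD i)
      (otherEmb i) notMat) (by
      intro i _
      have hV : bits (fun _ x => vertexReg x) ⊆ otherQubits (otherEmb i : Wire n w) :=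
        bits_vertexReg_subset (by simp)
      have h1 := (Avail.base (n := n) (q := q)
        (base := otherQubits (otherEmb i : Wire n w))).bits_parentVec hV hQ
      have h2 := h1.bits_childVec hn (hV.trans Set.subset_union_left)
        (Y := fun _ x => markReg p x)
        ((bits_markReg_subset hp (by simp)).trans Set.subset_union_left) hQ hQ'
      have h3 := h2.gate₃ (a := fun _ x => x roleWire)
        (b := fun P x => (parentVec P (vertexReg x)).getLsbD i)
        (d := fun P x => (childVec P p (vertexReg x) (markReg p x)).getLsbD i)
        (Or.inl (Or.inl ⟨roleWire, by simp, rfl⟩)) (Or.inl (Or.inr (mem_bits_of_lt i.2)))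
        (Or.inr (mem_bits_of_lt i.2)) (fun a b c => if a then b else c)
      have h4 := h3.gate (a := fun _ x => (vertexReg x).getLsbD i)
        (Or.inr (Or.inl (Or.inl (hV (mem_bits_of_lt i.2))))) (Set.mem_insert _ _)
        (fun a b => a ^^ b)
      refine h4.implUnitary (f := fun P x => (linkValue p P x).getLsbD i) (Or.inl ?_)
        notMat_mem_unitary ?_
      · funext P x
        simp only [linkValue, BitVec.getLsbD_xor]
        split_ifs <;> rfl
      · have : n * (Q + 5 * n + 5 * (p + 2) + 22) ≤ n * (Q + 5 * n + 5 * w + 22) :=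
          Nat.mul_le_mul_left _ (by omega)
        omega)
  rwa [List.length_finRange] at this

lemma childMarkOp_implUnitary (hn : 0 < n) {p : ℕ} (hQ : q.eval n ≤ Q)
    (hQ' : q.eval (n + p) ≤ Q) :
    ImplUnitary n q (w * (2 * (4 * Q + n + 2) + 1)) (childMarkOp (n := n) (w := w) p) := by
  have := ImplUnitary.list_prod (n := n) (q := q) (c := 2 * (4 * Q + n + 2) + 1) (List.finRange w)
    (O := fun i P => ctrlMat (fun x : Wire n w → Bool => x roleWire && (cumulative P p
      (parentVec P (vertexReg x)) (positionVec P (vertexReg x))).getLsbD i) (markEmb i) notMat) (by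
      intro i _
      have hV : bits (fun _ x => vertexReg x) ⊆ otherQubits (markEmb i : Wire n w) :=
        bits_vertexReg_subset (by simp)
      have hr : (fun _ x => x roleWire) ∈ otherQubits (markEmb i : Wire n w) :=
        ⟨roleWire, by simp, rfl⟩
      have h1 := (Avail.base (n := n) (q := q)
        (base := otherQubits (markEmb i : Wire n w))).bits_cumulative hn hV hQ hQ'
      by_cases hi : i.1 < p + 2
      · have h2 := h1.gate (Or.inl hr) (Or.inr (mem_bits_of_lt hi)) (fun a b => a && b)
        exact h2.implUnitary (Set.mem_insert _ _) notMat_mem_unitary (by omega)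
      · have h2 := h1.const (Or.inl hr) false
        refine h2.implUnitary (Or.inl ?_) notMat_mem_unitary (by omega)
        funext P x
        rw [BitVec.getLsbD_of_ge _ _ (by omega), Bool.and_false])
  rwa [List.length_finRange] at this

lemma flagOp_implUnitary (hn : 0 < n) (T : HamPart) (β : ℕ) (hQ : q.eval n ≤ Q)
    (hQ' : q.eval (n + β) ≤ Q) :
    ImplUnitary n q (2 * (5 * Q + 6 * n + 13) + 1) (flagOp (n := n) (w := w) T β) := by
  have hV : bits (fun _ x => vertexReg x) ⊆ otherQubits (flagWire : Wire n w) :=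
    bits_vertexReg_subset (by simp)
  have h1 := (Avail.base (n := n) (q := q)
    (base := otherQubits (flagWire : Wire n w))).isGood_mem hn hV T β hQ hQ'
  have h2 := h1.gate (a := fun _ x => x roleWire) (Or.inr ⟨roleWire, by simp, rfl⟩)
    (Set.mem_insert _ _) (fun a b => a && !b)
  exact h2.implUnitary (Set.mem_insert _ _) notMat_mem_unitary (by omega)

lemma exchangeOp_implUnitary :
    ImplUnitary n q (n * 3) (fun _ => exchangeOp (n := n) (w := w)) := by
  have := ImplUnitary.list_prod (n := n) (q := q) (c := 3) (List.finRange n)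
    (O := fun i _ => ctrlMat (fun x : Wire n w → Bool => x roleWire && x (otherWire i))
      (vertexEmb i) notMat) (by
      intro i _
      have hr : (fun _ x => x roleWire) ∈ otherQubits (vertexEmb i : Wire n w) :=
        ⟨roleWire, by simp, rfl⟩
      have hu : (fun _ x => x (otherWire i)) ∈ otherQubits (vertexEmb i : Wire n w) :=
        ⟨otherWire i, by simp, rfl⟩
      exact ((Avail.base (n := n) (q := q)).gate hr hu
        (fun a b => a && b)).implUnitary (Set.mem_insert _ _) notMat_mem_unitary (by omega))
  rwa [List.length_finRange] at this

lemma edgeOp_implUnitary (hn : 0 < n) (T : HamPart) {β : ℕ} (hβ : β ≤ w)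
    (hT : T.precision + 2 ≤ w) :
    ImplUnitary n q (100 * ((q.eval (n + w) + 1) * (n + w + 1) ^ 3))
      (edgeOp (n := n) (w := w) T β) := by
  set Q := q.eval (n + w) with hQdef
  have hQ0 : q.eval n ≤ Q := eval_mono_nat q (by omega)
  have hQp : q.eval (n + T.precision) ≤ Q := eval_mono_nat q (by omega)
  have hQβ : q.eval (n + β) ≤ Q := eval_mono_nat q (by omega)
  have := exchangeOp_implUnitary.mul ((flagOp_implUnitary hn T β hQ0 hQβ).mul
    ((childMarkOp_implUnitary (w := w) hn hQ0 hQp).mul ((linkOp_implUnitary hn hT hQ0 hQp).mul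
      ((spreadOp_implUnitary T.precision).mul (roleOp_implUnitary hn hQ0 T.parity)))))
  refine this.mono ?_
  clear_value Q
  have hz := Nat.zero_le
  -- Both sides are polynomials in `n`, `w`, `Q`, and each coefficient on the left is at most the
  -- one on the right, so nonnegativity of the monomials suffices.
  linarith [hz n, hz w, hz (n ^ 2), hz (n * w), hz (w ^ 2), hz (n ^ 3), hz (n ^ 2 * w),
    hz (n * w ^ 2), hz (w ^ 3), hz Q, hz (Q * n), hz (Q * w), hz (Q * n ^ 2), hz (Q * n * w),
    hz (Q * w ^ 2), hz (Q * n ^ 3), hz (Q * n ^ 2 * w), hz (Q * n * w ^ 2), hz (Q * w ^ 3)]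

end Circuits

/-! ### Evolution under a conjugated one-qubit Hamiltonian. -/

section Evolution

open scoped Matrix.Norms.L2Operator

variable {ι : Type} [Fintype ι] [DecidableEq ι]

lemma norm_unitary_le {X : Type} [Fintype X] [DecidableEq X] {U : Matrix X X ℂ}
    (hU : U ∈ Matrix.unitaryGroup X ℂ) : ‖U‖ ≤ 1 := by
  have h : ‖U‖ * ‖U‖ = ‖(1 : Matrix X X ℂ)‖ := by
    rw [← CStarRing.norm_star_mul_self, Matrix.mem_unitaryGroup_iff'.1 hU]
  rcases isEmpty_or_nonempty X with hX | hX
  · have : U = 0 := Subsingleton.elim _ _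
    simp [this]
  · rw [CStarRing.norm_one] at h
    nlinarith [norm_nonneg U]

lemma exp_smul_conj_unitary {X : Type} [Fintype X] [DecidableEq X] {V : Matrix X X ℂ}
    (hV : V ∈ Matrix.unitaryGroup X ℂ) (A : Matrix X X ℂ) (c : ℂ) :
    NormedSpace.exp (c • (V.conjTranspose * A * V)) =
      V.conjTranspose * NormedSpace.exp (c • A) * V := by
  have h1 := Matrix.mem_unitaryGroup_iff'.1 hV
  have h2 := Matrix.mem_unitaryGroup_iff.1 hV
  rw [Matrix.star_eq_conjTranspose] at h1 h2
  have := Matrix.exp_units_conj (⟨V.conjTranspose, V, h1, h2⟩ : (Matrix X X ℂ)ˣ) (c • A)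
  simpa [mul_assoc] using this

lemma exp_smul_hermitian_mem_unitary {X : Type} [Fintype X] [DecidableEq X] {A : Matrix X X ℂ}
    (hA : A.IsHermitian) (τ : ℝ) :
    NormedSpace.exp ((-(Complex.I * (τ : ℂ))) • A) ∈ Matrix.unitaryGroup X ℂ := by
  let _ : NormedAlgebra ℚ (Matrix X X ℂ) := .restrictScalars ℚ ℂ _
  refine NormedSpace.exp_mem_unitary_of_mem_skewAdjoint ?_
  rw [skewAdjoint.mem_iff, star_smul, Matrix.star_eq_conjTranspose, hA.eq]
  simp

/-- One-qubit operations as operations on all qubits. -/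
def qubitHom (w : ι) : Matrix Bool Bool ℂ →+* Matrix (ι → Bool) (ι → Bool) ℂ where
  toFun := ctrlMat (fun _ => true) w
  map_one' := ctrlMat_one _ _
  map_mul' M M' := (ctrlMat_mul (fun _ _ => rfl) M M').symm
  map_zero' := by ext x y; simp [ctrlMat]
  map_add' M M' := by
    ext x y
    simp only [ctrlMat, if_true, Matrix.add_apply]
    split_ifs <;> simp

/-- Letting a matrix act on one qubit is a continuous ring homomorphism, and these commute with the
exponential. -/
lemma exp_ctrlMat (w : ι) (M : Matrix Bool Bool ℂ) :
    NormedSpace.exp (ctrlMat (fun _ => true) w M) =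
      ctrlMat (fun _ => true) w (NormedSpace.exp M) := by
  have hc : Continuous (qubitHom w) := by
    refine continuous_matrix fun x y => ?_
    show Continuous fun M : Matrix Bool Bool ℂ => ctrlMat (fun _ => true) w M x y
    simp only [ctrlMat, if_true]
    split_ifs
    · exact continuous_id.matrix_elem _ _
    · exact continuous_const
  let _ : NormedAlgebra ℚ (Matrix Bool Bool ℂ) := .restrictScalars ℚ ℂ _
  exact (NormedSpace.map_exp (qubitHom w) hc M).symm

lemma ctrlMat_smul (w : ι) (c : ℂ) (M : Matrix Bool Bool ℂ) :
    ctrlMat (fun _ => true) w (c • M) = c • ctrlMat (fun _ => true) w M := by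
  ext x y
  simp [ctrlMat]

variable {n : ℕ} {q : Polynomial ℕ}

/-- The evolution under a unitarily transformed one-qubit Hamiltonian. -/
lemma ImplUnitary.impl_exp {c : ℕ} {V : Procedures → Matrix (ι → Bool) (ι → Bool) ℂ}
    (hV : ImplUnitary n q c V) {w d : ι} (hd : d ≠ w) {K : Matrix Bool Bool ℂ} (hK : K.IsHermitian) (τ : ℝ) :
    Impl n q (2 * c + 3) fun P => NormedSpace.exp ((-(Complex.I * (τ : ℂ))) •
      ((V P).conjTranspose * ctrlMat (fun _ => true) w K * V P)) := by
  simp only [fun P => exp_smul_conj_unitary (hV.mem_unitary P), ← ctrlMat_smul, exp_ctrlMat]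
  have h : Impl n q 3 (fun _ => ctrlMat (fun _ => true) w
      (NormedSpace.exp ((-(Complex.I * (τ : ℂ))) • K))) := by
    -- The qubit `d` only provides some available function from which the constant control is
    -- computed.
    have hw : (fun _ x => x d) ∈ otherQubits w := ⟨d, hd, rfl⟩
    exact ((Avail.base (n := n) (q := q)).const hw true).impl (f := fun _ _ => true)
      (Set.mem_insert _ _) (exp_smul_hermitian_mem_unitary hK τ)
  exact ((hV.impl_adjoint.mul h).mul hV.impl).mono (by omega)

end Evolution

/-! ### The reflection at the vertex states. -/

section Reflection

open scoped Matrix.Norms.L2Operator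

lemma Avail.any {D : Type} {n : ℕ} {q : Polynomial ℕ} {base Φ : Set (BoolFun D)} {c : ℕ}
    (h : Avail n q base c Φ) {φ : BoolFun D} (hφ : φ ∈ Φ) (l : List D)
    (hl : ∀ d ∈ l, (fun _ x => x d) ∈ Φ) :
    Avail n q base (c + (l.length + 1)) (insert (fun _ x => l.any x) Φ) := by
  induction l with
  | nil => exact h.const hφ false
  | cons d l ih =>
    have h1 := (ih fun d hd => hl d (List.mem_cons_of_mem _ hd)).gate
      (Set.mem_insert_of_mem _ (hl d List.mem_cons_self)) (Set.mem_insert _ _) (fun a b => a || b)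
    exact h1.mono (by rw [List.length_cons]; omega)
      (Set.insert_subset_insert (Set.subset_insert _ _))

variable {n w : ℕ}

/-- The qubits that are zero unless a vertex is processed. -/
def workWires (n w : ℕ) : List (Wire n w) :=
  (List.finRange n).map otherWire ++ ((List.finRange w).map markWire ++ [roleWire, flagWire])

/-- The reflection at the states in which only the vertex is nonzero. -/
def reflectOp : Matrix (Wire n w → Bool) (Wire n w → Bool) ℂ :=
  Matrix.diagonal fun x => if (workWires n w).any x then -1 else 1

/-- The matrix `-1` on one qubit is a global phase, so the reflection is a controlled operation
whose target may be any vertex qubit, which the control does not read. -/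
lemma reflectOp_eq_ctrlMat (i : Fin n) :
    reflectOp = ctrlMat (workWires n w).any (vertexWire i) (-1) := by
  refine matrix_ext_mulVec fun ψ x => ?_
  rw [ctrlMat_mulVec, reflectOp, Matrix.mulVec_diagonal]
  split_ifs
  · rw [Finset.sum_eq_single (x (vertexWire i))]
    · simp
    · intro b _ hb
      simp [Matrix.one_apply_ne hb.symm]
    · simp
  · simp

lemma reflectOp_implUnitary {q : Polynomial ℕ} (hn : 0 < n) :
    ImplUnitary n q (2 * (n + w + 3) + 1) (fun _ => reflectOp (n := n) (w := w)) := by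
  rw [reflectOp_eq_ctrlMat ⟨0, hn⟩]
  have hmem : ∀ d ∈ workWires n w,
      (fun _ x => x d) ∈ otherQubits (vertexWire ⟨0, hn⟩ : Wire n w) := by
    intro d hd
    refine ⟨d, ?_, rfl⟩
    rintro rfl
    simp [workWires] at hd
  have h1 := (Avail.base (n := n) (q := q)
    (base := otherQubits (vertexWire ⟨0, hn⟩ : Wire n w))).any (hmem roleWire (by simp [workWires]))
    _ hmem
  refine h1.implUnitary (f := fun _ => (workWires n w).any) (Set.mem_insert _ _) ?_ ?_
  · rw [Matrix.mem_unitaryGroup_iff]; simp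
  · simp [workWires]; omega

lemma conjTranspose_reflectOp :
    (reflectOp : Matrix (Wire n w → Bool) (Wire n w → Bool) ℂ).conjTranspose = reflectOp := by
  rw [reflectOp, Matrix.diagonal_conjTranspose]
  congr 1
  funext x
  simp only [Pi.star_apply]
  split_ifs <;> simp

end Reflection

/-! ## The parts of the Hamiltonian as operators -/

section Parts

variable {n w : ℕ}

/-- The phase of the weights in a part of the Hamiltonian. -/
noncomputable def HamPart.phase (T : HamPart) : ℂ :=
  (if T.sgn then -1 else 1) * (if T.im then Complex.I else 1)

/-- The operator that exchanges the two ends of an edge. -/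
noncomputable def HamPart.swapMat (T : HamPart) : Matrix Bool Bool ℂ := fun a b =>
  if a = b then 0 else if a then T.phase else star T.phase

lemma HamPart.phase_mul_star (T : HamPart) : T.phase * star T.phase = 1 := by
  unfold HamPart.phase
  split_ifs <;> simp

lemma HamPart.star_mul_phase (T : HamPart) : star T.phase * T.phase = 1 := by
  rw [mul_comm, T.phase_mul_star]

lemma HamPart.isHermitian_swapMat (T : HamPart) : T.swapMat.IsHermitian := by
  ext a b
  cases a <;> cases b <;> simp [HamPart.swapMat]

lemma HamPart.swapMat_mem_unitary (T : HamPart) : T.swapMat ∈ Matrix.unitaryGroup Bool ℂ := by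
  rw [Matrix.mem_unitaryGroup_iff, Matrix.star_eq_conjTranspose, T.isHermitian_swapMat.eq]
  ext a b
  have h1 := T.phase_mul_star
  have h2 := T.star_mul_phase
  simp only [Complex.star_def] at h1 h2
  cases a <;> cases b <;> simp [HamPart.swapMat, Matrix.mul_apply, h1, h2]

lemma exists_content (z : Wire n w → Bool) : ∃ v u y r g, z = content v u y r g := by
  refine ⟨BitVec.ofFnLE fun i => z (vertexWire i), BitVec.ofFnLE fun i => z (otherWire i),
    BitVec.ofFnLE fun i => z (markWire i), z roleWire, z flagWire, ?_⟩
  funext i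
  rcases i with (i | i) | (i | i | i) <;> simp [content]

/-- The basis state of a vertex. -/
def vertexState (w : ℕ) (v : BitVec n) : Wire n w → Bool := content v 0 0 false false

/-- The operator that exchanges the two ends of the edges in a part of the Hamiltonian. -/
noncomputable def partOp (T : HamPart) (β : ℕ) (P : Procedures) :
    Matrix (Wire n w → Bool) (Wire n w → Bool) ℂ :=
  (edgeOp T β P).conjTranspose * ctrlMat (fun _ => true) roleWire T.swapMat * edgeOp T β P

lemma partOp_isHermitian (T : HamPart) (β : ℕ) (P : Procedures) :
    (partOp (n := n) (w := w) T β P).IsHermitian := by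
  rw [Matrix.IsHermitian, partOp, Matrix.conjTranspose_mul, Matrix.conjTranspose_mul,
    Matrix.conjTranspose_conjTranspose, ctrlMat_conjTranspose (fun _ _ => rfl),
    T.isHermitian_swapMat.eq, Matrix.mul_assoc]

lemma mulVec_ket {X : Type} [Fintype X] [DecidableEq X] (A : Matrix (X → Bool) (X → Bool) ℂ)
    (x y : X → Bool) : A.mulVec (ket x) y = A y x := by
  rw [ket, Matrix.mulVec_single_one]; rfl

lemma swapMat_mulVec_ket (T : HamPart) (v u : BitVec n) (y : BitVec w) (r g : Bool) :
    (ctrlMat (fun _ => true) roleWire T.swapMat).mulVec (ket (content v u y r g)) =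
      (if r then star T.phase else T.phase) • ket (content v u y (!r) g) := by
  funext z
  rw [ctrlMat_mulVec, if_pos rfl, Fintype.sum_bool]
  obtain ⟨v', u', y', r', g', rfl⟩ := exists_content z
  simp only [update_role, ket_apply, content_injective, Pi.smul_apply, content_role]
  cases r <;> cases r' <;> simp [HamPart.swapMat]

lemma partOp_apply (T : HamPart) (β : ℕ) (P : Procedures) (x y : Wire n w → Bool) :
    partOp T β P x y = ∑ z, star ((edgeOp T β P).mulVec (ket x) z) *
      (ctrlMat (fun _ => true) roleWire T.swapMat).mulVec ((edgeOp T β P).mulVec (ket y)) z := by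
  rw [← mulVec_ket (partOp T β P) y x, partOp, ← Matrix.mulVec_mulVec, ← Matrix.mulVec_mulVec]
  generalize (ctrlMat (fun _ => true) roleWire T.swapMat).mulVec _ = φ
  rw [Matrix.mulVec, dotProduct]
  simp only [mulVec_ket, Matrix.conjTranspose_apply]

variable (P : Procedures) (T : HamPart) (β : ℕ) {v v' : BitVec n}

/-- The edges in a part of the Hamiltonian that are found by the search. -/
def IsLinked (v u : BitVec n) : Prop :=
  u = parentVec P v ∧ isGood P T β v = true ∧
    childVec P T.precision u (cumulative P T.precision u (positionVec P v)) = v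

-- After the exchange of roles the child is a single basis state. It meets the center's
-- superposition in at most one summand, the one whose mark is that of the child; vertex and link
-- then agree exactly if the center is the parent and the search returns the child.
open Classical in
lemma partOp_center_child (hT : T.precision + 2 ≤ w) (hv : isChild P T.parity v = true)
    (hv' : isChild P T.parity v' = false) :
    partOp T β P (vertexState w v') (vertexState w v) =
      if IsLinked P T β v v' then star T.phase * (((Real.sqrt 2)⁻¹ : ℝ) : ℂ) ^ (T.precision + 2)
      else 0 := by
  rw [partOp_apply, vertexState, vertexState, edgeOp_ket_child P T β v hv,
    edgeOp_ket_center P T β hT v' hv', swapMat_mulVec_ket]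
  rw [Finset.sum_eq_single (content (parentVec P v) (v ^^^ parentVec P v)
    ((cumulative P T.precision (parentVec P v) (positionVec P v)).setWidth w) false
    (!isGood P T β v))]
  · simp only [if_true, Finset.sum_apply, Pi.smul_apply, smul_eq_mul, ket_apply, Bool.not_true,
      mul_ite, mul_one, mul_zero, content_injective, setWidth_injective hT]
    rw [Finset.sum_eq_single (cumulative P T.precision (parentVec P v) (positionVec P v))]
    · by_cases h : parentVec P v = v'
      · subst h
        have e : v ^^^ parentVec P v = parentVec P v ^^^ childVec P T.precision (parentVec P v)
            (cumulative P T.precision (parentVec P v) (positionVec P v)) ↔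
            childVec P T.precision (parentVec P v)
            (cumulative P T.precision (parentVec P v) (positionVec P v)) = v := by
          rw [BitVec.xor_comm v, BitVec.xor_right_inj]
          exact eq_comm
        simp only [e, IsLinked, true_and, Bool.not_eq_false', and_comm]
        split_ifs
        · rw [mul_comm]; congr 1
          rw [star_pow, Complex.star_def, Complex.conj_ofReal]
        · simp
      · rw [if_neg (fun h' => h h'.1), if_neg (fun h' => h h'.1.symm)]
        simp
    · intro y _ hy
      rw [if_neg]
      rintro ⟨-, -, rfl, -⟩
      exact hy rfl
    · simp
  · intro z _ hz
    simp only [Pi.smul_apply, ket_apply, Bool.not_true, if_neg hz, smul_zero, mul_zero]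
  · simp

/-- Both images have role 1, and the exchange makes one of them orthogonal to the other. -/
lemma partOp_child_child (hv : isChild P T.parity v = true) (hv' : isChild P T.parity v' = true) :
    partOp T β P (vertexState w v') (vertexState w v) = 0 := by
  rw [partOp_apply, vertexState, vertexState, edgeOp_ket_child P T β v hv,
    edgeOp_ket_child P T β v' hv', swapMat_mulVec_ket]
  refine Finset.sum_eq_zero fun z _ => ?_
  simp only [Pi.smul_apply, ket_apply]
  split_ifs with h1 h2
  · rw [h1, content_injective] at h2; simp at h2
  all_goals simp

lemma partOp_center_center (hT : T.precision + 2 ≤ w) (hv : isChild P T.parity v = false)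
    (hv' : isChild P T.parity v' = false) :
    partOp T β P (vertexState w v') (vertexState w v) = 0 := by
  rw [partOp_apply, vertexState, vertexState, edgeOp_ket_center P T β hT v hv,
    edgeOp_ket_center P T β hT v' hv']
  refine Finset.sum_eq_zero fun z _ => ?_
  obtain ⟨v₀, u₀, y₀, r₀, g₀, rfl⟩ := exists_content z
  simp only [Matrix.mulVec_sum, Matrix.mulVec_smul, swapMat_mulVec_ket, Finset.sum_apply,
    Pi.smul_apply, ket_apply, content_injective]
  cases r₀ <;> simp

open Classical in
lemma partOp_child_center (hT : T.precision + 2 ≤ w) (hv : isChild P T.parity v = true)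
    (hv' : isChild P T.parity v' = false) :
    partOp T β P (vertexState w v) (vertexState w v') =
      if IsLinked P T β v v' then T.phase * (((Real.sqrt 2)⁻¹ : ℝ) : ℂ) ^ (T.precision + 2)
      else 0 := by
  rw [← (partOp_isHermitian T β P).apply, partOp_center_child P T β hT hv hv']
  split_ifs
  · simp
  · simp

end Parts

/-! ## Binary search -/

section Search

variable {n : ℕ} (P : Procedures)

/-- Invariant of the search: after `t` steps the value is `k` with its lowest `n - t` digits
cleared. The candidate passes exactly if the next digit of `k` is one. -/
lemma search_toNat {p : ℕ} {v : BitVec n} {y : BitVec (p + 2)} {k : ℕ} (hk : k < 2 ^ n)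
    (h : ∀ c, searchTest P p v y c = true ↔ c.toNat ≤ k) (t : ℕ) (ht : t ≤ n) :
    (search P p v y t).toNat = k / 2 ^ (n - t) * 2 ^ (n - t) := by
  induction t with
  | zero =>
    simp [search, Nat.div_eq_of_lt hk]
  | succ t ih =>
    specialize ih (by omega)
    obtain ⟨m, hm⟩ : ∃ m, n - t = m + 1 := ⟨n - t - 1, by omega⟩
    have hm' : n - (t + 1) = m := by omega
    have hm'' : n - 1 - t = m := by omega
    have hmn : m < n := by omega
    rw [hm] at ih
    rw [hm']
    set a := k / 2 ^ m with ha
    have hdiv : k / 2 ^ (m + 1) = a / 2 := by rw [pow_succ, ← Nat.div_div_eq_div_mul]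
    have hk1 : a * 2 ^ m ≤ k := Nat.div_mul_le_self k _
    have hk2 : k < (a + 1) * 2 ^ m := by
      rw [add_mul, one_mul]; exact Nat.lt_div_mul_add (by positivity)
    have hor : (search P p v y t ||| BitVec.twoPow n m).toNat = (a / 2 * 2 + 1) * 2 ^ m := by
      rw [BitVec.toNat_or, ih, hdiv, BitVec.toNat_twoPow,
        Nat.mod_eq_of_lt (Nat.pow_lt_pow_right (by norm_num) hmn), mul_comm (a / 2) (2 ^ (m + 1)),
        ← Nat.two_pow_add_eq_or_of_lt (Nat.pow_lt_pow_right (by norm_num) (by omega))]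
      ring
    rw [search, hm'']
    by_cases hc : searchTest P p v y (search P p v y t ||| BitVec.twoPow n m) = true
    · rw [if_pos hc, hor]
      have := (h _).1 hc
      rw [hor] at this
      have h3 : (a / 2 * 2 + 1) < a + 1 := lt_of_mul_lt_mul_right (this.trans_lt hk2) (by positivity)
      congr 1
      omega
    · rw [if_neg hc, ih, hdiv]
      have : ¬ (a / 2 * 2 + 1) * 2 ^ m ≤ k := by rw [← hor, ← h]; exact hc
      have h3 : ¬ (a / 2 * 2 + 1) ≤ a := fun h' => this ((Nat.mul_le_mul_right _ h').trans hk1)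
      have h4 : a = a / 2 * 2 := by omega
      calc a / 2 * 2 ^ (m + 1) = a / 2 * 2 * 2 ^ m := by ring
        _ = a * 2 ^ m := by rw [← h4]

/-- The start value zero is below the degree and so is every accepted candidate. This needs no
assumption on the mark: meaningless marks also lead to actual neighbors. -/
lemma search_lt_degree {p : ℕ} {v : BitVec n} {y : BitVec (p + 2)}
    (h : 0 < (degreeVec P v).toNat) (t : ℕ) :
    (search P p v y t).toNat < (degreeVec P v).toNat := by
  induction t with
  | zero => simpa [search] using h
  | succ t ih =>
    rw [search]
    split_ifs with hc
    · rw [searchTest, Bool.and_eq_true] at hc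
      exact BitVec.ult_iff_lt.1 hc.1
    · exact ih

end Search

/-! ## Trees described by procedures -/

namespace DescribesTree

variable {N : ℕ} {P : Procedures} {H : Matrix (Fin N) (Fin N) ℂ} {G : SimpleGraph (Fin N)}
  {r : Fin N}

/-- The label of a vertex. -/
def _root_.label {N : ℕ} (j : Fin N) : BitVec (labelBits N) := BitVec.ofNat _ j

lemma _root_.lt_two_pow_labelBits {N k : ℕ} (h : k < N) : k < 2 ^ labelBits N :=
  h.trans_le (Nat.le_pow_clog (by norm_num) N)

@[simp] lemma _root_.toNat_label (j : Fin N) : (label j).toNat = j := by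
  rw [label, BitVec.toNat_ofNat, Nat.mod_eq_of_lt (lt_two_pow_labelBits j.2)]

lemma _root_.label_injective : Function.Injective (label (N := N)) := by
  intro i j h
  have := congrArg BitVec.toNat h
  simpa [Fin.ext_iff] using this

lemma degree_lt (hD : DescribesTree P H G r) (j : Fin N) : P.degree j < N := by
  rw [hD.index.degree_eq]
  calc (G.neighborSet j).ncard < (Set.univ : Set (Fin N)).ncard :=
        Set.ncard_lt_ncard (by
          rw [Set.ssubset_univ_iff]
          intro h
          have : j ∈ G.neighborSet j := h ▸ Set.mem_univ j
          simp at this)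
    _ = N := by simp

@[simp] lemma degreeVec_label (hD : DescribesTree P H G r) (j : Fin N) :
    (degreeVec P (label j)).toNat = P.degree j := by
  rw [degreeVec, toNat_label, BitVec.toNat_ofNat,
    Nat.mod_eq_of_lt (lt_two_pow_labelBits (hD.degree_lt j))]

lemma degree_pos (hD : DescribesTree P H G r) (hG : G.IsTree) (hN : 2 ≤ N) (j : Fin N) :
    0 < P.degree j := by
  rw [hD.index.degree_eq, Set.ncard_pos]
  have : Nontrivial (Fin N) := Fin.nontrivial_iff_two_le.2 hN
  obtain ⟨k, hk⟩ := hG.connected.preconnected.exists_adj_of_nontrivial j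
  exact ⟨k, hk⟩

lemma exists_neighbor (hD : DescribesTree P H G r) {j : Fin N} {k : ℕ} (hk : k < P.degree j) :
    ∃ u : Fin N, G.Adj j u ∧ P.neighbor j k = u := by
  obtain ⟨u, hu, hu'⟩ := (hD.index.neighbor_bijOn j).mapsTo hk
  exact ⟨u, hu, hu'.symm⟩

lemma position_lt (hD : DescribesTree P H G r) {j u : Fin N} (h : G.Adj j u) :
    P.position j u < P.degree j ∧ P.neighbor j (P.position j u) = u := by
  obtain ⟨k, hk, hku⟩ := (hD.index.neighbor_bijOn j).surjOn ⟨u, h, rfl⟩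
  rw [← hku, hD.index.position_eq j k hk]
  exact ⟨hk, rfl⟩

lemma exists_childVec (hD : DescribesTree P H G r) (hG : G.IsTree) (hN : 2 ≤ N) (u : Fin N)
    (p : ℕ) (y : BitVec (p + 2)) : ∃ v : Fin N, childVec P p (label u) y = label v := by
  have h := search_lt_degree P (p := p) (v := label u) (y := y)
    (by rw [hD.degreeVec_label]; exact hD.degree_pos hG hN u) (labelBits N)
  rw [hD.degreeVec_label] at h
  obtain ⟨v, -, hv⟩ := hD.exists_neighbor h
  exact ⟨v, by rw [childVec, toNat_label, hv]; rfl⟩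

/-- The parent of a vertex. -/
lemma exists_parent (hD : DescribesTree P H G r) {j : Fin N} (hj : j ≠ r) :
    ∃ u : Fin N, G.Adj j u ∧ G.dist r u + 1 = G.dist r j ∧
      parentVec P (label j) = label u := by
  obtain ⟨h1, u, h2, h3, h4⟩ := hD.parent_eq j hj
  refine ⟨u, h2, h3, ?_⟩
  rw [parentVec, toNat_label, BitVec.toNat_ofNat,
    Nat.mod_eq_of_lt (lt_two_pow_labelBits (h1.trans (hD.degree_lt j))), h4]
  rfl

/-- Shortest walks from the root to `u` and `v`, prolonged to `j`, are paths, and a tree has only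
one path from the root to `j`. Their penultimate vertices agree. -/
lemma parent_unique (hG : G.IsTree) {j u v : Fin N} (hu : G.Adj j u) (hv : G.Adj j v)
    (hu' : G.dist r u + 1 = G.dist r j) (hv' : G.dist r v + 1 = G.dist r j) : u = v := by
  obtain ⟨p, hp⟩ := hG.connected.exists_walk_length_eq_dist r u
  obtain ⟨q, hq⟩ := hG.connected.exists_walk_length_eq_dist r v
  have hp' := (p.concat hu.symm).isPath_of_length_eq_dist (by rw [SimpleGraph.Walk.length_concat, hp, hu'])
  have hq' := (q.concat hv.symm).isPath_of_length_eq_dist (by rw [SimpleGraph.Walk.length_concat, hq, hv'])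
  have h := congrArg SimpleGraph.Walk.penultimate ((hG.existsUnique_path r j).unique hp' hq')
  simpa using h

lemma positionVec_label (hD : DescribesTree P H G r) {j u : Fin N} (hju : G.Adj j u)
    (h : parentVec P (label j) = label u) :
    (positionVec P (label j)).toNat = P.position u j := by
  rw [positionVec, h, toNat_label, toNat_label, BitVec.toNat_ofNat,
    Nat.mod_eq_of_lt (lt_two_pow_labelBits ((hD.position_lt hju.symm).1.trans (hD.degree_lt u)))]

lemma isChild_label (hD : DescribesTree P H G r) (hn : 0 < labelBits N) (b : Bool) (j : Fin N) :
    isChild P b (label j) = (decide (G.dist r j % 2 = 1) ^^ b) := by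
  rw [isChild, depthVec, toNat_label, hD.depth_eq, BitVec.getLsbD_ofNat]
  simp [hn, Nat.testBit_zero]

lemma ne_root_of_isGood (hD : DescribesTree P H G r) {T : HamPart} {β : ℕ} {j : Fin N}
    (h : isGood P T β (label j) = true) : j ≠ r := by
  rintro rfl
  simp [isGood, depthVec, hD.depth_eq, BitVec.ult_iff_lt] at h

end DescribesTree

/-! ## Binary digits of the weights -/

section Digits

/-- The magnitude of an integer in two's complement. -/
def magnitude : ℤ → ℕ
  | .ofNat m => m
  | .negSucc m => m

/-- In two's complement the digits of `-(m + 1)` are the negated digits of `m`. The magnitude of a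
negative integer is therefore one less than its absolute value. -/
lemma testBit_xor_sign (z : ℤ) (i : ℕ) :
    (Int.testBit z i ^^ decide (z < 0)) = (magnitude z).testBit i := by
  cases z with
  | ofNat m =>
    have : ¬ (m : ℤ) < 0 := by omega
    simp [Int.testBit, magnitude, this]
  | negSucc m => simp [Int.testBit, magnitude, Int.negSucc_lt_zero]

lemma magnitude_lt {z : ℤ} {k : ℕ} (hz : |z| < 2 ^ k) : magnitude z < 2 ^ k := by
  have h := abs_lt.1 hz
  zify
  cases z with
  | ofNat m => simpa [magnitude] using h.2
  | negSucc m =>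
    have := Int.negSucc_eq m
    simp only [magnitude]
    linarith [h.1]

lemma testBit_eq_neg {z : ℤ} {k : ℕ} (hz : |z| < 2 ^ k) : Int.testBit z k = decide (z < 0) := by
  have h := testBit_xor_sign z k
  rw [Nat.testBit_lt_two_pow (magnitude_lt hz)] at h
  exact bne_eq_false_iff_eq.1 h

lemma sum_testBit (k M : ℕ) (h : M < 2 ^ k) :
    ∑ i ∈ Finset.range k, (if M.testBit i then 2 ^ i else 0) = M := by
  induction k generalizing M with
  | zero => simp at h; simp [h]
  | succ k ih =>
    rw [Finset.sum_range_succ']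
    have := ih (M / 2) (by omega)
    simp only [Nat.testBit_succ, Nat.testBit_zero, pow_succ, pow_zero]
    have e : ∑ i ∈ Finset.range k, (if (M / 2).testBit i then 2 ^ i * 2 else 0) = M / 2 * 2 := by
      conv_rhs => rw [← this, Finset.sum_mul]
      refine Finset.sum_congr rfl fun i _ => ?_
      split_ifs <;> simp
    rw [e]
    rcases Nat.mod_two_eq_zero_or_one M with h | h <;> simp [h] <;> omega

/-- The two lowest of the `L + 2` digits are left out: a digit that is used has to be at least four
times as large as the error of the weight. -/
lemma sum_leading_bits (L M : ℕ) (h : M < 2 ^ (L + 2)) :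
    ∑ e : Fin L, (if M.testBit (L + 1 - e) then 2 ^ (L + 1 - e.1) else 0) = M / 4 * 4 := by
  have h1 := sum_testBit L (M / 4) (by rw [pow_add] at h; omega)
  rw [← Finset.sum_range_reflect] at h1
  rw [← h1, Finset.sum_mul, Finset.sum_range]
  refine Finset.sum_congr rfl fun e _ => ?_
  have he : L + 1 - e.1 = (L - 1 - e.1) + 2 := by omega
  rw [he, Nat.testBit_add, pow_add]
  split_ifs <;> simp

/-- The sign of an integer. -/
def signOf (z : ℤ) : ℤ := if z < 0 then -1 else 1

/-- The dropped digits contribute at most 3, and replacing `-(m + 1)` by `-m` contributes 1. -/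
lemma abs_sign_mul_sub_le (z : ℤ) : |signOf z * ((magnitude z / 4 * 4 : ℕ) : ℤ) - z| ≤ 4 := by
  cases z with
  | ofNat m =>
    simp only [signOf, magnitude, Int.ofNat_eq_natCast]
    rw [if_neg (by omega), abs_le]
    omega
  | negSucc m =>
    have := Int.negSucc_eq m
    simp only [signOf, magnitude]
    rw [if_pos (Int.negSucc_lt_zero m), abs_le]
    omega

lemma natAbs_ge_of_testBit {z : ℤ} {i : ℕ} (h : (magnitude z).testBit i = true) :
    (2 : ℤ) ^ i ≤ |z| := by
  have h1 := Nat.ge_two_pow_of_testBit h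
  zify at h1
  cases z with
  | ofNat m => simpa [magnitude] using h1
  | negSucc m =>
    have := Int.negSucc_eq m
    simp only [magnitude] at h1
    rw [this, abs_of_neg (by omega)]
    omega

end Digits

/-! ## The weights of a described tree -/

section ColumnNorm

variable {N : ℕ} (H : Matrix (Fin N) (Fin N) ℂ)

lemma maxColumnNorm_nonneg : 0 ≤ maxColumnNorm H :=
  Real.iSup_nonneg fun _ => Real.sqrt_nonneg _

lemma sum_norm_sq_le (j : Fin N) : ∑ k, ‖H k j‖ ^ 2 ≤ maxColumnNorm H ^ 2 := by
  have h : Real.sqrt (∑ k, ‖H k j‖ ^ 2) ≤ maxColumnNorm H :=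
    le_ciSup (f := fun j => Real.sqrt (∑ k, ‖H k j‖ ^ 2)) (Set.finite_range _).bddAbove j
  calc ∑ k, ‖H k j‖ ^ 2 = Real.sqrt (∑ k, ‖H k j‖ ^ 2) ^ 2 :=
        (Real.sq_sqrt (Finset.sum_nonneg fun _ _ => by positivity)).symm
    _ ≤ _ := pow_le_pow_left₀ (Real.sqrt_nonneg _) h 2

lemma norm_entry_le (k j : Fin N) : ‖H k j‖ ≤ maxColumnNorm H := by
  refine abs_le_of_sq_le_sq' ?_ (maxColumnNorm_nonneg H) |>.2
  exact (Finset.single_le_sum (f := fun k => ‖H k j‖ ^ 2) (fun _ _ => by positivity)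
    (Finset.mem_univ k)).trans (sum_norm_sq_le H j)

end ColumnNorm

lemma Represents.abs_le {b : ℕ} {u x : ℝ} {z : ℤ} (h : Represents b u z x) (hu : 0 < u)
    (hx : |x| ≤ u) : |z| ≤ 2 ^ b + 1 := by
  have h2 : (0 : ℝ) < 2 ^ b := by positivity
  have h1 : |(z : ℝ) / 2 ^ b * u| ≤ u + u / 2 ^ b := by
    have := abs_sub_abs_le_abs_sub ((z : ℝ) / 2 ^ b * u) x
    rw [abs_sub_comm] at this
    unfold Represents at h
    linarith
  rw [abs_mul, abs_div, abs_of_pos hu, abs_of_pos h2] at h1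
  have h3 : |(z : ℝ)| ≤ 2 ^ b + 1 := by
    have : |(z : ℝ)| / 2 ^ b * u = |(z : ℝ)| * (u / 2 ^ b) := by ring
    rw [this] at h1
    have e : u + u / 2 ^ b = (2 ^ b + 1) * (u / 2 ^ b) := by field_simp
    rw [e] at h1
    exact le_of_mul_le_mul_right h1 (by positivity)
  exact_mod_cast h3

/-! ### Digits of the weights, and recovery of heavy edges from partial sums. -/

namespace DescribesTree

variable {N : ℕ} {P : Procedures} {H : Matrix (Fin N) (Fin N) ℂ} {G : SimpleGraph (Fin N)}
  {r : Fin N}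

/-- The real or imaginary part of a weight. -/
def _root_.Procedures.part (P : Procedures) (im : Bool) (β : ℕ) (j k : ℕ) : ℤ :=
  (if im then P.weightIm else P.weightRe) β j k

/-- The real or imaginary part of a complex number. -/
def _root_.rePart (im : Bool) (x : ℂ) : ℝ := if im then x.im else x.re

lemma _root_.abs_rePart_le (im : Bool) (x : ℂ) : |rePart im x| ≤ ‖x‖ := by
  cases im
  · exact Complex.abs_re_le_norm x
  · exact Complex.abs_im_le_norm x

lemma represents_part (hD : DescribesTree P H G r) {j u : Fin N} (h : G.Adj j u) (im : Bool)
    (β : ℕ) : Represents β (maxColumnNorm H) (P.part im β u (P.position u j))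
      (rePart im (H j u)) := by
  obtain ⟨h1, h2⟩ := hD.position_lt h.symm
  cases im
  · exact hD.weights.weightRe_approx β u j _ h1 h2
  · exact hD.weights.weightIm_approx β u j _ h1 h2

lemma abs_part_le (hD : DescribesTree P H G r) (hH : 0 < maxColumnNorm H) {j u : Fin N}
    (h : G.Adj j u) (im : Bool) (β : ℕ) : |P.part im β u (P.position u j)| ≤ 2 ^ β + 1 :=
  (hD.represents_part h im β).abs_le hH ((abs_rePart_le _ _).trans (norm_entry_le H j u))

lemma isGood_label (hD : DescribesTree P H G r) (hG : G.IsTree) (hH : 0 < maxColumnNorm H)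
    {j u : Fin N} (hju : G.Adj j u) (hd : G.dist r u + 1 = G.dist r j)
    (hu : parentVec P (label j) = label u) (T : HamPart) {β : ℕ} (hβ : 1 ≤ β) :
    isGood P T β (label j) =
      ((magnitude (P.part T.im β u (P.position u j))).testBit (β - T.level) &&
        (decide (P.part T.im β u (P.position u j) < 0) == T.sgn)) := by
  have hdist : G.dist r j < N := by
    obtain ⟨p, hp, hp'⟩ := hG.connected.exists_path_of_dist r j
    rw [← hp']
    simpa using hp.length_lt
  have h1 : (BitVec.ofNat (labelBits N) 0).ult (depthVec P (label j)) = true := by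
    rw [BitVec.ult_iff_lt, BitVec.lt_def, depthVec, toNat_label, hD.depth_eq, BitVec.toNat_ofNat,
      BitVec.toNat_ofNat, Nat.mod_eq_of_lt (lt_two_pow_labelBits hdist)]
    simp; omega
  have h2 : weightVec P T.im β (label j) =
      BitVec.ofInt (β + 2) (P.part T.im β u (P.position u j)) := by
    rw [weightVec, hD.positionVec_label hju hu, hu, toNat_label, Procedures.part]
  -- The bound `2 ^ β + 1` on the integer leaves digit `β + 1` to the sign. It is strict enough only
  -- for `β ≥ 1`.
  have hz : |P.part T.im β u (P.position u j)| < 2 ^ (β + 1) := by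
    have := hD.abs_part_le hH hju T.im β
    have : (2 : ℤ) ≤ 2 ^ β := by
      calc (2 : ℤ) = 2 ^ 1 := by norm_num
        _ ≤ 2 ^ β := pow_le_pow_right₀ (by norm_num) hβ
    rw [pow_succ]; linarith
  rw [isGood, h1, h2, getLsbD_ofInt, getLsbD_ofInt, testBit_eq_neg hz, ← testBit_xor_sign]
  simp [show β - T.level < β + 2 by omega]

/-- The edges found in a part of the Hamiltonian have large weight. -/
lemma sq_norm_ge_of_isGood (hD : DescribesTree P H G r) (hH : 0 < maxColumnNorm H) {j u : Fin N}
    (hju : G.Adj j u) {im : Bool} {e β : ℕ} (he : e + 2 ≤ β)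
    (hM : (magnitude (P.part im β u (P.position u j))).testBit (β - e) = true) :
    9 / 16 * maxColumnNorm H ^ 2 / 4 ^ e ≤ ‖H j u‖ ^ 2 := by
  have h1 := natAbs_ge_of_testBit hM
  have h2 := hD.represents_part hju im β
  have h3 := abs_rePart_le im (H j u)
  set h := maxColumnNorm H
  set z := P.part im β u (P.position u j)
  have h1' : (2 : ℝ) ^ (β - e) ≤ |(z : ℝ)| := by exact_mod_cast h1
  have h4 : (2 : ℝ) ^ (β - e) / 2 ^ β * h - h / 2 ^ β ≤ ‖H j u‖ := by
    have h5 : |(z : ℝ) / 2 ^ β * h| ≤ ‖H j u‖ + h / 2 ^ β := by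
      have := abs_sub_abs_le_abs_sub ((z : ℝ) / 2 ^ β * h) (rePart im (H j u))
      rw [abs_sub_comm] at this
      unfold Represents at h2
      linarith
    rw [abs_mul, abs_div, abs_of_pos hH, abs_of_pos (by positivity : (0 : ℝ) < 2 ^ β)] at h5
    have : (2 : ℝ) ^ (β - e) / 2 ^ β * h ≤ |(z : ℝ)| / 2 ^ β * h := by gcongr
    linarith
  -- The set digit is worth `h / 2 ^ e`, the error is `h / 2 ^ β`, at most a quarter of it. This
  -- leaves the factor 3/4, whose square is 9/16.
  obtain ⟨d, rfl⟩ : ∃ d, β = e + (d + 2) := ⟨β - e - 2, by omega⟩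
  have h5 : 3 / 4 * h / 2 ^ e ≤ ‖H j u‖ := by
    refine le_trans ?_ h4
    have e1 : e + (d + 2) - e = d + 2 := by omega
    rw [e1]
    have h6 : (1 : ℝ) ≤ 2 ^ d := one_le_pow₀ (by norm_num)
    have e2 : (2 : ℝ) ^ (d + 2) / 2 ^ (e + (d + 2)) * h - h / 2 ^ (e + (d + 2)) =
        (1 - 1 / (4 * 2 ^ d)) * h / 2 ^ e := by
      rw [pow_add 2 e, pow_add 2 d]; field_simp; norm_num; ring
    rw [e2]
    gcongr
    have : 1 / (4 * 2 ^ d) ≤ (1 : ℝ) / 4 := by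
      apply one_div_le_one_div_of_le <;> linarith
    linarith
  calc 9 / 16 * h ^ 2 / 4 ^ e = (3 / 4 * h / 2 ^ e) ^ 2 := by
        rw [show (4 : ℝ) = 2 ^ 2 by norm_num, ← pow_mul, mul_comm 2 e, pow_mul]; ring
    _ ≤ _ := pow_le_pow_left₀ (by positivity) h5 2

lemma _root_.cumulative_label (P : Procedures) (p : ℕ) (u : Fin N) {k : BitVec (labelBits N)} :
    cumulative P p (label u) k = BitVec.ofInt (p + 2) (P.integral p u 0 k.toNat) := by
  rw [cumulative, toNat_label]; simp

/-- The binary search finds the edges of large weight. -/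
lemma childVec_cumulative (hD : DescribesTree P H G r) (hH : 0 < maxColumnNorm H) {j u : Fin N}
    (hju : G.Adj j u) (hu : parentVec P (label j) = label u) {e : ℕ}
    (hw : 9 / 16 * maxColumnNorm H ^ 2 / 4 ^ e ≤ ‖H j u‖ ^ 2) :
    childVec P (2 * e + 4) (label u)
      (cumulative P (2 * e + 4) (label u) (positionVec P (label j))) = label j := by
  set p := 2 * e + 4 with hp
  set h := maxColumnNorm H
  obtain ⟨hk, hk'⟩ := hD.position_lt hju.symm
  set k := P.position u j with hkdef
  let S : ℕ → ℝ := fun c => ∑ v : Fin N, if 0 ≤ P.position u v ∧ P.position u v < c then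
    ‖H v u‖ ^ 2 else 0
  have hS0 : ∀ c, 0 ≤ S c := fun c => Finset.sum_nonneg fun v _ => by split_ifs <;> positivity
  have hS1 : ∀ c, S c ≤ h ^ 2 := fun c => (Finset.sum_le_sum fun v _ => by
    split_ifs
    · exact le_rfl
    · positivity).trans (sum_norm_sq_le H u)
  have hmono : ∀ c, c ≤ k → S c ≤ S k := fun c hc => Finset.sum_le_sum fun v _ => by
    split_ifs with h1 h2
    · exact le_rfl
    · omega
    · positivity
    · exact le_rfl
  have hjump : ∀ c, k < c → S k + ‖H j u‖ ^ 2 ≤ S c := by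
    intro c hc
    simp only [S]
    rw [← Finset.add_sum_erase _ _ (Finset.mem_univ j), ← Finset.add_sum_erase (a := j) _ _
      (Finset.mem_univ j), if_neg (by omega), if_pos (by omega), zero_add, add_comm]
    gcongr with v _
    split_ifs with h1 h2
    · exact le_rfl
    · omega
    · positivity
    · exact le_rfl
  have hF : ∀ c, c ≤ P.degree u → |S c - (P.integral p u 0 c : ℝ) * (h ^ 2 / 2 ^ p)| ≤ h ^ 2 / 2 ^ p := by
    intro c hc
    have := hD.weights.integral_approx p u 0 c (Nat.zero_le _) hc
    unfold Represents at this
    rwa [div_mul_eq_mul_div, mul_div_assoc] at this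
  set ε := h ^ 2 / 2 ^ p with hε
  have hεpos : 0 < ε := by positivity
  have hhε : h ^ 2 = 2 ^ p * ε := by rw [hε]; field_simp
  -- In units of `ε = h ^ 2 / (16 * 4 ^ e)` the bound `9/16 * h ^ 2 / 4 ^ e` is exactly 9.
  have hw' : 9 * ε ≤ ‖H j u‖ ^ 2 := by
    refine le_trans (le_of_eq ?_) hw
    rw [hε, hp, pow_add, pow_mul]; norm_num; ring
  have hb : ∀ c, c ≤ P.degree u → -1 ≤ P.integral p u 0 c ∧ P.integral p u 0 c ≤ 2 ^ p + 1 := by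
    intro c hc
    have h1 := abs_le.1 (hF c hc)
    have h2 := hS0 c
    have h3 := hS1 c
    rw [hhε] at h3
    constructor
    · have : (-1 : ℝ) * ε ≤ (P.integral p u 0 c : ℝ) * ε := by linarith
      exact_mod_cast le_of_mul_le_mul_right this hεpos
    · have : (P.integral p u 0 c : ℝ) * ε ≤ (2 ^ p + 1 : ℝ) * ε := by linarith
      exact_mod_cast le_of_mul_le_mul_right this hεpos
  -- Each integral is off by at most one unit. Up to index `k` the partial sums are at most that at
  -- `k`, beyond it they exceed it by 9 units, so the computed values differ by at most 2 or at
  -- least 7. The threshold 4 of the test lies in between.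
  have hlow : ∀ c, c ≤ k → P.integral p u 0 c ≤ P.integral p u 0 k + 2 := by
    intro c hc
    have h1 := abs_le.1 (hF c (by omega))
    have h2 := abs_le.1 (hF k (by omega))
    have h3 := hmono c hc
    have : (P.integral p u 0 c : ℝ) * ε ≤ ((P.integral p u 0 k : ℝ) + 2) * ε := by linarith
    exact_mod_cast le_of_mul_le_mul_right this hεpos
  have hhigh : ∀ c, k < c → c ≤ P.degree u → P.integral p u 0 k + 7 ≤ P.integral p u 0 c := by
    intro c hc hc'
    have h1 := abs_le.1 (hF c (by omega))
    have h2 := abs_le.1 (hF k (by omega))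
    have h3 := hjump c hc
    have : ((P.integral p u 0 k : ℝ) + 7) * ε ≤ (P.integral p u 0 c : ℝ) * ε := by linarith
    exact_mod_cast le_of_mul_le_mul_right this hεpos
  have hpos : (positionVec P (label j)).toNat = k := hD.positionVec_label hju hu
  have hp16 : (16 : ℤ) ≤ 2 ^ p := by
    calc (16 : ℤ) = 2 ^ 4 := by norm_num
      _ ≤ 2 ^ p := pow_le_pow_right₀ (by norm_num) (by omega)
  -- The integrals lie between `-1` and `2 ^ p + 1`, so even after adding 4 there is no overflow in
  -- `p + 2` signed bits.
  have hint : ∀ z : ℤ, -1 ≤ z → z ≤ 2 ^ p + 5 → (BitVec.ofInt (p + 2) z).toInt = z := by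
    intro z h1 h2
    have e1 : (2 : ℤ) ^ (p + 2 - 1) = 2 * 2 ^ p := by
      rw [show p + 2 - 1 = p + 1 by omega, pow_succ]; ring
    apply BitVec.toInt_ofInt_eq_self (by omega) <;> rw [e1] <;> linarith
  have htest : ∀ c, searchTest P p (label u)
      (cumulative P p (label u) (positionVec P (label j))) c = true ↔ c.toNat ≤ k := by
    intro c
    rw [searchTest, Bool.and_eq_true, BitVec.ult_iff_lt, BitVec.lt_def, hD.degreeVec_label,
      cumulative_label, cumulative_label, hpos, BitVec.slt_iff_toInt_lt]
    have e4 : BitVec.ofNat (p + 2) 4 = BitVec.ofInt (p + 2) 4 := rfl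
    rw [e4, ← BitVec.ofInt_add]
    constructor
    · rintro ⟨h1, h2⟩
      by_contra h3
      push Not at h3
      have h4 := hhigh c.toNat h3 h1.le
      have h5 := hb c.toNat h1.le
      have h6 := hb k hk.le
      rw [hint _ (by linarith) (by linarith), hint _ (by linarith) (by linarith)] at h2
      linarith
    · intro h1
      refine ⟨by omega, ?_⟩
      have h4 := hlow c.toNat h1
      have h5 := hb c.toNat (by omega)
      have h6 := hb k hk.le
      rw [hint _ (by linarith) (by linarith), hint _ (by linarith) (by linarith)]
      linarith
  have hsearch := search_toNat P (lt_two_pow_labelBits (hk.trans (hD.degree_lt u))) htest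
    (labelBits N) le_rfl
  rw [Nat.sub_self, pow_zero, Nat.div_one, mul_one] at hsearch
  rw [childVec, hsearch, toNat_label, hk']
  rfl

end DescribesTree

/-! ## The Hamiltonian composed of the parts -/

/-- The parts of a Hamiltonian with `L` binary digits of the weights. -/
abbrev PartIndex (L : ℕ) : Type := Bool × Bool × Bool × Fin L

/-- The part with a given index. -/
def PartIndex.toPart {L : ℕ} (a : PartIndex L) : HamPart := ⟨a.1, a.2.1, a.2.2.1, a.2.2.2⟩

/-- The number of qubits for the mark of an edge. -/
def markBits (L : ℕ) : ℕ := 2 * L + 4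

lemma PartIndex.precision_le {L : ℕ} (a : PartIndex L) : a.toPart.precision + 2 ≤ markBits L := by
  have := a.2.2.2.2
  simp only [HamPart.precision, PartIndex.toPart, markBits]
  omega

/-- The Hamiltonian with the weights rounded to `L` binary digits. -/
noncomputable def roundedHam (N L : ℕ) (h : ℝ) (P : Procedures) : Matrix (Fin N) (Fin N) ℂ :=
  fun i j => (8 * h : ℝ) * ∑ a : PartIndex L, partOp a.toPart (L + 1) P
    (vertexState (markBits L) (label i)) (vertexState (markBits L) (label j))

lemma roundedHam_isHermitian (N L : ℕ) (h : ℝ) (P : Procedures) :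
    (roundedHam N L h P).IsHermitian := by
  refine Matrix.IsHermitian.ext fun i j => ?_
  rw [roundedHam, roundedHam, star_mul', star_sum, Complex.star_def, Complex.conj_ofReal]
  refine congrArg _ (Finset.sum_congr rfl fun a _ => ?_)
  rw [← (partOp_isHermitian a.toPart (L + 1) P).apply]
  exact star_star _

/-! ### Entries of the rounded Hamiltonian. -/

namespace DescribesTree

variable {N : ℕ} {P : Procedures} {H : Matrix (Fin N) (Fin N) ℂ} {G : SimpleGraph (Fin N)}
  {r : Fin N}

lemma adj_of_isLinked (hD : DescribesTree P H G r) {T : HamPart} {β : ℕ} {j i : Fin N}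
    (h : IsLinked P T β (label j) (label i)) : G.Adj j i ∧ G.dist r i + 1 = G.dist r j := by
  obtain ⟨u, h1, h2, h3⟩ := hD.exists_parent (hD.ne_root_of_isGood h.2.1)
  have := label_injective (h.1.trans h3)
  subst this
  exact ⟨h1, h2⟩

lemma parentVec_label (hD : DescribesTree P H G r) (hG : G.IsTree) {j i : Fin N} (h : G.Adj j i)
    (h' : G.dist r i + 1 = G.dist r j) : parentVec P (label j) = label i := by
  have hj : j ≠ r := by
    rintro rfl
    simp at h'
  obtain ⟨u, h1, h2, h3⟩ := hD.exists_parent hj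
  rw [h3, parent_unique hG h h1 h' h2]

/-- A set digit forces the weight to be large, and then the search recovers the child. The search
condition in `IsLinked` is thus automatic for the edges of the part. -/
lemma isLinked_iff (hD : DescribesTree P H G r) (hG : G.IsTree) (hH : 0 < maxColumnNorm H)
    {j i : Fin N} (h : G.Adj j i) (h' : G.dist r i + 1 = G.dist r j) {T : HamPart} {β : ℕ}
    (hT : T.level + 2 ≤ β) :
    IsLinked P T β (label j) (label i) ↔ isGood P T β (label j) = true := by
  have hp := hD.parentVec_label hG h h'
  refine ⟨fun h => h.2.1, fun hg => ⟨hp.symm, hg, ?_⟩⟩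
  refine hD.childVec_cumulative hH h hp (hD.sq_norm_ge_of_isGood hH h (im := T.im) (β := β) hT ?_)
  rw [hD.isGood_label hG hH h h' hp T (by omega), Bool.and_eq_true] at hg
  exact hg.1

lemma _root_.inv_sqrt_two_pow (e : ℕ) :
    (((Real.sqrt 2)⁻¹ : ℝ) : ℂ) ^ (2 * e + 4 + 2) = 1 / 2 ^ (e + 3) := by
  have h : (((Real.sqrt 2)⁻¹ : ℝ) : ℂ) ^ 2 = 1 / 2 := by
    rw [← Complex.ofReal_pow, inv_pow, Real.sq_sqrt (by norm_num)]
    push_cast; norm_num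
  rw [show 2 * e + 4 + 2 = 2 * (e + 3) by ring, pow_mul, h, one_div_pow]

lemma partOp_label (hD : DescribesTree P H G r) (hG : G.IsTree) (hH : 0 < maxColumnNorm H)
    {j i : Fin N} (h : G.Adj j i) (h' : G.dist r i + 1 = G.dist r j) {L : ℕ}
    (hn : 0 < labelBits N) (a : PartIndex L) :
    partOp a.toPart (L + 1) P
      (vertexState (markBits L) (label j)) (vertexState (markBits L) (label i)) =
    if a.1 = !decide (G.dist r j % 2 = 1) then
      (if (magnitude (P.part a.2.1 (L + 1) i (P.position i j))).testBit (L + 1 - a.2.2.2) = true ∧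
          decide (P.part a.2.1 (L + 1) i (P.position i j) < 0) = a.2.2.1 then
        a.toPart.phase * (1 / 2 ^ (a.2.2.2.1 + 3)) else 0)
    else 0 := by
  have hj := hD.isChild_label hn a.toPart.parity j
  have hi := hD.isChild_label hn a.toPart.parity i
  have hodd : decide (G.dist r i % 2 = 1) = !decide (G.dist r j % 2 = 1) := by
    rw [← h']
    rcases Nat.mod_two_eq_zero_or_one (G.dist r i) with h | h
    · simp [h, show (G.dist r i + 1) % 2 = 1 by omega]
    · simp [h, show (G.dist r i + 1) % 2 = 0 by omega]
  rw [hodd] at hi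
  have hpar : a.toPart.parity = a.1 := rfl
  have hgood := hD.isGood_label hG hH h h' (hD.parentVec_label hG h h') a.toPart
    (β := L + 1) (by omega)
  have hlevel : a.toPart.level + 2 ≤ L + 1 := by
    have := a.2.2.2.2
    simp only [PartIndex.toPart]; omega
  rw [hpar] at hi hj
  split_ifs with hc hg
  · rw [hc] at hi hj
    rw [partOp_child_center P a.toPart (L + 1) a.precision_le (by rw [hpar, hc, hj]; simp)
      (by rw [hpar, hc, hi]; simp), if_pos, HamPart.precision, inv_sqrt_two_pow]
    · rfl
    · rw [hD.isLinked_iff hG hH h h' hlevel, hgood]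
      simp only [Bool.and_eq_true, beq_iff_eq]
      exact hg
  · rw [hc] at hi hj
    rw [partOp_child_center P a.toPart (L + 1) a.precision_le (by rw [hpar, hc, hj]; simp)
      (by rw [hpar, hc, hi]; simp), if_neg]
    rw [hD.isLinked_iff hG hH h h' hlevel, hgood]
    simp only [Bool.and_eq_true, beq_iff_eq]
    exact hg
  · have hc' : a.1 = decide (G.dist r j % 2 = 1) := by
      cases h1 : a.1 <;> cases h2 : decide (G.dist r j % 2 = 1) <;> simp_all
    rw [hc'] at hi hj
    rw [partOp_center_child P a.toPart (L + 1) a.precision_le (by rw [hpar, hc', hi]; simp)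
      (by rw [hpar, hc', hj]; simp), if_neg]
    intro hl
    have := (hD.adj_of_isLinked hl).2
    omega

/-- Only the part with the sign of `z` contributes. The amplitude `2 ^ (-(e + 3))` is an eighth of
the value `2 ^ (-e)` of the digit `L + 1 - e` relative to `2 ^ (L + 1)`; the factor `8 * h` in
`roundedHam` makes up for it. -/
lemma _root_.sum_digits (L : ℕ) {z : ℤ} (hz : magnitude z < 2 ^ (L + 2)) (c im : Bool) :
    ∑ s : Bool, ∑ e : Fin L, (if (magnitude z).testBit (L + 1 - e) = true ∧ decide (z < 0) = s then
      (PartIndex.toPart (c, im, s, e)).phase * (1 / 2 ^ (e.1 + 3)) else 0) =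
    (if im then Complex.I else 1) *
      (((signOf z * ((magnitude z / 4 * 4 : ℕ) : ℤ) : ℤ) : ℂ) / 2 ^ (L + 1) / 8) := by
  rw [Finset.sum_eq_single (decide (z < 0))]
  rotate_left
  · intro b _ hb
    simp [hb.symm]
  · simp
  have hsum : ∑ e : Fin L, (if (magnitude z).testBit (L + 1 - e) then
      (1 : ℂ) / 2 ^ (e.1 + 3) else 0) = ((magnitude z / 4 * 4 : ℕ) : ℂ) / 2 ^ (L + 1) / 8 := by
    rw [← sum_leading_bits L _ hz, Nat.cast_sum, Finset.sum_div, Finset.sum_div]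
    refine Finset.sum_congr rfl fun e _ => ?_
    split_ifs
    · have : (2 : ℂ) ^ (L + 1) = 2 ^ (L + 1 - e.1) * 2 ^ e.1 := by
        rw [← pow_add]; congr 1; omega
      rw [this, pow_add]
      push_cast
      field_simp
      norm_num
    · simp
  have hs : (if (z < 0) then (-1 : ℂ) else 1) = (signOf z : ℂ) := by
    rw [signOf]; split_ifs <;> simp
  rw [Int.cast_mul, Int.cast_natCast, mul_div_assoc, mul_div_assoc, ← hsum, Finset.mul_sum,
    Finset.mul_sum]
  refine Finset.sum_congr rfl fun e _ => ?_
  simp only [PartIndex.toPart, HamPart.phase, decide_eq_true_eq, hs, and_true]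
  cases im <;> split_ifs <;> simp_all <;> ring

lemma sum_partOp_eq (hD : DescribesTree P H G r) (hG : G.IsTree) (hH : 0 < maxColumnNorm H)
    {j i : Fin N} (h : G.Adj j i) (h' : G.dist r i + 1 = G.dist r j) {L : ℕ}
    (hn : 0 < labelBits N) :
    ∑ a : PartIndex L, partOp a.toPart (L + 1) P
      (vertexState (markBits L) (label j)) (vertexState (markBits L) (label i)) =
    ∑ im : Bool, (if im then Complex.I else 1) *
      (((signOf (P.part im (L + 1) i (P.position i j)) *
        ((magnitude (P.part im (L + 1) i (P.position i j)) / 4 * 4 : ℕ) : ℤ) : ℤ) : ℂ) /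
          2 ^ (L + 1) / 8) := by
  simp only [hD.partOp_label hG hH h h' hn]
  simp only [Fintype.sum_prod_type]
  rw [Finset.sum_eq_single (!decide (G.dist r j % 2 = 1))]
  rotate_left
  · intro b _ hb
    simp [hb]
  · simp
  refine Finset.sum_congr rfl fun im _ => ?_
  have hz := hD.abs_part_le hH h im (L + 1)
  have hzlt : magnitude (P.part im (L + 1) i (P.position i j)) < 2 ^ (L + 2) := magnitude_lt (by
    have : (2 : ℤ) ≤ 2 ^ (L + 1) := by
      calc (2 : ℤ) = 2 ^ 1 := by norm_num
        _ ≤ 2 ^ (L + 1) := pow_le_pow_right₀ (by norm_num) (by omega)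
    rw [pow_succ 2 (L + 1)]; linarith)
  rw [← sum_digits L hzlt (!decide (G.dist r j % 2 = 1)) im]
  simp only [if_true]

/-- In units of `h / 2 ^ (L + 1)`, rounding costs 4 and the procedure 1, for each of the real and
imaginary parts. -/
lemma norm_roundedHam_sub_le (hD : DescribesTree P H G r) (hG : G.IsTree)
    (hHG : IsGraphOfNonzeroEntries G H) (hHh : H.IsHermitian)
    (hH : 0 < maxColumnNorm H) (hn : 0 < labelBits N) (L : ℕ) (i j : Fin N) :
    ‖roundedHam N L (maxColumnNorm H) P i j - H i j‖ ≤ 10 * maxColumnNorm H / 2 ^ (L + 1) := by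
  set h := maxColumnNorm H with hdef
  have key : ∀ i j, G.Adj j i → G.dist r i + 1 = G.dist r j →
      ‖roundedHam N L h P j i - H j i‖ ≤ 10 * h / 2 ^ (L + 1) := by
    intro i j hji hd
    rw [roundedHam, hD.sum_partOp_eq hG hH hji hd hn, Fintype.sum_bool]
    have hb : ∀ im, |8 * h * (((signOf (P.part im (L + 1) i (P.position i j)) *
        ((magnitude (P.part im (L + 1) i (P.position i j)) / 4 * 4 : ℕ) : ℤ) : ℤ) : ℝ) /
          2 ^ (L + 1) / 8) - rePart im (H j i)| ≤ 5 * h / 2 ^ (L + 1) := by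
      intro im
      have h1 := hD.represents_part hji im (L + 1)
      have h2 := abs_sign_mul_sub_le (P.part im (L + 1) i (P.position i j))
      set z := P.part im (L + 1) i (P.position i j)
      set y := signOf z * ((magnitude z / 4 * 4 : ℕ) : ℤ)
      have h2' : |(y : ℝ) - z| ≤ 4 := by exact_mod_cast h2
      unfold Represents at h1
      rw [abs_sub_comm, ← hdef] at h1
      have h3 : |((y : ℝ) - z) * (h / 2 ^ (L + 1))| ≤ 4 * (h / 2 ^ (L + 1)) := by
        rw [abs_mul, abs_of_pos (a := h / 2 ^ (L + 1)) (by positivity)]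
        gcongr
      calc |8 * h * ((y : ℝ) / 2 ^ (L + 1) / 8) - rePart im (H j i)|
          = |((y : ℝ) - z) * (h / 2 ^ (L + 1)) + ((z : ℝ) / 2 ^ (L + 1) * h - rePart im (H j i))| := by
            congr 1; ring
        _ ≤ 4 * (h / 2 ^ (L + 1)) + h / 2 ^ (L + 1) := (abs_add_le _ _).trans (add_le_add h3 h1)
        _ = 5 * h / 2 ^ (L + 1) := by ring
    have ht := hb true
    have hf := hb false
    simp only [rePart, if_true, Bool.false_eq_true, if_false] at ht hf ⊢
    set a := ((signOf (P.part true (L + 1) i (P.position i j)) *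
        ((magnitude (P.part true (L + 1) i (P.position i j)) / 4 * 4 : ℕ) : ℤ) : ℤ) : ℝ) with ha
    set b := ((signOf (P.part false (L + 1) i (P.position i j)) *
        ((magnitude (P.part false (L + 1) i (P.position i j)) / 4 * 4 : ℕ) : ℤ) : ℤ) : ℝ) with hb
    refine (Complex.norm_le_abs_re_add_abs_im _).trans ?_
    have e : ((8 * h : ℝ) : ℂ) * (Complex.I * ((((signOf (P.part true (L + 1) i (P.position i j)) *
        ((magnitude (P.part true (L + 1) i (P.position i j)) / 4 * 4 : ℕ) : ℤ) : ℤ)) : ℂ) / 2 ^ (L + 1) / 8)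
        + 1 * ((((signOf (P.part false (L + 1) i (P.position i j)) *
        ((magnitude (P.part false (L + 1) i (P.position i j)) / 4 * 4 : ℕ) : ℤ) : ℤ)) : ℂ) / 2 ^ (L + 1) / 8))
        = ((8 * h * (b / 2 ^ (L + 1) / 8) : ℝ) : ℂ) + ((8 * h * (a / 2 ^ (L + 1) / 8) : ℝ) : ℂ) * Complex.I := by
      rw [ha, hb]
      push_cast
      ring
    rw [e]
    simp only [Complex.sub_re, Complex.sub_im, Complex.add_re, Complex.add_im, Complex.ofReal_re,
      Complex.ofReal_im, Complex.re_ofReal_mul, Complex.im_ofReal_mul, Complex.I_re, Complex.I_im,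
      mul_zero, mul_one, add_zero, zero_add]
    calc _ ≤ 5 * h / 2 ^ (L + 1) + 5 * h / 2 ^ (L + 1) := add_le_add hf ht
      _ = _ := by ring
  by_cases hadj : G.Adj j i
  -- In a tree one end of an edge is the parent of the other. The case of the reversed edge follows
  -- as both matrices are Hermitian.
  · rcases hG.dist_eq_dist_add_one_of_adj r hadj with hd | hd
    · have h1 := key i j hadj hd.symm
      rw [← (roundedHam_isHermitian N L h P).apply, ← hHh.apply, ← star_sub, norm_star]
      exact h1
    · exact key j i hadj.symm hd.symm
  · have h1 : H i j = 0 := by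
      by_contra hne
      exact hadj ((hHG i j).1 hne).symm
    have h2 : roundedHam N L h P i j = 0 := by
      rw [roundedHam, Finset.sum_eq_zero, mul_zero]
      intro a _
      cases hi : isChild P a.toPart.parity (label i) <;> cases hj : isChild P a.toPart.parity (label j)
      · exact partOp_center_center P _ _ a.precision_le hj hi
      · rw [partOp_center_child P _ _ a.precision_le hj hi, if_neg]
        exact fun hl => hadj (hD.adj_of_isLinked hl).1
      · rw [partOp_child_center P _ _ a.precision_le hi hj, if_neg]
        exact fun hl => hadj (hD.adj_of_isLinked hl).1.symm
      · exact partOp_child_child P _ _ hj hi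
    rw [h1, h2, sub_zero, norm_zero]
    positivity

end DescribesTree

/-! ## The Hamiltonian on the data qubits -/

section HamOp

open scoped Matrix.Norms.L2Operator

variable {n : ℕ}

/-- The operator `edgeOp`, after a reflection or not. -/
noncomputable def pieceMap (L : ℕ) (a : PartIndex L × Bool) (P : Procedures) :
    Matrix (Wire n (markBits L) → Bool) (Wire n (markBits L) → Bool) ℂ :=
  edgeOp a.1.toPart (L + 1) P * if a.2 then reflectOp else 1

/-- The pieces of the Hamiltonian, which occur with and without a reflection. -/
noncomputable def pieceOp (L : ℕ) (a : PartIndex L × Bool) (P : Procedures) :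
    Matrix (Wire n (markBits L) → Bool) (Wire n (markBits L) → Bool) ℂ :=
  (pieceMap L a P).conjTranspose * ctrlMat (fun _ => true) roleWire a.1.toPart.swapMat *
    pieceMap L a P

/-- The Hamiltonian on the data qubits. -/
noncomputable def hamOp (L : ℕ) (h : ℝ) (P : Procedures) :
    Matrix (Wire n (markBits L) → Bool) (Wire n (markBits L) → Bool) ℂ :=
  ∑ a : PartIndex L × Bool, (4 * h : ℝ) • pieceOp L a P

/-- The cost of an evolution under a piece of the Hamiltonian. -/
def pieceCost (q : Polynomial ℕ) (n L : ℕ) : ℕ :=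
  2 * (100 * ((q.eval (n + markBits L) + 1) * (n + markBits L + 1) ^ 3) +
    (2 * (n + markBits L + 3) + 1)) + 3

lemma pieceMap_implUnitary {q : Polynomial ℕ} (hn : 0 < n) (L : ℕ) (a : PartIndex L × Bool) :
    ImplUnitary n q (100 * ((q.eval (n + markBits L) + 1) * (n + markBits L + 1) ^ 3) +
      (2 * (n + markBits L + 3) + 1)) (pieceMap (n := n) L a) := by
  refine (edgeOp_implUnitary hn a.1.toPart (by simp only [markBits]; omega)
    a.1.precision_le).mul (O' := fun _ => if a.2 then reflectOp else 1) ?_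
  split_ifs
  · exact reflectOp_implUnitary hn
  · exact ImplUnitary.one.mono (Nat.zero_le _)

lemma pieceOp_impl_exp {q : Polynomial ℕ} (hn : 0 < n) (L : ℕ) (a : PartIndex L × Bool) (τ : ℝ) :
    Impl n q (pieceCost q n L) fun P =>
      NormedSpace.exp ((-(Complex.I * (τ : ℂ))) • pieceOp (n := n) L a P) :=
  (pieceMap_implUnitary hn L a).impl_exp (w := roleWire) (d := flagWire) (by simp)
    a.1.toPart.isHermitian_swapMat τ

lemma pieceOp_isHermitian (L : ℕ) (a : PartIndex L × Bool) (P : Procedures) :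
    (pieceOp (n := n) L a P).IsHermitian := by
  rw [Matrix.IsHermitian, pieceOp, Matrix.conjTranspose_mul, Matrix.conjTranspose_mul,
    Matrix.conjTranspose_conjTranspose, ctrlMat_conjTranspose (fun _ _ => rfl),
    a.1.toPart.isHermitian_swapMat.eq, Matrix.mul_assoc]

lemma norm_pieceOp_le (hn : 0 < n) (L : ℕ) (a : PartIndex L × Bool) (P : Procedures) :
    ‖pieceOp (n := n) L a P‖ ≤ 1 := by
  have hV := (pieceMap_implUnitary (q := 0) hn L a).mem_unitary P
  refine norm_unitary_le (mul_mem (mul_mem ?_ (ctrlMat_mem_unitary (fun _ _ => rfl)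
    a.1.toPart.swapMat_mem_unitary)) hV)
  rw [← Matrix.star_eq_conjTranspose]
  exact Unitary.star_mem hV

/-- The two pieces are `A` and `R * A * R` with the reflection `R`. Their sum doubles the block of
`A` on the vertex states and cancels the blocks leading out of them. -/
lemma pieceOp_false_add_true (L : ℕ) (a : PartIndex L) (P : Procedures)
    (x y : Wire n (markBits L) → Bool) (hy : (workWires n (markBits L)).any y = false) :
    pieceOp L (a, false) P x y + pieceOp L (a, true) P x y =
      if (workWires n (markBits L)).any x then 0 else 2 * partOp a.toPart (L + 1) P x y := by
  have h1 : pieceOp (n := n) L (a, false) P = partOp a.toPart (L + 1) P := by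
    simp [pieceOp, pieceMap, partOp]
  have h2 : pieceOp (n := n) L (a, true) P = reflectOp * partOp a.toPart (L + 1) P * reflectOp := by
    simp only [pieceOp, pieceMap, partOp, if_true, Matrix.conjTranspose_mul,
      conjTranspose_reflectOp, Matrix.mul_assoc]
  rw [h1, h2, reflectOp, Matrix.mul_diagonal, Matrix.diagonal_mul, hy]
  cases (workWires n (markBits L)).any x <;> simp [two_mul]

end HamOp

/-! ### The vertex states as an invariant subspace. -/

section Code

variable {N : ℕ}

/-- The isometry that maps vertices to their basis states. -/
def codeMat (N L : ℕ) : Matrix (Wire (labelBits N) (markBits L) → Bool) (Fin N) ℂ := fun x j =>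
  if x = vertexState (markBits L) (label j) then 1 else 0

lemma workWires_any_vertexState {n w : ℕ} (v : BitVec n) :
    (workWires n w).any (vertexState w v) = false := by
  simp [workWires, vertexState, content]

lemma eq_vertexState {n w : ℕ} {x : Wire n w → Bool} (h : (workWires n w).any x = false) :
    x = vertexState w (vertexReg x) := by
  simp only [workWires, List.any_append, List.any_map, Bool.or_eq_false_iff, List.any_eq_false,
    List.mem_finRange, true_implies, Function.comp_apply] at h
  funext i
  rcases i with (i | i) | (i | i | i)
  · simp [vertexState, content, vertexReg]
  · simpa [vertexState, content] using h.1 i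
  · simpa [vertexState, content] using h.2.1 i
  · simpa [vertexState, content] using h.2.2 roleWire (by simp)
  · simpa [vertexState, content] using h.2.2 flagWire (by simp)

lemma vertexState_injective {n w : ℕ} : Function.Injective (vertexState (n := n) w) :=
  fun _ _ h => (content_injective.1 h).1

/-- Bit strings that label no vertex are not removed by the reflection. They are never reached, as
the parent of a vertex and every result of the search are vertices. -/
lemma partOp_eq_zero_of_ne_label {P : Procedures} {H : Matrix (Fin N) (Fin N) ℂ}
    {G : SimpleGraph (Fin N)} {r : Fin N} (hD : DescribesTree P H G r) (hG : G.IsTree) (hN : 2 ≤ N)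
    {L : ℕ} (a : PartIndex L) {v : BitVec (labelBits N)} (hv : ∀ i : Fin N, v ≠ label i)
    (j : Fin N) :
    partOp a.toPart (L + 1) P (vertexState (markBits L) v) (vertexState (markBits L) (label j)) =
      0 := by
  cases hi : isChild P a.toPart.parity v <;> cases hj : isChild P a.toPart.parity (label j)
  · exact partOp_center_center P _ _ a.precision_le hj hi
  · rw [partOp_center_child P _ _ a.precision_le hj hi, if_neg]
    intro hl
    obtain ⟨u, -, -, hu⟩ := hD.exists_parent (hD.ne_root_of_isGood hl.2.1)
    exact hv u (hl.1.trans hu)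
  · rw [partOp_child_center P _ _ a.precision_le hi hj, if_neg]
    intro hl
    obtain ⟨u, hu⟩ := hD.exists_childVec hG hN j a.toPart.precision
      (cumulative P a.toPart.precision (label j) (positionVec P v))
    exact hv u (hl.2.2.symm.trans hu)
  · exact partOp_child_child P _ _ hj hi

/-- Without leakage the encoded space is invariant, and on it the two pieces with coefficient `4 *
h` add up to `8 * h` times a part. -/
lemma hamOp_mul_codeMat {P : Procedures} {H : Matrix (Fin N) (Fin N) ℂ}
    {G : SimpleGraph (Fin N)} {r : Fin N} (hD : DescribesTree P H G r) (hG : G.IsTree) (hN : 2 ≤ N)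
    (L : ℕ) (h : ℝ) : hamOp (n := labelBits N) L h P * codeMat N L = codeMat N L * roundedHam N L h P := by
  ext x j
  have e1 : ∑ y, hamOp L h P x y * codeMat N L y j =
      hamOp L h P x (vertexState (markBits L) (label j)) := by
    simp [codeMat]
  have e2 : ∑ i, codeMat N L x i * roundedHam N L h P i j =
      ∑ i, if x = vertexState (markBits L) (label i) then roundedHam N L h P i j else 0 := by
    simp [codeMat]
  have e3 : hamOp L h P x (vertexState (markBits L) (label j)) = (4 * h : ℝ) * ∑ a : PartIndex L,
      if (workWires (labelBits N) (markBits L)).any x then 0 else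
        2 * partOp a.toPart (L + 1) P x (vertexState (markBits L) (label j)) := by
    rw [hamOp, Matrix.sum_apply, Fintype.sum_prod_type, Finset.mul_sum]
    refine Finset.sum_congr rfl fun a _ => ?_
    rw [Fintype.sum_bool, Matrix.smul_apply, Matrix.smul_apply,
      ← pieceOp_false_add_true L a P x _ (workWires_any_vertexState _)]
    simp only [Complex.real_smul]
    ring
  rw [Matrix.mul_apply, Matrix.mul_apply, e1, e2, e3]
  cases hx : (workWires (labelBits N) (markBits L)).any x
  · rw [eq_vertexState hx]
    by_cases hv : ∃ i : Fin N, vertexReg x = label i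
    · obtain ⟨i, hi⟩ := hv
      rw [hi, Finset.sum_eq_single i]
      · rw [if_pos rfl, roundedHam]
        simp only [Bool.false_eq_true, if_false, ← Finset.mul_sum]
        push_cast
        ring
      · intro b _ hb
        rw [if_neg]
        exact fun h' => hb (label_injective (vertexState_injective h')).symm
      · simp
    · push Not at hv
      rw [Finset.sum_eq_zero, Finset.sum_eq_zero, mul_zero]
      · intro i _
        rw [if_neg]
        exact fun h' => hv i (vertexState_injective h')
      · intro a _
        simp [partOp_eq_zero_of_ne_label hD hG hN a hv j]
  · rw [Finset.sum_eq_zero, Finset.sum_eq_zero, mul_zero]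
    · intro i _
      rw [if_neg]
      rintro rfl
      rw [workWires_any_vertexState] at hx
      simp at hx
    · simp

end Code

/-! ## Exponentials of matrices -/

section Exponentials

open scoped Matrix.Norms.L2Operator

variable {X Y : Type} [Fintype X] [DecidableEq X] [Fintype Y] [DecidableEq Y]

lemma norm_pow_sub_pow_le {A : Type} [NormedRing A] [NormOneClass A] {a b : A} (ha : ‖a‖ ≤ 1)
    (hb : ‖b‖ ≤ 1) (r : ℕ) : ‖a ^ r - b ^ r‖ ≤ r * ‖a - b‖ := by
  induction r with
  | zero => simp
  | succ r ih =>
    have e : a ^ (r + 1) - b ^ (r + 1) = a ^ r * (a - b) + (a ^ r - b ^ r) * b := by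
      rw [pow_succ, pow_succ]; noncomm_ring
    have h1 : ‖a ^ r‖ ≤ 1 := (norm_pow_le a r).trans (pow_le_one₀ (norm_nonneg a) ha)
    calc ‖a ^ (r + 1) - b ^ (r + 1)‖ ≤ ‖a ^ r‖ * ‖a - b‖ + ‖a ^ r - b ^ r‖ * ‖b‖ := by
          rw [e]
          exact (norm_add_le _ _).trans (add_le_add (norm_mul_le _ _) (norm_mul_le _ _))
      _ ≤ 1 * ‖a - b‖ + r * ‖a - b‖ * 1 := by gcongr
      _ = ((r + 1 : ℕ) : ℝ) * ‖a - b‖ := by push_cast; ring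

lemma exp_mul_of_mul_eq {A : Matrix X X ℂ} {B : Matrix Y Y ℂ} {J : Matrix X Y ℂ}
    (h : A * J = J * B) : NormedSpace.exp A * J = J * NormedSpace.exp B := by
  have hpow : ∀ k : ℕ, A ^ k * J = J * B ^ k := by
    intro k
    induction k with
    | zero => simp
    | succ k ih => rw [pow_succ, Matrix.mul_assoc, h, ← Matrix.mul_assoc, ih, pow_succ,
        Matrix.mul_assoc]
  have hA := NormedSpace.exp_series_hasSum_exp' (𝕂 := ℂ) A
  have hB := NormedSpace.exp_series_hasSum_exp' (𝕂 := ℂ) B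
  have h1 := hA.map (AddMonoidHom.mk' (fun M : Matrix X X ℂ => M * J) fun a b => Matrix.add_mul a b J)
    (continuous_id.matrix_mul continuous_const)
  have h2 := hB.map (AddMonoidHom.mk' (fun M : Matrix Y Y ℂ => J * M) fun a b => Matrix.mul_add J a b)
    (continuous_const.matrix_mul continuous_id)
  refine h1.unique ?_
  convert h2 using 1
  · funext k
    simp [hpow]
  · rfl

lemma norm_exp_hermitian_le {A : Matrix X X ℂ} (hA : A.IsHermitian) (τ : ℝ) :
    ‖NormedSpace.exp ((-(Complex.I * (τ : ℂ))) • A)‖ ≤ 1 :=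
  norm_unitary_le (exp_smul_hermitian_mem_unitary hA τ)

/-- Interpolate by `e ^ (-i s A) e ^ (-i (t - s) B)`. Its derivative in `s` is the difference of the
generators between two unitary factors. -/
lemma norm_exp_sub_exp_le {A B : Matrix X X ℂ} (hA : A.IsHermitian) (hB : B.IsHermitian) {t : ℝ}
    (ht : 0 ≤ t) : ‖NormedSpace.exp ((-(Complex.I * (t : ℂ))) • A) -
      NormedSpace.exp ((-(Complex.I * (t : ℂ))) • B)‖ ≤ ‖A - B‖ * t := by
  have hsmul : ∀ (M : Matrix X X ℂ) (s : ℝ),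
      s • ((-Complex.I) • M) = (-(Complex.I * (s : ℂ))) • M := by
    intro M s
    ext i j
    simp only [Matrix.smul_apply, smul_eq_mul, Complex.real_smul]
    ring
  have hder : ∀ s ∈ Set.Icc (0 : ℝ) t, HasDerivWithinAt (fun s : ℝ =>
      NormedSpace.exp (s • ((-Complex.I) • A)) * NormedSpace.exp ((t - s) • ((-Complex.I) • B)))
      (NormedSpace.exp (s • ((-Complex.I) • A)) * ((-Complex.I) • (A - B)) *
        NormedSpace.exp ((t - s) • ((-Complex.I) • B))) (Set.Icc 0 t) s := by
    intro s _
    have h1 := hasDerivAt_exp_smul_const ((-Complex.I) • A) s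
    have h2 := (hasDerivAt_exp_smul_const' ((-Complex.I) • B) (t - s)).scomp s
      ((hasDerivAt_id s).const_sub t)
    have h3 := (h1.mul h2).hasDerivWithinAt (s := Set.Icc 0 t)
    refine h3.congr_deriv ?_
    simp only [Function.comp_apply, neg_smul, one_smul, smul_sub]
    noncomm_ring
  have hbound : ∀ s ∈ Set.Ico (0 : ℝ) t, ‖NormedSpace.exp (s • ((-Complex.I) • A)) *
      ((-Complex.I) • (A - B)) * NormedSpace.exp ((t - s) • ((-Complex.I) • B))‖ ≤ ‖A - B‖ := by
    intro s _
    rw [hsmul, hsmul]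
    calc _ ≤ ‖NormedSpace.exp ((-(Complex.I * (s : ℂ))) • A)‖ * ‖(-Complex.I) • (A - B)‖ *
          ‖NormedSpace.exp ((-(Complex.I * ((t - s : ℝ) : ℂ))) • B)‖ :=
          (norm_mul_le _ _).trans (mul_le_mul_of_nonneg_right (norm_mul_le _ _) (norm_nonneg _))
      _ ≤ 1 * ‖(-Complex.I) • (A - B)‖ * 1 := by
          gcongr
          · exact norm_exp_hermitian_le hA s
          · exact norm_exp_hermitian_le hB (t - s)
      _ = ‖A - B‖ := by rw [norm_smul]; simp
  have := norm_image_sub_le_of_norm_deriv_le_segment' hder hbound t ⟨ht, le_rfl⟩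
  simpa [← hsmul] using this

/-- Summing the norms over all matrix units is crude but sufficient: the squared dimension is paid
for by `2 * n` additional digits of the weights. -/
lemma norm_le_of_entries_le {M : Matrix X X ℂ} {ε : ℝ} (h : ∀ i j, ‖M i j‖ ≤ ε) :
    ‖M‖ ≤ (Fintype.card X : ℝ) ^ 2 * ε := by
  have hone : ∀ i j : X, ‖(Matrix.single i j (1 : ℂ))‖ ≤ 1 := by
    intro i j
    have h1 : ‖(Matrix.single j j (1 : ℂ))‖ ≤ 1 := by
      rw [← Matrix.diagonal_single, Matrix.l2_opNorm_diagonal, pi_norm_le_iff_of_nonneg zero_le_one]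
      intro k
      rw [Pi.single_apply]
      split_ifs <;> simp
    have h2 := Matrix.l2_opNorm_conjTranspose_mul_self (Matrix.single i j (1 : ℂ))
    rw [Matrix.conjTranspose_single, Matrix.single_mul_single_same, star_one, one_mul] at h2
    nlinarith [norm_nonneg (Matrix.single i j (1 : ℂ))]
  rw [Matrix.matrix_eq_sum_single M]
  calc _ ≤ ∑ i, ∑ j, ‖Matrix.single i j (M i j)‖ :=
        (norm_sum_le _ _).trans (Finset.sum_le_sum fun i _ => norm_sum_le _ _)
    _ ≤ ∑ _i : X, ∑ _j : X, ε := by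
        gcongr with i _ j _
        have : Matrix.single i j (M i j) = M i j • Matrix.single i j (1 : ℂ) := by simp
        rw [this, norm_smul]
        calc _ ≤ ‖M i j‖ * 1 := by gcongr; exact hone i j
          _ ≤ ε := by rw [mul_one]; exact h i j
    _ = _ := by simp; ring

end Exponentials

/-! ## The simulation -/

section Encoding

/-- The data qubits among all qubits, the qubits of the vertex first. -/
def wireEmb {n w m : ℕ} (hm : n + n + (w + 2) ≤ m) : Wire n w ↪ Fin m :=
  ((Equiv.sumCongr finSumFinEquiv ((Equiv.sumCongr (Equiv.refl _) finTwoEquiv.symm).trans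
    finSumFinEquiv)).trans finSumFinEquiv).toEmbedding.trans (Fin.castLEEmb hm)

lemma wireEmb_vertexWire {n w m : ℕ} (hm : n + n + (w + 2) ≤ m) (i : Fin n) :
    (wireEmb hm (vertexWire i) : Fin m).1 = i := by
  simp [wireEmb]

lemma le_wireEmb {n w m : ℕ} (hm : n + n + (w + 2) ≤ m) {d : Wire n w}
    (hd : ∀ i, d ≠ vertexWire i) : n ≤ (wireEmb hm d).1 := by
  rcases d with (i | i) | d
  · exact absurd rfl (hd i)
  · simp [wireEmb]
  · simp [wireEmb]
    omega

variable {N : ℕ}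

lemma testBit_eq_false_of_le (j : Fin N) {i : ℕ} (hi : labelBits N ≤ i) :
    Nat.testBit j i = false :=
  Nat.testBit_lt_two_pow ((lt_two_pow_labelBits j.2).trans_le (Nat.pow_le_pow_right (by norm_num) hi))

lemma basisLabel_comp_wireEmb {w m : ℕ} (hm : labelBits N + labelBits N + (w + 2) ≤ m)
    (j : Fin N) : basisLabel m j ∘ wireEmb hm = vertexState w (label j) := by
  funext d
  by_cases hd : ∃ i, d = vertexWire i
  · obtain ⟨i, rfl⟩ := hd
    simp only [Function.comp_apply, basisLabel, wireEmb_vertexWire]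
    simp only [vertexState, content, label, Sum.elim_inl, BitVec.getLsbD_ofNat, i.2, decide_true,
      Bool.true_and]
  · push Not at hd
    rw [Function.comp_apply, basisLabel, testBit_eq_false_of_le j (le_wireEmb hm hd)]
    rcases d with (i | i) | (i | i | i)
    · exact absurd rfl (hd i)
    all_goals simp [vertexState, content]

lemma encode_eq_embState {L m : ℕ} (hm : labelBits N + labelBits N + (markBits L + 2) ≤ m)
    (ψ : Fin N → ℂ) : encode m ψ = embState (wireEmb hm) ((codeMat N L).mulVec ψ) := by
  have hout : ∀ (j : Fin N) l, l ∉ Set.range (wireEmb hm) → basisLabel m j l = false := by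
    intro j l hl
    refine testBit_eq_false_of_le j ?_
    by_contra h
    push Not at h
    exact hl ⟨vertexWire ⟨l, h⟩, Fin.ext (wireEmb_vertexWire hm _)⟩
  funext x
  simp only [encode, embState, Matrix.mulVec, dotProduct, codeMat, ite_mul, one_mul, zero_mul]
  split_ifs with hx
  · refine Finset.sum_congr rfl fun j _ => ?_
    congr 1
    rw [eq_iff_iff]
    constructor
    · rintro rfl
      exact basisLabel_comp_wireEmb hm j
    · intro h
      rw [← extend_comp_embedding _ x hx, h, ← basisLabel_comp_wireEmb hm j,
        extend_comp_embedding _ _ (hout j)]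
  · refine Finset.sum_eq_zero fun j _ => ?_
    rw [if_neg]
    rintro rfl
    exact hx (hout j)

lemma norm_codeMat_mulVec (L : ℕ) (ψ : Fin N → ℂ) :
    ‖WithLp.toLp 2 ((codeMat N L).mulVec ψ)‖ = ‖WithLp.toLp 2 ψ‖ := by
  rw [EuclideanSpace.norm_eq, EuclideanSpace.norm_eq]
  congr 1
  have hinj : Function.Injective fun j : Fin N => vertexState (markBits L) (label j) :=
    vertexState_injective.comp label_injective
  symm
  refine Finset.sum_of_injOn (fun j : Fin N => vertexState (markBits L) (label j)) hinj.injOn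
    (by simp) ?_ ?_
  · intro x _ hx
    have : (codeMat N L).mulVec ψ x = 0 := by
      rw [Matrix.mulVec, dotProduct]
      refine Finset.sum_eq_zero fun j _ => ?_
      rw [codeMat, if_neg, zero_mul]
      rintro rfl
      exact hx ⟨j, by simp, rfl⟩
    simp [this]
  · intro j _
    have : (codeMat N L).mulVec ψ (vertexState (markBits L) (label j)) = ψ j := by
      rw [Matrix.mulVec, dotProduct, Finset.sum_eq_single j]
      · simp [codeMat]
      · intro b _ hb
        rw [codeMat, if_neg (fun h => hb (hinj h).symm), zero_mul]
      · simp
    simp only [this]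

end Encoding

/-! ### The circuit and its total error. -/

section Circuit

open scoped Matrix.Norms.L2Operator
open ProductFormula

variable {n : ℕ}

/-- The pieces of the Hamiltonian, multiplied by `-i`. -/
noncomputable def generators (L : ℕ) (h : ℝ) (P : Procedures) :
    List (Matrix (Wire n (markBits L) → Bool) (Wire n (markBits L) → Bool) ℂ) :=
  (Finset.univ : Finset (PartIndex L × Bool)).toList.map fun a =>
    (-(Complex.I * ((4 * h : ℝ) : ℂ))) • pieceOp L a P

lemma smul_generator (L : ℕ) (h : ℝ) (P : Procedures) (a : PartIndex L × Bool) (τ : ℝ) :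
    τ • ((-(Complex.I * ((4 * h : ℝ) : ℂ))) • pieceOp (n := n) L a P) =
      (-(Complex.I * ((τ * (4 * h) : ℝ) : ℂ))) • pieceOp L a P := by
  ext i j
  simp only [Matrix.smul_apply, smul_eq_mul, Complex.real_smul]
  push_cast
  ring

lemma smul_sum_generators (L : ℕ) (h : ℝ) (P : Procedures) (τ : ℝ) :
    τ • (generators (n := n) L h P).sum = (-(Complex.I * (τ : ℂ))) • hamOp L h P := by
  rw [generators, Finset.sum_map_toList, Finset.smul_sum, hamOp, Finset.smul_sum]
  refine Finset.sum_congr rfl fun a _ => ?_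
  rw [smul_generator]
  ext i j
  simp only [Matrix.smul_apply, smul_eq_mul, Complex.real_smul]
  push_cast
  ring

lemma hamOp_isHermitian (L : ℕ) (h : ℝ) (P : Procedures) : (hamOp (n := n) L h P).IsHermitian := by
  rw [Matrix.IsHermitian, hamOp, Matrix.conjTranspose_sum]
  refine Finset.sum_congr rfl fun a _ => ?_
  rw [Matrix.conjTranspose_smul, (pieceOp_isHermitian L a P).eq, star_trivial]

lemma card_pieces (L : ℕ) :
    ((Finset.univ : Finset (PartIndex L × Bool)).toList).length = 16 * L := by
  rw [Finset.length_toList, Finset.card_univ]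
  simp
  ring

lemma sum_norm_generators_le (hn : 0 < n) (L : ℕ) {h : ℝ} (hh : 0 ≤ h) (P : Procedures) :
    ((generators (n := n) L h P).map fun Z => ‖Z‖).sum ≤ 64 * L * h := by
  rw [generators, List.map_map]
  refine (List.sum_le_card_nsmul _ (4 * h) ?_).trans (le_of_eq ?_)
  · intro x hx
    obtain ⟨a, -, rfl⟩ := List.mem_map.1 hx
    rw [Function.comp_apply, norm_smul]
    have h1 : ‖-(Complex.I * ((4 * h : ℝ) : ℂ))‖ = 4 * h := by
      rw [norm_neg, norm_mul, Complex.norm_I, one_mul, Complex.norm_real, Real.norm_eq_abs,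
        abs_of_nonneg (by positivity)]
    rw [h1]
    nlinarith [norm_pieceOp_le hn L a P]
  · rw [List.length_map, card_pieces]
    simp
    ring

lemma expProd_generators (L : ℕ) (h : ℝ) (P : Procedures) (b : Bool) (τ : ℝ) :
    expProd (if b then (generators (n := n) L h P).reverse else generators L h P) τ =
      ((if b then (Finset.univ : Finset (PartIndex L × Bool)).toList.reverse else
        (Finset.univ : Finset (PartIndex L × Bool)).toList).map fun a =>
          NormedSpace.exp ((-(Complex.I * ((τ * (4 * h) : ℝ) : ℂ))) • pieceOp L a P)).prod := by
  rw [expProd, generators]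
  cases b
  · simp only [Bool.false_eq_true, if_false, List.map_map, Function.comp_def, smul_generator]
  · simp only [if_true, ← List.map_reverse, List.map_map, Function.comp_def, smul_generator]

lemma eval_generators_impl {q : Polynomial ℕ} (hn : 0 < n) (l : Formula) (L : ℕ) (h τ : ℝ) :
    Impl n q (l.length * (16 * L * pieceCost q n L)) fun P =>
      l.eval (generators (n := n) L h P) τ := by
  simp only [Formula.eval, expProd_generators]
  refine Impl.list_prod l (O := fun x P => ((if x.2 then
    (Finset.univ : Finset (PartIndex L × Bool)).toList.reverse else
      (Finset.univ : Finset (PartIndex L × Bool)).toList).map fun a =>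
        NormedSpace.exp ((-(Complex.I * ((x.1 * τ * (4 * h) : ℝ) : ℂ))) • pieceOp L a P)).prod)
    fun x _ => ?_
  have := Impl.list_prod (n := n) (q := q) (c := pieceCost q n L) (if x.2 then
    (Finset.univ : Finset (PartIndex L × Bool)).toList.reverse else
      (Finset.univ : Finset (PartIndex L × Bool)).toList)
    (O := fun a P => NormedSpace.exp
      ((-(Complex.I * ((x.1 * τ * (4 * h) : ℝ) : ℂ))) • pieceOp (n := n) L a P))
    fun a _ => pieceOp_impl_exp hn L a _
  refine this.mono (le_of_eq ?_)
  congr 1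
  split_ifs
  · rw [List.length_reverse, card_pieces]
  · rw [card_pieces]

lemma norm_eval_generators_le (l : Formula) (L : ℕ) (h : ℝ) (P : Procedures) (τ : ℝ) :
    ‖l.eval (generators (n := n) L h P) τ‖ ≤ 1 := by
  refine norm_unitary_le (Submonoid.list_prod_mem _ fun U hU => ?_)
  obtain ⟨x, -, rfl⟩ := List.mem_map.1 hU
  rw [expProd_generators]
  refine Submonoid.list_prod_mem _ fun U hU => ?_
  obtain ⟨a, -, rfl⟩ := List.mem_map.1 hU
  exact exp_smul_hermitian_mem_unitary (pieceOp_isHermitian L a P) _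

/-- A bound on the error of a product formula. -/
def _root_.ProductFormula.Formula.HasOrder (l : Formula) (k : ℕ) : Prop :=
  ∀ (A : Type) [NormedRing A] [NormedAlgebra ℝ A] [CompleteSpace A] [NormOneClass A]
      [Algebra ℚ A] (Y : List A) (M : ℝ), (Y.map fun Z => ‖Z‖).sum ≤ M → ∀ τ : ℝ, 0 ≤ τ →
      ‖l.eval Y τ - NormedSpace.exp (τ • Y.sum)‖ ≤
        2 * (τ * (l.weight * M)) ^ (k + 2) * Real.exp (τ * (l.weight * M))

/-- Errors of contractions add up over the `r` segments. In each segment the scaled norm `X / r` is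
at most one, so the exponential in the error bound is at most 3. -/
lemma norm_eval_pow_sub_exp_le {l : Formula} {k : ℕ} (hl : l.HasOrder k) (hn : 0 < n)
    (L : ℕ) {h t : ℝ} (hh : 0 ≤ h) (ht : 0 ≤ t) (P : Procedures) {r : ℕ} (hr : 0 < r)
    (hX : l.weight * (64 * L * h) * t ≤ r) :
    ‖l.eval (generators (n := n) L h P) (t / r) ^ r -
      NormedSpace.exp ((-(Complex.I * (t : ℂ))) • hamOp L h P)‖ ≤
        6 * (l.weight * (64 * L * h) * t) ^ (k + 2) / r ^ (k + 1) := by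
  set X := l.weight * (64 * L * h) * t with hXdef
  have hr' : (0 : ℝ) < r := by exact_mod_cast hr
  have hX0 : 0 ≤ X := by have := l.one_le_weight; positivity
  have hexp : NormedSpace.exp ((-(Complex.I * (t : ℂ))) • hamOp (n := n) L h P) =
      NormedSpace.exp ((t / r : ℝ) • (generators (n := n) L h P).sum) ^ r := by
    rw [← Matrix.exp_nsmul, smul_sum_generators]
    congr 1
    ext i j
    simp only [Matrix.smul_apply, smul_eq_mul, nsmul_eq_mul]
    have : (r : ℂ) ≠ 0 := by exact_mod_cast hr.ne'
    push_cast
    field_simp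
  rw [hexp]
  have h1 := hl _ (generators (n := n) L h P) (64 * L * h) (sum_norm_generators_le hn L hh P)
    (t / r) (by positivity)
  have e : t / r * (l.weight * (64 * L * h)) = X / r := by rw [hXdef]; ring
  rw [e] at h1
  have h2 : Real.exp (X / r) ≤ 3 := by
    have : X / r ≤ 1 := (div_le_one hr').2 hX
    exact (Real.exp_le_exp.2 this).trans (by linarith [Real.exp_one_lt_d9])
  have h3 : ‖NormedSpace.exp ((t / r : ℝ) • (generators (n := n) L h P).sum)‖ ≤ 1 := by
    rw [smul_sum_generators]
    exact norm_exp_hermitian_le (hamOp_isHermitian L h P) _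
  refine (norm_pow_sub_pow_le (norm_eval_generators_le l L h P _) h3 r).trans ?_
  calc _ ≤ r * (2 * (X / r) ^ (k + 2) * 3) := by
        gcongr
        exact h1.trans (by gcongr)
    _ = 6 * X ^ (k + 2) / r ^ (k + 1) := by
        rw [div_pow, pow_succ (r : ℝ) (k + 1)]
        field_simp
        ring

lemma norm_mulVec_le {X : Type} [Fintype X] [DecidableEq X] (A : Matrix X X ℂ) (ψ : X → ℂ) :
    ‖WithLp.toLp 2 (A.mulVec ψ)‖ ≤ ‖A‖ * ‖WithLp.toLp 2 ψ‖ :=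
  A.l2_opNorm_mulVec (WithLp.toLp 2 ψ)

lemma eq_zero_of_labelBits_eq_zero {N : ℕ} (hN : labelBits N = 0) {H : Matrix (Fin N) (Fin N) ℂ}
    {G : SimpleGraph (Fin N)} (hHG : IsGraphOfNonzeroEntries G H) : H = 0 := by
  have h1 : N ≤ 1 := by
    have := Nat.le_pow_clog (b := 2) (by norm_num) N
    rw [labelBits] at hN
    simpa [hN] using this
  ext i j
  by_contra h
  have : i = j := Fin.ext (by omega)
  exact G.ne_of_adj ((hHG i j).1 h) this

lemma simulates_nil_of_eq_zero {N n : ℕ} (P : Procedures) (m : ℕ) {t δ : ℝ} (hδ : 0 ≤ δ) :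
    Simulates P ([] : Circuit n m) (0 : Matrix (Fin N) (Fin N) ℂ) t δ := by
  intro ψ
  rw [smul_zero, NormedSpace.exp_zero, Matrix.one_mulVec]
  simp only [Circuit.run, List.foldl_nil, sub_self]
  simp only [WithLp.toLp_zero, norm_zero]
  positivity

/-- A circuit for the evolution, for a given number of digits of the weights and a given number of
segments of the evolution. -/
theorem exists_circuit_simulates (q : Polynomial ℕ) {l : Formula} {k : ℕ} (hl : l.HasOrder k)
    {N : ℕ} (hn : 0 < labelBits N) {h t δ : ℝ} (hh : 0 < h) (ht : 0 ≤ t) (L : ℕ)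
    {r : ℕ} (hr : 0 < r) (hX : l.weight * (64 * L * h) * t ≤ r)
    (hsplit : 6 * (l.weight * (64 * L * h) * t) ^ (k + 2) / r ^ (k + 1) ≤ δ / 2)
    (hround : 4 ^ labelBits N * (10 * h / 2 ^ (L + 1)) * t ≤ δ / 2) :
    ∃ (m : ℕ) (A : Circuit (labelBits N) m), labelBits N ≤ m ∧
      A.cost q ≤ r * (l.length * (16 * L * pieceCost q (labelBits N) L)) ∧
      ∀ (H : Matrix (Fin N) (Fin N) ℂ) (G : SimpleGraph (Fin N)) (r : Fin N) (P : Procedures),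
        H.IsHermitian → IsGraphOfNonzeroEntries G H → G.IsTree → maxColumnNorm H = h →
        DescribesTree P H G r → Simulates P A H t δ := by
  obtain ⟨s, hs⟩ := (eval_generators_impl (q := q) hn l L h (t / r)).pow r
  set n := labelBits N with hndef
  let m := n + n + (markBits L + 2) + s
  have hm : n + n + (markBits L + 2) ≤ m := Nat.le_add_right _ _
  obtain ⟨A, hA, hA'⟩ := hs m (wireEmb hm) (by simp [m])
  refine ⟨m, A, by omega, hA, fun H G root P hHh hHG hG hHn hD ψ => ?_⟩
  have hN : 2 ≤ N := by
    by_contra hN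
    have : labelBits N = 0 := by
      rw [labelBits, Nat.clog_of_right_le_one (by omega)]
    omega
  rw [encode_eq_embState hm, encode_eq_embState hm, hA', ← embState_sub, norm_embState]
  set J := codeMat N L
  set S := l.eval (generators (n := n) L h P) (t / r) ^ r
  set E := NormedSpace.exp ((-(Complex.I * (t : ℂ))) • hamOp (n := n) L h P) with hE
  set F := NormedSpace.exp ((-(Complex.I * (t : ℂ))) • roundedHam N L h P) with hF
  set F' := NormedSpace.exp ((-(Complex.I * (t : ℂ))) • H)
  -- The encoding intertwines the evolution on the qubits with that of the rounded Hamiltonian, so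
  -- the total error splits into that of the product formula and that of rounding.
  have hEJ : E * J = J * F := by
    refine exp_mul_of_mul_eq ?_
    rw [Matrix.smul_mul, hamOp_mul_codeMat hD hG hN, Matrix.mul_smul]
  have e1 : S.mulVec (J.mulVec ψ) - J.mulVec (F'.mulVec ψ) =
      (S - E).mulVec (J.mulVec ψ) + J.mulVec ((F - F').mulVec ψ) := by
    have : E.mulVec (J.mulVec ψ) = J.mulVec (F.mulVec ψ) := by
      rw [Matrix.mulVec_mulVec, hEJ, ← Matrix.mulVec_mulVec]
    rw [Matrix.sub_mulVec, Matrix.sub_mulVec, Matrix.mulVec_sub, this]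
    abel
  have h1 : ‖S - E‖ ≤ δ / 2 := (norm_eval_pow_sub_exp_le hl hn L hh.le ht P hr hX).trans hsplit
  have h2 : ‖F - F'‖ ≤ δ / 2 := by
    refine (norm_exp_sub_exp_le (roundedHam_isHermitian N L h P) hHh ht).trans (le_trans ?_ hround)
    refine mul_le_mul_of_nonneg_right ?_ ht
    refine (norm_le_of_entries_le (ε := 10 * h / 2 ^ (L + 1)) fun i j => ?_).trans ?_
    · rw [← hHn]
      exact hD.norm_roundedHam_sub_le hG hHG hHh (hHn ▸ hh) hn L i j
    · refine mul_le_mul_of_nonneg_right ?_ (by positivity)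
      rw [Fintype.card_fin, show (4 : ℝ) = 2 ^ 2 by norm_num, ← pow_mul, mul_comm, pow_mul]
      refine pow_le_pow_left₀ (by positivity) ?_ 2
      exact_mod_cast Nat.le_pow_clog (by norm_num) N
  rw [e1, WithLp.toLp_add]
  calc _ ≤ ‖WithLp.toLp 2 ((S - E).mulVec (J.mulVec ψ))‖ +
        ‖WithLp.toLp 2 (J.mulVec ((F - F').mulVec ψ))‖ := norm_add_le _ _
    _ ≤ δ / 2 * ‖WithLp.toLp 2 ψ‖ + δ / 2 * ‖WithLp.toLp 2 ψ‖ := by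
        refine add_le_add ?_ ?_
        · refine (norm_mulVec_le _ _).trans ?_
          rw [norm_codeMat_mulVec]
          gcongr
        · rw [norm_codeMat_mulVec]
          refine (norm_mulVec_le _ _).trans ?_
          gcongr
    _ = δ * ‖WithLp.toLp 2 ψ‖ := by ring

end Circuit

/-! ## The choice of the parameters -/

section Parameters

open ProductFormula

/-- The number of digits needed beyond those for the labels. -/
noncomputable def extraDigits (δ x : ℝ) : ℕ := ⌈Real.logb 2 (10 * x / δ + 1)⌉₊

lemma le_two_pow_extraDigits {δ x : ℝ} (hδ : 0 < δ) (hx : 0 ≤ x) :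
    10 * x / δ ≤ 2 ^ extraDigits δ x := by
  have h1 : 0 < 10 * x / δ + 1 := by positivity
  have h2 : Real.logb 2 (10 * x / δ + 1) ≤ (extraDigits δ x : ℝ) := Nat.le_ceil _
  rw [Real.logb_le_iff_le_rpow (by norm_num) h1, Real.rpow_natCast] at h2
  linarith

lemma eval_le_pow (q : Polynomial ℕ) {y : ℕ} (hy : 1 ≤ y) :
    q.eval y ≤ q.eval 1 * y ^ q.natDegree := by
  rw [Polynomial.eval_eq_sum_range, Polynomial.eval_eq_sum_range, Finset.sum_mul]
  refine Finset.sum_le_sum fun i hi => ?_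
  rw [one_pow, mul_one]
  exact Nat.mul_le_mul_left _ (Nat.pow_le_pow_right hy (by simp at hi; omega))

/-- The cost of a segment is bounded by a power. -/
lemma pieceCost_le (q : Polynomial ℕ) {n L y : ℕ} (hy : n + markBits L + 3 ≤ y) :
    pieceCost q n L ≤ 300 * (q.eval 1 + 1) * y ^ (q.natDegree + 3) := by
  have h1 : q.eval (n + markBits L) ≤ q.eval 1 * y ^ q.natDegree :=
    (eval_mono_nat q (by omega : n + markBits L ≤ y)).trans (eval_le_pow q (by omega))
  have h2 : (n + markBits L + 1) ^ 3 ≤ y ^ 3 := Nat.pow_le_pow_left (by omega) 3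
  have h3 : 1 ≤ y ^ q.natDegree := Nat.one_le_pow _ _ (by omega)
  have h4 : y ≤ y ^ 3 := Nat.le_self_pow (by norm_num) y
  have h5 : 3 ≤ y := by omega
  unfold pieceCost
  have h6 : (q.eval (n + markBits L) + 1) * (n + markBits L + 1) ^ 3 ≤
      (q.eval 1 + 1) * y ^ (q.natDegree + 3) := by
    calc _ ≤ (q.eval 1 * y ^ q.natDegree + y ^ q.natDegree) * y ^ 3 :=
          Nat.mul_le_mul (by omega) h2
      _ = _ := by ring
  have h7 : y ≤ (q.eval 1 + 1) * y ^ (q.natDegree + 3) := by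
    calc y ≤ y ^ (q.natDegree + 3) := Nat.le_self_pow (by omega) y
      _ ≤ _ := Nat.le_mul_of_pos_left _ (by omega)
  rw [mul_assoc]
  omega

variable (q : Polynomial ℕ) (δ : ℝ)

/-- The exponent in the polylogarithmic factor of the cost. -/
def costDegree : ℕ := q.natDegree + 6

/-- The cost for a product formula of given order, up to a factor that is polynomial in the number
of qubits. -/
noncomputable def formulaCost (l : Formula) (k : ℕ) (x : ℝ) : ℝ :=
  (2 * (12 / δ + 1) * (64 * l.weight) ^ 2 * (l.length + 1) * (4800 * (q.eval 1 + 1))) *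
    ((extraDigits δ x : ℝ) + 1) ^ costDegree q * (x + 1) ^ (1 + 1 / ((k : ℝ) + 1))

/-- The factor of the cost that is polynomial in the number of qubits. -/
noncomputable def qubitFactor (n : ℕ) : ℕ := (10 * (2 * n + 1)) ^ costDegree q

/-- With `B = (X + 1) ^ (1 + 1 / (k + 1))` one has `B ^ (k + 1) = (X + 1) ^ (k + 2)`, so `r` is `C *
B` rounded up. -/
lemma exists_segments {C X : ℝ} (hC : 1 ≤ C) (hX : 0 ≤ X) (k : ℕ) : ∃ r : ℕ, 0 < r ∧ X ≤ r ∧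
    X ^ (k + 2) / r ^ (k + 1) ≤ 1 / C ∧
    (r : ℝ) ≤ 2 * C * (X + 1) ^ (1 + 1 / ((k : ℝ) + 1)) := by
  set B := (X + 1) ^ (1 + 1 / ((k : ℝ) + 1)) with hB
  have hk : (0 : ℝ) < (k : ℝ) + 1 := by positivity
  have hXB : X + 1 ≤ B := by
    conv_lhs => rw [← Real.rpow_one (X + 1)]
    exact Real.rpow_le_rpow_of_exponent_le (by linarith) (by
      have : 0 ≤ 1 / ((k : ℝ) + 1) := by positivity
      linarith)
  have hBpow : B ^ (k + 1) = (X + 1) ^ (k + 2) := by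
    rw [hB, ← Real.rpow_natCast, ← Real.rpow_mul (by linarith), ← Real.rpow_natCast]
    congr 1
    push_cast
    field_simp
    ring
  have hCB : 1 ≤ C * B := by nlinarith
  refine ⟨⌈C * B⌉₊, Nat.ceil_pos.2 (by linarith), ?_, ?_, ?_⟩
  · refine le_trans ?_ (Nat.le_ceil _)
    nlinarith
  · have h1 : (C * B) ^ (k + 1) ≤ (⌈C * B⌉₊ : ℝ) ^ (k + 1) :=
      pow_le_pow_left₀ (by linarith) (Nat.le_ceil _) _
    have h2 : C * (X + 1) ^ (k + 2) ≤ (C * B) ^ (k + 1) := by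
      rw [mul_pow, hBpow]
      gcongr
      exact le_self_pow₀ hC (by omega)
    rw [div_le_div_iff₀ (by linarith [pow_pos (by linarith : 0 < C * B) (k + 1)]) (by linarith)]
    have h3 : X ^ (k + 2) ≤ (X + 1) ^ (k + 2) := pow_le_pow_left₀ hX (by linarith) _
    nlinarith
  · have := (Nat.ceil_lt_add_one (by linarith : 0 ≤ C * B)).le
    linarith

theorem exists_circuit_cost_le {l : Formula} {k : ℕ} (hl : l.HasOrder k) {N : ℕ}
    (hn : 0 < labelBits N) {h t : ℝ} (hh : 0 < h) (ht : 0 ≤ t) (hδ : 0 < δ) :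
    ∃ (m : ℕ) (A : Circuit (labelBits N) m), labelBits N ≤ m ∧
      (A.cost q : ℝ) ≤ qubitFactor q (labelBits N) * formulaCost q δ l k (h * t) ∧
      ∀ (H : Matrix (Fin N) (Fin N) ℂ) (G : SimpleGraph (Fin N)) (r : Fin N) (P : Procedures),
        H.IsHermitian → IsGraphOfNonzeroEntries G H → G.IsTree → maxColumnNorm H = h →
        DescribesTree P H G r → Simulates P A H t δ := by
  set n := labelBits N with hndef
  set x := h * t with hx
  have hx0 : 0 ≤ x := by positivity
  set ℓ := extraDigits δ x with hℓ
  -- The `2 * n` digits absorb the factor `4 ^ n` in the rounding error, the other `ℓ` digits the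
  -- factor `10 * x / δ`.
  set L := 2 * n + ℓ with hL
  -- The splitting error is at most `6 / C`, which has to be at most `δ / 2`.
  set C := 12 / δ + 1 with hC
  have hC1 : 1 ≤ C := by have : 0 < 12 / δ := by positivity
                         linarith
  have hw := l.one_le_weight
  set X := l.weight * (64 * L * h) * t with hX
  have hX0 : 0 ≤ X := by positivity
  obtain ⟨r, hr, hXr, hsplit, hrle⟩ := exists_segments hC1 hX0 k
  have hround : 4 ^ n * (10 * h / 2 ^ (L + 1)) * t ≤ δ / 2 := by
    have h1 := le_two_pow_extraDigits hδ hx0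
    rw [← hℓ, div_le_iff₀ hδ] at h1
    have e : (2 : ℝ) ^ (L + 1) = 4 ^ n * 2 ^ ℓ * 2 := by
      rw [hL, pow_succ, pow_add, pow_mul]; norm_num
    have e2 : (4 : ℝ) ^ n * (10 * h / 2 ^ (L + 1)) * t = 10 * x / (2 ^ ℓ * 2) := by
      rw [e, hx]; field_simp
    rw [e2, div_le_div_iff₀ (by positivity) (by norm_num)]
    linarith
  obtain ⟨m, A, hm, hA, hsim⟩ := exists_circuit_simulates q hl hn hh ht L hr hXr (by
    rw [mul_div_assoc]
    have : 1 / C ≤ δ / 12 := by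
      rw [div_le_div_iff₀ (by linarith) (by norm_num), hC]
      have : δ * (12 / δ + 1) = 12 + δ := by field_simp
      linarith
    linarith) hround
  refine ⟨m, A, hm, ?_, hsim⟩
  -- The product `u * v` bounds all sizes that occur and separates the dependence on the qubits from
  -- that on `x`. Two of its powers come from the number of segments, one from `L`, the others from
  -- the cost of a piece, in total `costDegree q`.
  set u := 10 * (2 * n + 1) with hu
  set v := ℓ + 1 with hv
  have huv : n + markBits L + 3 ≤ u * v := by
    rw [hu, hv, markBits, hL]
    nlinarith [Nat.zero_le (n * ℓ)]
  have hLuv : L ≤ u * v := by rw [hu, hv, hL]; nlinarith [Nat.zero_le (n * ℓ)]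
  have hpc := pieceCost_le q huv
  have h1uv : 1 ≤ u * v := by omega
  have hcost : (A.cost q : ℝ) ≤ r * ((l.length + 1) * (16 * L *
      (300 * (q.eval 1 + 1) * (u * v) ^ (q.natDegree + 3)))) := by
    calc (A.cost q : ℝ) ≤ ((r * (l.length * (16 * L * pieceCost q n L)) : ℕ) : ℝ) := by
          exact_mod_cast hA
      _ ≤ ((r * ((l.length + 1) * (16 * L *
        (300 * (q.eval 1 + 1) * (u * v) ^ (q.natDegree + 3)))) : ℕ) : ℝ) := by
          gcongr
          omega
      _ = _ := by push_cast; ring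
  have hrle' : (r : ℝ) ≤ 2 * C * ((64 * l.weight) ^ 2 * (u * v) ^ 2 *
      (x + 1) ^ (1 + 1 / ((k : ℝ) + 1))) := by
    refine hrle.trans ?_
    have h1 : X + 1 ≤ (64 * l.weight * (u * v)) * (x + 1) := by
      have e : X = 64 * l.weight * L * x := by rw [hX, hx]; ring
      have h2 : (L : ℝ) ≤ u * v := by exact_mod_cast hLuv
      have h3 : (1 : ℝ) ≤ u * v := by exact_mod_cast h1uv
      have h4 : 64 * l.weight * L * x ≤ 64 * l.weight * (u * v) * x := by gcongr
      nlinarith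
    have h2 : (X + 1) ^ (1 + 1 / ((k : ℝ) + 1)) ≤
        (64 * l.weight * (u * v)) ^ 2 * (x + 1) ^ (1 + 1 / ((k : ℝ) + 1)) := by
      have h3 : (1 : ℝ) ≤ u * v := by exact_mod_cast h1uv
      have h4 : 1 ≤ 64 * l.weight * (u * v) := by nlinarith
      calc _ ≤ ((64 * l.weight * (u * v)) * (x + 1)) ^ (1 + 1 / ((k : ℝ) + 1)) :=
            Real.rpow_le_rpow (by linarith) h1 (by positivity)
        _ = (64 * l.weight * (u * v)) ^ (1 + 1 / ((k : ℝ) + 1)) *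
            (x + 1) ^ (1 + 1 / ((k : ℝ) + 1)) := Real.mul_rpow (by linarith) (by linarith)
        _ ≤ _ := by
            gcongr
            rw [← Real.rpow_natCast]
            refine Real.rpow_le_rpow_of_exponent_le h4 ?_
            have : 1 / ((k : ℝ) + 1) ≤ 1 := by
              rw [div_le_one (by positivity)]
              linarith [Nat.cast_nonneg (α := ℝ) k]
            push_cast
            linarith
    calc _ ≤ 2 * C * ((64 * l.weight * (u * v)) ^ 2 * (x + 1) ^ (1 + 1 / ((k : ℝ) + 1))) := by
          gcongr
      _ = _ := by ring
  refine hcost.trans ?_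
  have hL' : (L : ℝ) ≤ u * v := by exact_mod_cast hLuv
  calc _ ≤ 2 * C * ((64 * l.weight) ^ 2 * (u * v) ^ 2 * (x + 1) ^ (1 + 1 / ((k : ℝ) + 1))) *
        ((l.length + 1) * (16 * (u * v) *
          (300 * (q.eval 1 + 1) * (u * v) ^ (q.natDegree + 3)))) := by
        gcongr
    _ = _ := by
        rw [formulaCost, qubitFactor, costDegree, ← hu, ← hC, ← hℓ]
        have : ((v : ℕ) : ℝ) = (ℓ : ℝ) + 1 := by rw [hv]; push_cast; ring
        rw [← this]
        push_cast
        ring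

end Parameters

/-! ## The growth of the cost -/

section Growth

open ProductFormula

variable (q : Polynomial ℕ) (δ : ℝ)

lemma formulaCost_mono {δ : ℝ} (hδ : 0 < δ) (l : Formula) (k : ℕ) {x y : ℝ} (hx : 0 ≤ x)
    (hxy : x ≤ y) : formulaCost q δ l k x ≤ formulaCost q δ l k y := by
  have h1 : extraDigits δ x ≤ extraDigits δ y := by
    refine Nat.ceil_mono (Real.logb_le_logb_of_le (by norm_num) (by positivity) ?_)
    gcongr
  have h2 := l.one_le_weight
  unfold formulaCost
  gcongr

/-- This bound makes the excess of the exponent nonnegative for `x ≥ 2`. The factor `l.length + 1`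
in `formulaCost` avoids a separate treatment of an empty formula. -/
lemma add_one_le_formulaCost {δ : ℝ} (hδ : 0 < δ) (l : Formula) (k : ℕ) {x : ℝ} (hx : 0 ≤ x) :
    x + 1 ≤ formulaCost q δ l k x := by
  have h1 : 1 ≤ 12 / δ + 1 := by have : 0 < 12 / δ := by positivity
                                 linarith
  have h2 : 1 ≤ (64 * l.weight) ^ 2 := one_le_pow₀ (by linarith [l.one_le_weight])
  have h3 : (1 : ℝ) ≤ l.length + 1 := by linarith [Nat.cast_nonneg (α := ℝ) l.length]
  have h4 : (1 : ℝ) ≤ 4800 * ((q.eval 1 : ℕ) + 1) := by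
    linarith [Nat.cast_nonneg (α := ℝ) (q.eval 1)]
  have h5 : (1 : ℝ) ≤ ((extraDigits δ x : ℝ) + 1) ^ costDegree q :=
    one_le_pow₀ (by linarith [Nat.cast_nonneg (α := ℝ) (extraDigits δ x)])
  have h6 : x + 1 ≤ (x + 1) ^ (1 + 1 / ((k : ℝ) + 1)) := by
    conv_lhs => rw [← Real.rpow_one (x + 1)]
    refine Real.rpow_le_rpow_of_exponent_le (by linarith) ?_
    have : 0 ≤ 1 / ((k : ℝ) + 1) := by positivity
    linarith
  have h7 : 1 ≤ 2 * (12 / δ + 1) * (64 * l.weight) ^ 2 * (l.length + 1) *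
      (4800 * ((q.eval 1 : ℕ) + 1)) :=
    one_le_mul_of_one_le_of_one_le (one_le_mul_of_one_le_of_one_le
      (one_le_mul_of_one_le_of_one_le (by linarith) h2) h3) h4
  rw [formulaCost]
  calc x + 1 ≤ (x + 1) ^ (1 + 1 / ((k : ℝ) + 1)) := h6
    _ ≤ _ := le_mul_of_one_le_left (by linarith) (one_le_mul_of_one_le_of_one_le h7 h5)

/-- The number of extra digits grows like `log x`, and any power of the logarithm, with all
constants of a fixed formula, is eventually below `x ^ s`. -/
lemma eventually_formulaCost_le {δ : ℝ} (hδ : 0 < δ) (l : Formula) (k : ℕ) {s : ℝ} (hs : 0 < s) :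
    ∀ᶠ x : ℝ in atTop, formulaCost q δ l k x ≤ x ^ (1 + 1 / ((k : ℝ) + 1) + s) := by
  set K := 2 * (12 / δ + 1) * (64 * l.weight) ^ 2 * (l.length + 1) *
    (4800 * ((q.eval 1 : ℕ) + 1) : ℝ) with hK
  have hw := l.one_le_weight
  have hK0 : 0 < K := by positivity
  set D := costDegree q
  set b := 1 + 1 / ((k : ℝ) + 1) with hb
  have hb2 : b ≤ 2 := by
    have : 1 / ((k : ℝ) + 1) ≤ 1 := by
      rw [div_le_one (by positivity)]
      linarith [Nat.cast_nonneg (α := ℝ) k]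
    linarith
  have hb0 : 0 ≤ b := by positivity
  have hlog := (isLittleO_log_rpow_rpow_atTop (D : ℝ) hs).bound
    (show 0 < 1 / (K * 8 ^ D * 4) by positivity)
  filter_upwards [hlog, eventually_ge_atTop (2 : ℝ), eventually_ge_atTop (10 / δ + 1)] with x h1 h2 h3
  have hlogx : Real.log 2 ≤ Real.log x := Real.log_le_log (by norm_num) h2
  have hlog2 := Real.log_two_gt_d9
  have hv : (extraDigits δ x : ℝ) + 1 ≤ 8 * Real.log x := by
    have h4 : 0 ≤ Real.logb 2 (10 * x / δ + 1) := by
      refine Real.logb_nonneg (by norm_num) ?_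
      have : 0 ≤ 10 * x / δ := by positivity
      linarith
    have h5 := (Nat.ceil_lt_add_one h4).le
    have h6 : Real.logb 2 (10 * x / δ + 1) ≤ 2 * (2 * Real.log x) := by
      rw [Real.logb, div_le_iff₀ (by linarith)]
      have h7 : Real.log (10 * x / δ + 1) ≤ 2 * Real.log x := by
        rw [← Real.log_rpow (by linarith)]
        refine Real.log_le_log (by positivity) ?_
        norm_num
        have e : 10 * x / δ = 10 / δ * x := by ring
        rw [e]
        nlinarith
      nlinarith
    have : (extraDigits δ x : ℝ) ≤ Real.logb 2 (10 * x / δ + 1) + 1 := h5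
    linarith
  have hlog0 : 0 ≤ Real.log x := by linarith
  have hx1 : (x + 1) ^ b ≤ 4 * x ^ b := by
    calc (x + 1) ^ b ≤ (2 * x) ^ b := Real.rpow_le_rpow (by linarith) (by linarith) hb0
      _ = 2 ^ b * x ^ b := Real.mul_rpow (by norm_num) (by linarith)
      _ ≤ 4 * x ^ b := by
          gcongr
          calc (2 : ℝ) ^ b ≤ 2 ^ (2 : ℝ) := Real.rpow_le_rpow_of_exponent_le (by norm_num) hb2
            _ = 4 := by norm_num
  rw [Real.norm_of_nonneg (by apply Real.rpow_nonneg; linarith),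
    Real.norm_of_nonneg (by apply Real.rpow_nonneg; linarith), Real.rpow_natCast] at h1
  calc formulaCost q δ l k x = K * ((extraDigits δ x : ℝ) + 1) ^ D * (x + 1) ^ b := rfl
    _ ≤ K * (8 * Real.log x) ^ D * (4 * x ^ b) := by gcongr
    _ = K * 8 ^ D * 4 * Real.log x ^ D * x ^ b := by rw [mul_pow]; ring
    _ ≤ K * 8 ^ D * 4 * (1 / (K * 8 ^ D * 4) * x ^ s) * x ^ b := by gcongr
    _ = x ^ (b + s) := by
        clear_value b
        rw [Real.rpow_add (by linarith)]
        field_simp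

/-- The least cost among the product formulas of order at most `x`. -/
noncomputable def leastCost (l : ℕ → Formula) (x : ℝ) : ℝ :=
  (Finset.range (⌈x⌉₊ + 1)).inf' ⟨0, by simp⟩ fun k => formulaCost q δ (l k) k x

/-- The excess of the exponent of the cost over one. -/
noncomputable def excess (l : ℕ → Formula) (x : ℝ) : ℝ :=
  if x < 2 then -1 else Real.log (leastCost q δ l x) / Real.log x - 1

lemma le_leastCost {δ : ℝ} (hδ : 0 < δ) (l : ℕ → Formula) {x : ℝ} (hx : 0 ≤ x) :
    x + 1 ≤ leastCost q δ l x :=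
  Finset.le_inf' _ _ fun k _ => add_one_le_formulaCost q hδ (l k) k hx

/-- For any fixed order `k` the least cost is eventually at most that of order `k`, although the
constants may grow arbitrarily with `k`: the range of orders only has to exhaust all naturals as `x`
grows. -/
lemma tendsto_excess {δ : ℝ} (hδ : 0 < δ) (l : ℕ → Formula) :
    Tendsto (excess q δ l) atTop (𝓝 0) := by
  refine tendsto_order.2 ⟨fun a ha => ?_, fun a ha => ?_⟩
  · filter_upwards [eventually_ge_atTop (2 : ℝ)] with x hx
    have h1 : 0 < Real.log x := Real.log_pos (by linarith)
    have h2 : Real.log x ≤ Real.log (leastCost q δ l x) :=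
      Real.log_le_log (by linarith) (by linarith [le_leastCost q hδ l (by linarith : 0 ≤ x)])
    rw [excess, if_neg (by linarith)]
    have : 1 ≤ Real.log (leastCost q δ l x) / Real.log x := (one_le_div h1).2 h2
    linarith
  -- Half of `a` is left for the order `k`, half for the polylogarithmic factor.
  · obtain ⟨k, hk⟩ := exists_nat_one_div_lt (show 0 < a / 2 by linarith)
    filter_upwards [eventually_ge_atTop (2 : ℝ), eventually_ge_atTop (k : ℝ),
      eventually_formulaCost_le q hδ (l k) k (show 0 < a / 2 by linarith)] with x hx hxk hG
    have h1 : 0 < Real.log x := Real.log_pos (by linarith)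
    have hpos : 0 < leastCost q δ l x := by linarith [le_leastCost q hδ l (by linarith : 0 ≤ x)]
    have h2 : leastCost q δ l x ≤ x ^ (1 + 1 / ((k : ℝ) + 1) + a / 2) := by
      refine (Finset.inf'_le _ ?_).trans hG
      have : k ≤ ⌈x⌉₊ := by exact_mod_cast hxk.trans (Nat.le_ceil x)
      simp; omega
    have h3 := Real.log_le_log hpos h2
    rw [Real.log_rpow (by linarith)] at h3
    have h4 : Real.log (leastCost q δ l x) / Real.log x ≤ 1 + 1 / ((k : ℝ) + 1) + a / 2 :=
      (div_le_iff₀ h1).2 h3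
    rw [excess, if_neg (by linarith)]
    linarith

lemma rpow_excess {δ : ℝ} (hδ : 0 < δ) (l : ℕ → Formula) {x : ℝ} (hx : 2 ≤ x) :
    x ^ (1 + excess q δ l x) = leastCost q δ l x := by
  have h1 : Real.log x ≠ 0 := (Real.log_pos (by linarith)).ne'
  have hpos : 0 < leastCost q δ l x := by linarith [le_leastCost q hδ l (by linarith : 0 ≤ x)]
  rw [excess, if_neg (by linarith), Real.rpow_def_of_pos (by linarith), add_sub_cancel,
    mul_div_cancel₀ _ h1, Real.exp_log hpos]

end Growth

theorem theorem4 (q : Polynomial ℕ) (δ : ℝ) (hδ : 0 < δ) :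
    ∃ (p : Polynomial ℕ) (η : ℝ → ℝ), Tendsto η atTop (𝓝 0) ∧
      ∀ (N : ℕ) (h t : ℝ), 0 ≤ h → 0 ≤ t →
        ∃ (m : ℕ) (A : Circuit (labelBits N) m), labelBits N ≤ m ∧
          (A.cost q : ℝ) ≤ ((p.eval (labelBits N) : ℕ) : ℝ) * (h * t) ^ (1 + η (h * t)) ∧
          ∀ (H : Matrix (Fin N) (Fin N) ℂ) (G : SimpleGraph (Fin N)) (r : Fin N) (P : Procedures),
            H.IsHermitian → IsGraphOfNonzeroEntries G H → G.IsTree → maxColumnNorm H = h →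
            DescribesTree P H G r → Simulates P A H t δ := by
  choose l hl using ProductFormula.exists_formula_norm_sub_le
  -- This constant covers all `x < 2`, where the exponent `1 + η x` is set to zero so that the power
  -- of `x` is one, even for `x = 0`.
  set c := ⌈formulaCost q δ (l 0) 0 2⌉₊
  have hc : formulaCost q δ (l 0) 0 2 ≤ c := Nat.le_ceil _
  have hc1 : (1 : ℝ) ≤ c := by
    linarith [add_one_le_formulaCost q hδ (l 0) 0 (by norm_num : (0 : ℝ) ≤ 2)]
  refine ⟨Polynomial.C c * (10 * (2 * Polynomial.X + 1)) ^ costDegree q, excess q δ l,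
    tendsto_excess q hδ l, fun N h t hh ht => ?_⟩
  have hp : (Polynomial.C c * (10 * (2 * Polynomial.X + 1)) ^ costDegree q).eval (labelBits N) =
      c * qubitFactor q (labelBits N) := by
    simp [qubitFactor]
  rw [hp]
  have hx : 0 ≤ h * t := mul_nonneg hh ht
  -- With at most one vertex, or with `h = 0`, the Hamiltonian vanishes and the empty circuit will
  -- do.
  by_cases h0 : labelBits N = 0 ∨ h = 0
  · refine ⟨labelBits N, [], le_rfl, ?_, fun H G r P _ hHG _ hHh _ => ?_⟩
    · simp only [Circuit.cost, List.map_nil, List.sum_nil, Nat.cast_zero]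
      positivity
    · have hH : H = 0 := by
        rcases h0 with h0 | h0
        · exact eq_zero_of_labelBits_eq_zero h0 hHG
        · ext i j
          exact norm_le_zero_iff.1 ((norm_entry_le H i j).trans (by rw [hHh, h0]))
      rw [hH]
      exact simulates_nil_of_eq_zero P _ hδ.le
  push Not at h0
  have hn : 0 < labelBits N := Nat.pos_of_ne_zero h0.1
  have hh' : 0 < h := lt_of_le_of_ne hh h0.2.symm
  rcases lt_or_ge (h * t) 2 with hx2 | hx2
  · obtain ⟨m, A, hm, hA, hsim⟩ := exists_circuit_cost_le q δ (hl 0) hn hh' ht hδ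
    refine ⟨m, A, hm, hA.trans ?_, hsim⟩
    rw [excess, if_pos hx2, add_neg_cancel, Real.rpow_zero, mul_one, Nat.cast_mul, mul_comm]
    gcongr
    exact (formulaCost_mono q hδ (l 0) 0 hx hx2.le).trans hc
  -- For `x ≥ 2` the exponent is defined such that `x ^ (1 + η x)` is the least cost. An order
  -- attaining the minimum gives the circuit.
  · obtain ⟨k, -, hk⟩ := Finset.exists_mem_eq_inf' (s := Finset.range (⌈h * t⌉₊ + 1)) ⟨0, by simp⟩
      fun k => formulaCost q δ (l k) k (h * t)
    obtain ⟨m, A, hm, hA, hsim⟩ := exists_circuit_cost_le q δ (hl k) hn hh' ht hδ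
    refine ⟨m, A, hm, hA.trans ?_, hsim⟩
    have hk' : leastCost q δ l (h * t) = formulaCost q δ (l k) k (h * t) := hk
    rw [rpow_excess q hδ l hx2, hk', Nat.cast_mul, mul_assoc]
    have h1 := add_one_le_formulaCost q hδ (l k) k hx
    exact le_mul_of_one_le_left (mul_nonneg (Nat.cast_nonneg _) (by linarith)) hc1
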